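/- Let $n>1$ and $m>0$ be integers, $0\le\sigma<\infty$, $1<p<\infty$ and $m+\sigma>n/p$, and let $\alpha$ be a real number such that neither $n+\alpha$ nor $n+\alpha+m$ is a negative integer. Let $B$ be the open unit ball of $\mathbb C^n$, $S=\partial B$ its boundary sphere, $\langle z,w\rangle=\sum_j z_j\overline{w_j}$, $dv$ Lebesgue measure on $B$ normalized so that $v(B)=1$, and $d\lambda(z)=(1-|z|^2)^{-n-1}\,dv(z)$. The Besov–Sobolev space $B_p^\sigma(B)$ consists of the holomorphic functions $f$ on $B$ with $$\sum_{k=0}^{m-1}|f^{(k)}(0)|^p+\int_B\bigl|(1-|z|^2)^{m+\sigma}f^{(m)}(z)\bigr|^p\,d\lambda(z)<\infty,$$ where $f^{(k)}$ is the complex derivative of order $k$. It is normed by $$\|f\|_{B_p^\sigma(B)}^p=\int_B|R^{\alpha,m}f(z)|^p(1-|z|^2)^{mp+\sigma p-n-1}\,dv(z),$$ where, if $f=\sum_{k\ge0}f_k$ is the homogeneous expansion of $f$ about the origin, $$R^{\alpha,m}f=\sum_{k=0}^\infty\frac{\Gamma(n+1+\alpha)\,\Gamma(n+1+k+\alpha+m)}{\Gamma(n+1+\alpha+m)\,\Gamma(n+1+k+\alpha)}\,f_k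 .$$ A positive Borel measure $\mu$ on $B$ is called a Carleson measure for $B_p^\sigma(B)$ if there is a constant $C>0$ such that $\int_B|f|^p\,d\mu\le C\|f\|_{B_p^\sigma(B)}^p$ for all $f\in B_p^\sigma(B)$. For $\xi\in S$ and $\delta>0$ let $Q_\delta(\xi)=\{z\in B:|1-\langle z,\xi\rangle|<\delta\}$. For $s>0$, $\mu$ is called an $s$-Carleson measure if $\sup\{\mu(Q_\delta(\xi))/\delta^{ns}:\xi\in S,\ \delta>0\}<\infty$. Let $\mu$ be a positive Borel measure on $B$. (i) Let $\sigma>0$. If $\mu$ is a Carleson measure for $B_p^\sigma(B)$, then $\mu$ is a $\frac{\sigma p}{n}$-Carleson measure. Conversely, if $\varepsilon>0$ and $\mu$ is a $\frac{\sigma p+\varepsilon}{n}$-Carleson measure, then $\mu$ is a Carleson measure for $B_p^\sigma(B)$. (ii) Let $\sigma=0$. If $\mu$ is a Carleson measure for $B_p^0(B)$, then $$\sup\Bigl\{\frac{\mu(Q_\delta(\xi))}{\log^{1-p}\frac2\delta}:\xi\in S,\ 0<\delta<2\Bigr\}<\infty.$$ Conversely, if $\varepsilon>0$ and $$\sup\Bigl\{\frac{\mu(Q_\delta(\xi))}{\log^{1-p-\varepsilon}\frac2\delta}:\xi\in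 S,\ 0<\delta<2\Bigr\}<\infty,$$ then $\mu$ is a Carleson measure for $B_p^0(B)$. -/

import Mathlib

open MeasureTheory Metric
open scoped ENNReal

noncomputable section

namespace BesovSobolev

/-- The complex Euclidean space `ℂⁿ`. -/
abbrev Cn (n : ℕ) : Type := EuclideanSpace ℂ (Fin n)

/-- The open unit ball `B` of `ℂⁿ`. -/
def unitBall (n : ℕ) : Set (Cn n) := ball 0 1

/-- The class `H(B)` of holomorphic functions in `B`; a function on `B` is represented by any
function on `ℂⁿ` with these values on `B`, and only the values on `B` are ever used. -/
def IsHolomorphicOnBall (n : ℕ) (f : Cn n → ℂ) : Prop := DifferentiableOn ℂ f (unitBall n)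

/-- Normalized Lebesgue measure `dv` of `B`, with `v(B) = 1`. -/
def normalizedVolume (n : ℕ) : Measure (Cn n) :=
  (volume (unitBall n))⁻¹ • volume.restrict (unitBall n)

/-- The invariant measure `dλ(z) = (1 - |z|²)^{-n-1} dv(z)` of `B`. -/
def invariantMeasure (n : ℕ) : Measure (Cn n) :=
  (normalizedVolume n).withDensity
    fun z => ENNReal.ofReal ((1 - ‖z‖ ^ 2) ^ (-(n : ℝ) - 1))

/-- The quantity `∑_{k<m} |f^{(k)}(0)|^p + ∫_B |(1 - |z|²)^{m+σ} f^{(m)}(z)|^p dλ(z)`, where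
`f^{(k)}` is the complex derivative of order `k`, a `k`-linear form measured by its
operator norm. -/
def derivativeEnergy (n m : ℕ) (σ p : ℝ) (f : Cn n → ℂ) : ℝ≥0∞ :=
  ∑ k ∈ Finset.range m, ENNReal.ofReal (‖iteratedFDeriv ℂ k f 0‖ ^ p) +
    ∫⁻ z, ENNReal.ofReal
      (((1 - ‖z‖ ^ 2) ^ ((m : ℝ) + σ) * ‖iteratedFDeriv ℂ m f z‖) ^ p) ∂(invariantMeasure n)

/-- The Besov-Sobolev space `B_p^σ(B)`, defined by derivatives of order `m`. -/
def MemBesov (n m : ℕ) (σ p : ℝ) (f : Cn n → ℂ) : Prop :=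
  IsHolomorphicOnBall n f ∧ derivativeEnergy n m σ p f < ∞

/-- The term `f_k` of degree `k` in the homogeneous expansion `f = ∑ f_k` about the origin. -/
def homogeneousTerm (n : ℕ) (f : Cn n → ℂ) (k : ℕ) (z : Cn n) : ℂ :=
  (k.factorial : ℂ)⁻¹ * iteratedFDeriv ℂ k f 0 (fun _ => z)

/-- The radial operator `R^{α,t}`, which multiplies `f_k` by
`Γ(n+1+α) Γ(n+1+k+α+t) / (Γ(n+1+α+t) Γ(n+1+k+α))`. -/
def radialOp (n : ℕ) (α t : ℝ) (f : Cn n → ℂ) (z : Cn n) : ℂ :=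
  ∑' k : ℕ,
    ((Real.Gamma (n + 1 + α) * Real.Gamma (n + 1 + k + α + t) /
        (Real.Gamma (n + 1 + α + t) * Real.Gamma (n + 1 + k + α)) : ℝ) : ℂ) *
      homogeneousTerm n f k z

/-- `‖f‖^p = ∫_B |R^{α,m} f(z)|^p (1 - |z|²)^{mp + σp - n - 1} dv(z)`. -/
def besovNormPow (n m : ℕ) (σ p α : ℝ) (f : Cn n → ℂ) : ℝ≥0∞ :=
  ∫⁻ z, ENNReal.ofReal
    (‖radialOp n α m f z‖ ^ p * (1 - ‖z‖ ^ 2) ^ ((m : ℝ) * p + σ * p - n - 1))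
    ∂(normalizedVolume n)

/-- `μ` is a Carleson measure for `B_p^σ(B)`: there is `C > 0` with
`∫_B |f|^p dμ ≤ C ‖f‖^p` for all `f` in `B_p^σ(B)`. Only the part of `μ` on `B` matters. -/
def IsCarlesonForBesov (n m : ℕ) (σ p α : ℝ) (μ : Measure (Cn n)) : Prop :=
  ∃ C : ℝ, 0 < C ∧ ∀ f : Cn n → ℂ, MemBesov n m σ p f →
    ∫⁻ z in unitBall n, ENNReal.ofReal (‖f z‖ ^ p) ∂μ ≤
      ENNReal.ofReal C * besovNormPow n m σ p α f

/-- `Q_δ(ξ) = {z ∈ B : |1 - ⟨z, ξ⟩| < δ}`, with `⟨z, ξ⟩ = ∑ z_j conj(ξ_j)`. -/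
def carlesonTent (n : ℕ) (δ : ℝ) (ξ : Cn n) : Set (Cn n) :=
  {z | z ∈ unitBall n ∧ ‖1 - inner ℂ ξ z‖ < δ}

/-- `μ` is an `s`-Carleson measure: `sup {μ(Q_δ(ξ)) / δ^{ns} : ξ ∈ S, δ > 0} < ∞`. -/
def IsPowerCarleson (n : ℕ) (s : ℝ) (μ : Measure (Cn n)) : Prop :=
  ⨆ ξ ∈ sphere (0 : Cn n) 1, ⨆ δ ∈ Set.Ioi (0 : ℝ),
    μ (carlesonTent n δ ξ) / ENNReal.ofReal (δ ^ ((n : ℝ) * s)) < ∞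

/-- `sup {μ(Q_δ(ξ)) / log^a(2/δ) : ξ ∈ S, 0 < δ < 2} < ∞`; the range of `δ` is the one on which
`log(2/δ)` is positive. -/
def IsLogCarleson (n : ℕ) (a : ℝ) (μ : Measure (Cn n)) : Prop :=
  ⨆ ξ ∈ sphere (0 : Cn n) 1, ⨆ δ ∈ Set.Ioo (0 : ℝ) 2,
    μ (carlesonTent n δ ξ) / ENNReal.ofReal (Real.log (2 / δ) ^ a) < ∞

end BesovSobolev

end

/-!
Write `R` for the radial derivative and `A = n + 1 + α`. Since the order `m` is an integer, the
quotients of Gamma functions defining `R^{α,m}` are polynomials in `k`, so that `R^{α,m}` is a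
constant multiple of the differential operator `(A + R)(A + 1 + R) ⋯ (A + m - 1 + R)`
(`radialOp_eq_eulerIter`), and the norm of `f` is a weighted `L^p` norm of the image of `f` under
this operator.

*Necessity.* The functions `(1 - ⟨z,w⟩)^{-b}` with an integer `b > σ` (for `σ > 0`) and
`-log(1 - ⟨z,w⟩)` (for `σ = 0`), with `w = (1 - δ) ξ`, are large on the tent `Q_δ(ξ)`. The operator
maps them to functions of the same kind (`exists_eulerIter_testFun`), so their norms are bounded by
integrals of powers of `|1 - ⟨z,w⟩|⁻¹` against `(1 - |z|²)^c dv`. Decomposing the ball into the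
dyadic shells `Q_{2^{j+1} δ}(ξ) \ Q_{2^j δ}(ξ)` and using `v_c(Q_δ(ξ)) ≲ δ^{n+1+c}`
(`exists_ballWeight_carlesonTent_le`) gives a power of `δ`, or `log (2/δ)` in the critical case
(`exists_lintegral_kernel_le_rpow`, `exists_lintegral_kernel_le_log`). Testing the Carleson
inequality on these functions yields the tent conditions.

*Sufficiency.* Put `g = (A + R) ⋯ (A + m - 1 + R) f`. The multipliers
`1 / ((A + k) ⋯ (A + k + m - 1))` inverting the operator are beta integrals, hence, up to
exponentially small errors, moments of `(1 - t)^{m-1}` times a bounded function on `[1/2, 1]`.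
Therefore `|f(z)|` is at most a constant times `∫_{1/2}^1 (1 - t)^{m-1} |g(t z)| dt` plus the
supremum of `|g|` on a compact ball (`exists_norm_le_integral_eulerIter`).
Hölder's inequality, with an auxiliary weight `h` for which `h(x)^{1/(p-1)} / x` is integrable at
`0`, bounds `|f(z)|^p` by an integral of `|g(t z)|^p`
(`radial_lintegral_rpow_le`). The mean value inequality replaces `|g(t z)|^p` by an average over a
nonisotropic neighbourhood of `t z` (`exists_enorm_rpow_le_lintegral_anisoBall`). After integrating
in `z` against `μ` and interchanging the integrals, for fixed `w` only points `z` in a tent over `w`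
of size comparable to `1 - |w|²` contribute (`exists_lintegral_averagingKernel_le`), and the growth
condition `μ(Q_δ(ξ)) ≲ δ^{σp} h(δ)` bounds the result by the norm of `f`
(`isCarlesonForBesov_of_tent_bound`). The choices `h(x) = x^ε`, and a power `-(p - 1 + ε)` of a
logarithm, give the two converses.
-/

noncomputable section

namespace BesovSobolev

open scoped ContDiff Topology
open Set

variable {n : ℕ}

/-! ### Holomorphic functions on the ball and the radial operator -/

lemma fderiv_apply_eq_circleIntegral {U : Set (Cn n)} (hU : IsOpen U) {f : Cn n → ℂ}
    (hf : DifferentiableOn ℂ f U) (v z : Cn n) {r : ℝ} (hr : 0 < r)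
    (hz : ∀ t ∈ closedBall (0 : ℂ) r, z + t • v ∈ U) :
    fderiv ℂ f z v =
      (2 * Real.pi * Complex.I : ℂ)⁻¹ • ∮ t in C(0, r), (1 / t ^ 2) • f (z + t • v) := by
  have hline : ∀ t : ℂ, HasDerivAt (fun t : ℂ => z + t • v) v t := fun t => by
    simpa using ((hasDerivAt_id t).smul_const v).const_add z
  have hd : ∀ t ∈ closedBall (0 : ℂ) r,
      HasDerivAt (fun t : ℂ => f (z + t • v)) (fderiv ℂ f (z + t • v) v) t := fun t ht =>
    ((hf.differentiableAt (hU.mem_nhds (hz t ht))).hasFDerivAt).comp_hasDerivAt t (hline t)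
  have h0 : deriv (fun t : ℂ => f (z + t • v)) 0 = fderiv ℂ f z v := by
    simpa using (hd 0 (by simp [hr.le])).deriv
  have := DifferentiableOn.deriv_eq_smul_circleIntegral (f := fun t : ℂ => f (z + t • v)) hr
    (fun t ht => (hd t ht).differentiableAt.differentiableWithinAt)
  rw [h0] at this
  simp only [sub_zero] at this
  rw [this, smul_smul, inv_mul_cancel₀, one_smul]
  simp [Real.pi_ne_zero]

/-- A holomorphic function of several variables has holomorphic directional derivatives: Cauchy's
formula on a complex line writes the derivative as an integral of translates of the function,
which may be differentiated under the integral sign. -/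
lemma differentiableOn_fderiv_apply {U : Set (Cn n)} (hU : IsOpen U) {f : Cn n → ℂ}
    (hf : DifferentiableOn ℂ f U) (v : Cn n) :
    DifferentiableOn ℂ (fun z => fderiv ℂ f z v) U := by
  intro z₀ hz₀
  obtain ⟨ε, hε, hball⟩ := Metric.isOpen_iff.1 hU z₀ hz₀
  set ρ := ε / 4 with hρ
  have hρ0 : 0 < ρ := by positivity
  set r := ρ / (‖v‖ + 1) with hrdef
  have hr : 0 < r := by positivity
  have hrv : r * ‖v‖ ≤ ρ := by
    rw [hrdef, div_mul_eq_mul_div, div_le_iff₀ (by positivity)]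
    nlinarith [norm_nonneg v]
  have hcirc : ∀ z ∈ ball z₀ ρ, ∀ t ∈ closedBall (0 : ℂ) r, z + t • v ∈ closedBall z₀ (2 * ρ) := by
    intro z hz t ht
    rw [mem_closedBall, dist_eq_norm]
    rw [mem_ball, dist_eq_norm] at hz
    rw [mem_closedBall, dist_zero_right] at ht
    calc ‖z + t • v - z₀‖ = ‖(z - z₀) + t • v‖ := by congr 1; abel
      _ ≤ ‖z - z₀‖ + ‖t • v‖ := norm_add_le _ _
      _ ≤ ρ + r * ‖v‖ := by rw [norm_smul]; gcongr
      _ ≤ 2 * ρ := by linarith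
  have hsub : closedBall z₀ (3 * ρ) ⊆ U := fun y hy => hball (by
    rw [mem_closedBall] at hy; rw [mem_ball]; linarith)
  have hsub2 : closedBall z₀ (2 * ρ) ⊆ U := fun y hy => hball (by
    rw [mem_closedBall] at hy; rw [mem_ball]; linarith)
  obtain ⟨M, hM⟩ := (isCompact_closedBall z₀ (3 * ρ)).exists_bound_of_continuousOn
    (hf.continuousOn.mono hsub)
  have hM0 : 0 ≤ M := (norm_nonneg _).trans (hM z₀ (by simp; positivity))
  have hder : ∀ y ∈ closedBall z₀ (2 * ρ), ‖fderiv ℂ f y‖ ≤ (2 * M + 1) / ρ := by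
    intro y hy
    have hyb : ball y ρ ⊆ closedBall z₀ (3 * ρ) := fun x hx => by
      rw [mem_ball] at hx
      rw [mem_closedBall] at *
      linarith [dist_triangle x y z₀]
    refine Complex.norm_fderiv_le_div_of_mapsTo_ball (hf.mono (hyb.trans hsub)) ?_ hρ0
    intro x hx
    rw [mem_closedBall, dist_eq_norm]
    linarith [norm_sub_le (f x) (f y), hM x (hyb hx), hM y (hyb (mem_ball_self hρ0))]
  have key : ∀ z ∈ ball z₀ ρ, fderiv ℂ f z v =
      (2 * Real.pi * Complex.I : ℂ)⁻¹ • ∮ t in C(0, r), (1 / t ^ 2) • f (z + t • v) := fun z hz =>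
    fderiv_apply_eq_circleIntegral hU hf v z hr fun t ht => hsub2 (hcirc z hz t ht)
  have hev : (fun z => fderiv ℂ f z v) =ᶠ[𝓝 z₀] fun z =>
      (2 * Real.pi * Complex.I : ℂ)⁻¹ • ∮ t in C(0, r), (1 / t ^ 2) • f (z + t • v) := by
    filter_upwards [ball_mem_nhds z₀ hρ0] with z hz using key z hz
  refine (DifferentiableAt.congr_of_eventuallyEq ?_ hev).differentiableWithinAt
  suffices h : DifferentiableAt ℂ
      (fun z => ∮ t in C(0, r), (1 / t ^ 2) • f (z + t • v)) z₀ from h.fun_const_smul _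
  have hmem : ∀ θ, circleMap 0 r θ ∈ closedBall (0 : ℂ) r := fun θ => by
    simp [abs_of_pos hr]
  have hcoef : Continuous fun θ : ℝ =>
      deriv (circleMap (0 : ℂ) r) θ * (1 / (circleMap (0 : ℂ) r θ) ^ 2) := by
    have h1 : Continuous (deriv (circleMap (0 : ℂ) r)) := by
      simp only [funext (deriv_circleMap (0 : ℂ) r)]
      exact (continuous_circleMap 0 r).mul continuous_const
    exact h1.mul (continuous_const.div ((continuous_circleMap 0 r).pow 2)
      fun θ => pow_ne_zero 2 (circleMap_ne_center hr.ne'))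
  have hcont : ∀ z ∈ ball z₀ ρ, Continuous fun θ : ℝ => f (z + circleMap 0 r θ • v) := fun z hz =>
    (hf.continuousOn.mono hsub2).comp_continuous
      (continuous_const.add ((continuous_circleMap 0 r).smul continuous_const))
      fun θ => hcirc z hz _ (hmem θ)
  obtain ⟨K, hK⟩ := (isCompact_uIcc (a := (0 : ℝ)) (b := 2 * Real.pi)).exists_bound_of_continuousOn
    hcoef.continuousOn
  have hK0 : 0 ≤ K := (norm_nonneg _).trans (hK 0 left_mem_uIcc)
  refine (intervalIntegral.hasFDerivAt_integral_of_dominated_of_fderiv_le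
    (bound := fun _ => K * ((2 * M + 1) / ρ)) (s := ball z₀ ρ)
    (F := fun z θ => deriv (circleMap (0 : ℂ) r) θ •
      ((1 / (circleMap (0 : ℂ) r θ) ^ 2) • f (z + circleMap 0 r θ • v)))
    (F' := fun z θ => (deriv (circleMap (0 : ℂ) r) θ * (1 / (circleMap (0 : ℂ) r θ) ^ 2)) •
      fderiv ℂ f (z + circleMap 0 r θ • v))
    (ball_mem_nhds z₀ hρ0) ?_ ?_ ?_ ?_ ?_ ?_).differentiableAt
  · filter_upwards [ball_mem_nhds z₀ hρ0] with z hz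
    simp only [smul_smul]
    exact (hcoef.smul (hcont z hz)).aestronglyMeasurable
  · simp only [smul_smul]
    exact (hcoef.smul (hcont z₀ (mem_ball_self hρ0))).intervalIntegrable _ _
  · refine (hcoef.measurable.aestronglyMeasurable).smul ?_
    have : Measurable fun θ : ℝ => z₀ + circleMap 0 r θ • v :=
      (continuous_const.add ((continuous_circleMap 0 r).smul continuous_const)).measurable
    exact ((measurable_fderiv ℂ f).comp this).aestronglyMeasurable
  · refine Filter.Eventually.of_forall fun θ hθ z hz => ?_
    rw [norm_smul]
    exact mul_le_mul (hK θ (uIoc_subset_uIcc hθ)) (hder _ (hcirc z hz _ (hmem θ)))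
      (norm_nonneg _) hK0
  · exact intervalIntegrable_const
  · refine Filter.Eventually.of_forall fun θ _ z hz => ?_
    simp only [smul_smul]
    have h1 : HasFDerivAt f (fderiv ℂ f (z + circleMap 0 r θ • v)) (z + circleMap 0 r θ • v) :=
      (hf.differentiableAt (hU.mem_nhds (hsub2 (hcirc z hz _ (hmem θ))))).hasFDerivAt
    have h2 : HasFDerivAt (fun z => z + circleMap 0 r θ • v) (ContinuousLinearMap.id ℂ (Cn n)) z :=
      (hasFDerivAt_id z).add_const _
    exact (h1.comp z h2).fun_const_smul
      (deriv (circleMap (0 : ℂ) r) θ * (1 / (circleMap (0 : ℂ) r θ) ^ 2))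

lemma contDiffOn_of_differentiableOn {U : Set (Cn n)} (hU : IsOpen U) {f : Cn n → ℂ}
    (hf : DifferentiableOn ℂ f U) : ContDiffOn ℂ ∞ f U := by
  rw [contDiffOn_infty]
  intro k
  induction k generalizing f with
  | zero => exact contDiffOn_zero.2 hf.continuousOn
  | succ k ih =>
    have : ((k + 1 : ℕ) : WithTop ℕ∞) = (k : WithTop ℕ∞) + 1 := by norm_cast
    rw [this, contDiffOn_succ_iff_fderiv_of_isOpen hU]
    refine ⟨hf, fun h => by simp at h, ?_⟩
    rw [contDiffOn_clm_apply]
    exact fun v => ih (differentiableOn_fderiv_apply hU hf v)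

lemma isOpen_unitBall : IsOpen (unitBall n) := isOpen_ball

lemma mem_unitBall {z : Cn n} : z ∈ unitBall n ↔ ‖z‖ < 1 := by simp [unitBall]

lemma smul_mem_unitBall {z : Cn n} {t : ℂ} (h : ‖t‖ * ‖z‖ < 1) : t • z ∈ unitBall n := by
  rw [mem_unitBall, norm_smul]; exact h

lemma hasDerivAt_slice {f : Cn n → ℂ} (hf : IsHolomorphicOnBall n f) {z : Cn n} {t : ℂ}
    (ht : ‖t‖ * ‖z‖ < 1) :
    HasDerivAt (fun t : ℂ => f (t • z)) (fderiv ℂ f (t • z) z) t := by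
  have h := (hf.differentiableAt (isOpen_unitBall.mem_nhds (smul_mem_unitBall ht))).hasFDerivAt
  have h2 : HasDerivAt (fun t : ℂ => t • z) z t := by
    simpa using (hasDerivAt_id t).smul_const z
  exact h.comp_hasDerivAt t h2

lemma differentiableOn_slice {f : Cn n → ℂ} (hf : IsHolomorphicOnBall n f) {z : Cn n} {r : ℝ}
    (hr : r * ‖z‖ ≤ 1) : DifferentiableOn ℂ (fun t : ℂ => f (t • z)) (ball 0 r) := by
  intro t ht
  refine (hasDerivAt_slice hf ?_).differentiableAt.differentiableWithinAt
  rw [mem_ball_zero_iff] at ht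
  rcases eq_or_ne z 0 with rfl | hz
  · simp
  · exact (mul_lt_mul_of_pos_right ht (norm_pos_iff.2 hz)).trans_le hr

lemma homogeneousTerm_eq_iteratedDeriv {f : Cn n → ℂ} (hf : IsHolomorphicOnBall n f) (k : ℕ)
    (z : Cn n) :
    homogeneousTerm n f k z =
      (k.factorial : ℂ)⁻¹ * iteratedDeriv k (fun t : ℂ => f (t • z)) 0 := by
  have hsm := contDiffOn_of_differentiableOn isOpen_unitBall hf
  let L : ℂ →L[ℂ] Cn n := ContinuousLinearMap.toSpanSingleton ℂ z
  have hL : (fun t : ℂ => f (t • z)) = f ∘ L := by ext t; simp [L]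
  have hpre : IsOpen (L ⁻¹' unitBall n) := isOpen_unitBall.preimage L.continuous
  have h0 : L 0 ∈ unitBall n := by simp [mem_unitBall]
  have key := ContinuousLinearMap.iteratedFDerivWithin_comp_right (i := k) (n := ∞) L hsm
    isOpen_unitBall.uniqueDiffOn hpre.uniqueDiffOn (x := 0) h0 (by exact_mod_cast le_top)
  rw [iteratedFDerivWithin_of_isOpen k hpre h0, iteratedFDerivWithin_of_isOpen k isOpen_unitBall h0]
    at key
  rw [homogeneousTerm, iteratedDeriv_eq_iteratedFDeriv, hL, key]
  simp [L, ContinuousMultilinearMap.compContinuousLinearMap_apply]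

lemma homogeneousTerm_smul (f : Cn n → ℂ) (k : ℕ) (t : ℂ) (z : Cn n) :
    homogeneousTerm n f k (t • z) = t ^ k * homogeneousTerm n f k z := by
  rw [homogeneousTerm, homogeneousTerm,
    (iteratedFDeriv ℂ k f 0).map_smul_univ (fun _ => t) (fun _ => z)]
  simp [mul_left_comm]

lemma hasSum_homogeneousTerm {f : Cn n → ℂ} (hf : IsHolomorphicOnBall n f) {z : Cn n}
    (hz : z ∈ unitBall n) : HasSum (fun k => homogeneousTerm n f k z) (f z) := by
  rw [mem_unitBall] at hz
  have hz0 := norm_nonneg z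
  have hr : 2 / (1 + ‖z‖) * ‖z‖ ≤ 1 := by
    rw [div_mul_eq_mul_div, div_le_one (by positivity)]; linarith
  have h1 : (1 : ℂ) ∈ ball (0 : ℂ) (2 / (1 + ‖z‖)) := by
    rw [mem_ball_zero_iff, norm_one, lt_div_iff₀ (by positivity)]; linarith
  have := Complex.hasSum_taylorSeries_on_ball (differentiableOn_slice hf hr) h1
  simpa [homogeneousTerm_eq_iteratedDeriv hf] using this

/-- The first-order operator `a + R`, where `R F(z) = F'(z) z` is the radial derivative. -/
def eulerOp (a : ℝ) (F : Cn n → ℂ) (z : Cn n) : ℂ := a * F z + fderiv ℂ F z z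

lemma IsHolomorphicOnBall.eulerOp {F : Cn n → ℂ} (hF : IsHolomorphicOnBall n F) (a : ℝ) :
    IsHolomorphicOnBall n (eulerOp a F) := by
  have h : ContDiffOn ℂ ∞ (fderiv ℂ F) (unitBall n) :=
    (contDiffOn_of_differentiableOn isOpen_unitBall hF).fderiv_of_isOpen isOpen_unitBall (by simp)
  exact (hF.const_mul _).add ((h.differentiableOn (by simp)).clm_apply differentiableOn_id)

lemma iteratedDeriv_id_mul_deriv {φ : ℂ → ℂ} {r : ℝ} (hφ : DifferentiableOn ℂ φ (ball 0 r))
    (k : ℕ) {t : ℂ} (ht : t ∈ ball (0 : ℂ) r) :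
    iteratedDeriv k (fun t => t * deriv φ t) t =
      t * iteratedDeriv (k + 1) φ t + k * iteratedDeriv k φ t := by
  induction k generalizing t with
  | zero => simp [iteratedDeriv_one]
  | succ k ih =>
    have hd : ∀ j : ℕ, DifferentiableAt ℂ (iteratedDeriv j φ) t := fun j => by
      have : AnalyticOnNhd ℂ φ (ball 0 r) := hφ.analyticOnNhd isOpen_ball
      have h2 := (this.iterated_deriv j) t ht
      rw [← iteratedDeriv_eq_iterate] at h2
      exact h2.differentiableAt
    have hev : iteratedDeriv k (fun t => t * deriv φ t) =ᶠ[𝓝 t]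
        fun t => t * iteratedDeriv (k + 1) φ t + k * iteratedDeriv k φ t := by
      filter_upwards [isOpen_ball.mem_nhds ht] with s hs using ih hs
    rw [iteratedDeriv_succ, hev.deriv_eq]
    have h1 := ((hasDerivAt_id t).mul (hd (k + 1)).hasDerivAt).add
      ((hd k).hasDerivAt.const_mul (k : ℂ))
    have h2 := h1.deriv
    simp only [id, one_mul] at h2
    refine Eq.trans ?_ (h2.trans ?_)
    · rfl
    · rw [← iteratedDeriv_succ, ← iteratedDeriv_succ]
      push_cast
      ring

lemma homogeneousTerm_eulerOp {F : Cn n → ℂ} (hF : IsHolomorphicOnBall n F) (a : ℝ) (k : ℕ)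
    (z : Cn n) :
    homogeneousTerm n (eulerOp a F) k z = ((a + k : ℝ) : ℂ) * homogeneousTerm n F k z := by
  rw [homogeneousTerm_eq_iteratedDeriv hF, homogeneousTerm_eq_iteratedDeriv (hF.eulerOp a)]
  set r : ℝ := 1 / (1 + ‖z‖) with hr
  have hr0 : 0 < r := by positivity
  have hrz : r * ‖z‖ ≤ 1 := by
    rw [hr, div_mul_eq_mul_div, div_le_one (by positivity)]; linarith
  have hφ := differentiableOn_slice hF hrz
  set φ : ℂ → ℂ := fun t => F (t • z) with hφdef
  have h0 : (0 : ℂ) ∈ ball (0 : ℂ) r := by simp [hr0]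
  have hev : (fun t : ℂ => eulerOp a F (t • z)) =ᶠ[𝓝 0] fun t => a * φ t + t * deriv φ t := by
    filter_upwards [isOpen_ball.mem_nhds h0] with t ht
    have : ‖t‖ * ‖z‖ < 1 := by
      rw [mem_ball_zero_iff] at ht
      rcases eq_or_ne z 0 with rfl | hz
      · simp
      · exact (mul_lt_mul_of_pos_right ht (norm_pos_iff.2 hz)).trans_le hrz
    rw [(hasDerivAt_slice hF this).deriv, eulerOp, map_smul, smul_eq_mul]
  have han : AnalyticAt ℂ φ 0 := hφ.analyticAt (isOpen_ball.mem_nhds h0)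
  rw [hev.iteratedDeriv_eq, iteratedDeriv_fun_add, iteratedDeriv_const_mul_field,
    iteratedDeriv_id_mul_deriv hφ k h0]
  · push_cast; ring
  · exact (analyticAt_const.mul han).contDiffAt
  · exact (analyticAt_id.mul han.deriv).contDiffAt

/-- The operator `(A + R)(A + 1 + R) ⋯ (A + m - 1 + R)`. -/
def eulerIter (A : ℝ) : ℕ → (Cn n → ℂ) → Cn n → ℂ
  | 0, F => F
  | m + 1, F => eulerOp (A + m) (eulerIter A m F)

lemma IsHolomorphicOnBall.eulerIter {F : Cn n → ℂ} (hF : IsHolomorphicOnBall n F) (A : ℝ)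
    (m : ℕ) : IsHolomorphicOnBall n (eulerIter A m F) := by
  induction m with
  | zero => exact hF
  | succ m ih => exact ih.eulerOp _

lemma homogeneousTerm_eulerIter {F : Cn n → ℂ} (hF : IsHolomorphicOnBall n F) (A : ℝ) (m k : ℕ)
    (z : Cn n) :
    homogeneousTerm n (eulerIter A m F) k z =
      ((∏ j ∈ Finset.range m, (A + k + j) : ℝ) : ℂ) * homogeneousTerm n F k z := by
  induction m with
  | zero => simp [eulerIter]
  | succ m ih =>
    rw [eulerIter, homogeneousTerm_eulerOp (hF.eulerIter A m), ih, Finset.prod_range_succ]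
    push_cast; ring

lemma Gamma_add_nat {x : ℝ} (hx : ∀ k : ℕ, x ≠ -(k : ℝ)) (m : ℕ) :
    Real.Gamma (x + m) = (∏ j ∈ Finset.range m, (x + j)) * Real.Gamma x := by
  induction m with
  | zero => simp
  | succ m ih =>
    have h : x + m ≠ 0 := fun h => hx m (by linarith)
    rw [Nat.cast_succ, ← add_assoc, Real.Gamma_add_one h, ih, Finset.prod_range_succ]
    ring

/-- Since the order `m` is an integer, `R^{α,m}` is a differential operator: up to a constant it is
the product of the operators `n + 1 + α + j + R` with `0 ≤ j < m`. -/
lemma radialOp_eq_eulerIter {α : ℝ} (hα : ∀ k : ℕ, (n : ℝ) + 1 + α ≠ -(k : ℝ)) (m : ℕ)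
    {f : Cn n → ℂ} (hf : IsHolomorphicOnBall n f) {z : Cn n} (hz : z ∈ unitBall n) :
    radialOp n α m f z = ((∏ j ∈ Finset.range m, ((n : ℝ) + 1 + α + j) : ℝ) : ℂ)⁻¹ *
      eulerIter (n + 1 + α) m f z := by
  have h := (hasSum_homogeneousTerm (hf.eulerIter (n + 1 + α) m) hz).mul_left
    ((∏ j ∈ Finset.range m, ((n : ℝ) + 1 + α + j) : ℝ) : ℂ)⁻¹
  rw [radialOp, ← h.tsum_eq]
  refine tsum_congr fun k => ?_
  rw [homogeneousTerm_eulerIter hf, ← mul_assoc]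
  congr 1
  have hk : ∀ i : ℕ, (n : ℝ) + 1 + α + k ≠ -(i : ℝ) := fun i h =>
    hα (k + i) (by push_cast; linarith)
  have e1 : (n : ℝ) + 1 + k + α = n + 1 + α + k := by ring
  have e2 := Gamma_add_nat hα m
  have e3 := Gamma_add_nat hk m
  have g1 : Real.Gamma ((n : ℝ) + 1 + α) ≠ 0 := Real.Gamma_ne_zero hα
  have g2 : Real.Gamma ((n : ℝ) + 1 + α + k) ≠ 0 := Real.Gamma_ne_zero hk
  rw [e1, e2, e3]
  push_cast
  have g1' : (Real.Gamma ((n : ℝ) + 1 + α) : ℂ) ≠ 0 := by exact_mod_cast g1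
  have g2' : (Real.Gamma ((n : ℝ) + 1 + α + k) : ℂ) ≠ 0 := by exact_mod_cast g2
  field_simp

/-! ### Inversion of the radial operator by beta integrals -/

lemma integral_rpow_mul_one_sub_pow {x : ℝ} (hx : 0 < x) (m : ℕ) :
    ∫ t in (0 : ℝ)..1, t ^ (x - 1) * (1 - t) ^ m =
      m.factorial / ∏ j ∈ Finset.range (m + 1), (x + j) := by
  have h := Complex.betaIntegral_eval_nat_add_one_right (u := (x : ℂ)) (by simpa using hx) m
  rw [Complex.betaIntegral] at h
  have h2 : ∫ t in (0 : ℝ)..1, (t : ℂ) ^ ((x : ℂ) - 1) * (1 - (t : ℂ)) ^ ((m + 1 : ℂ) - 1) =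
      ((∫ t in (0 : ℝ)..1, t ^ (x - 1) * (1 - t) ^ m : ℝ) : ℂ) := by
    rw [← intervalIntegral.integral_ofReal]
    refine intervalIntegral.integral_congr fun t ht => ?_
    rw [uIcc_of_le zero_le_one] at ht
    simp only [add_sub_cancel_right, Complex.cpow_natCast]
    push_cast
    rw [Complex.ofReal_cpow ht.1]
    push_cast
    rfl
  rw [h2] at h
  exact_mod_cast h

lemma intervalIntegrable_rpow_mul_one_sub_pow {x : ℝ} (hx : 0 < x) (m : ℕ) (a b : ℝ) :
    IntervalIntegrable (fun t : ℝ => t ^ (x - 1) * (1 - t) ^ m) volume a b :=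
  (intervalIntegral.intervalIntegrable_rpow' (by linarith)).mul_continuousOn
    (by fun_prop)

/-- The multipliers `1 / ((A + k) ⋯ (A + k + m))` which invert the differential operator are, up to
an exponentially small error, the moments of a kernel supported in `[1/2, 1]`: for large `k` the
full moment over `[0, 1]` is a beta integral. -/
lemma exists_abs_inv_prod_sub_moment_le (A : ℝ) (m : ℕ) :
    ∃ K : ℝ, 0 ≤ K ∧ ∀ k : ℕ,
      |(∏ j ∈ Finset.range (m + 1), (A + k + j))⁻¹ -
        (m.factorial : ℝ)⁻¹ * ∫ t in (1 / 2 : ℝ)..1, t ^ (A + k - 1) * (1 - t) ^ m| ≤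
      K * (1 / 2) ^ k := by
  set E : ℕ → ℝ := fun k => (∏ j ∈ Finset.range (m + 1), (A + k + j))⁻¹ -
        (m.factorial : ℝ)⁻¹ * ∫ t in (1 / 2 : ℝ)..1, t ^ (A + k - 1) * (1 - t) ^ m with hE
  obtain ⟨N, hN⟩ := exists_nat_gt (1 - A)
  have hfact : (1 : ℝ) ≤ m.factorial := by
    exact_mod_cast Nat.one_le_iff_ne_zero.2 m.factorial_ne_zero
  have hbig : ∀ k, N ≤ k → |E k| ≤ (1 / 2) ^ A * (1 / 2) ^ k := by
    intro k hk
    have hkN : (N : ℝ) ≤ k := by exact_mod_cast hk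
    have hx : 1 < A + k := by linarith
    have hx0 : 0 < A + k := by linarith
    have hint := intervalIntegrable_rpow_mul_one_sub_pow hx0 m
    have hbeta := integral_rpow_mul_one_sub_pow hx0 m
    rw [← intervalIntegral.integral_add_adjacent_intervals (hint 0 (1 / 2)) (hint (1 / 2) 1)]
      at hbeta
    have hEk : E k = (m.factorial : ℝ)⁻¹ *
        ∫ t in (0 : ℝ)..(1 / 2), t ^ (A + k - 1) * (1 - t) ^ m := by
      have : (∏ j ∈ Finset.range (m + 1), (A + k + j))⁻¹ = (m.factorial : ℝ)⁻¹ *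
          (m.factorial / ∏ j ∈ Finset.range (m + 1), (A + k + j)) := by
        field_simp
      simp only [hE]
      rw [this, ← hbeta]
      ring
    have hnn : 0 ≤ ∫ t in (0 : ℝ)..(1 / 2), t ^ (A + k - 1) * (1 - t) ^ m := by
      refine intervalIntegral.integral_nonneg (by norm_num) fun t ht => ?_
      have : 0 ≤ 1 - t := by linarith [ht.2]
      have := ht.1
      positivity
    have hle : ∫ t in (0 : ℝ)..(1 / 2), t ^ (A + k - 1) * (1 - t) ^ m ≤
        ∫ t in (0 : ℝ)..(1 / 2), t ^ (A + k - 1) := by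
      refine intervalIntegral.integral_mono_on (by norm_num) (hint 0 (1 / 2))
        (intervalIntegral.intervalIntegrable_rpow' (by linarith)) fun t ht => ?_
      refine mul_le_of_le_one_right (Real.rpow_nonneg ht.1 _) ?_
      exact pow_le_one₀ (by linarith [ht.2]) (by linarith [ht.1])
    rw [integral_rpow (Or.inl (by linarith)), sub_add_cancel, Real.zero_rpow hx0.ne', sub_zero]
      at hle
    have hle2 : (1 / 2 : ℝ) ^ (A + k) / (A + k) ≤ (1 / 2) ^ (A + k) :=
      div_le_self (by positivity) hx.le
    rw [hEk, abs_of_nonneg (by positivity), ← Real.rpow_natCast, ← Real.rpow_add (by norm_num)]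
    calc (m.factorial : ℝ)⁻¹ * ∫ t in (0 : ℝ)..(1 / 2), t ^ (A + k - 1) * (1 - t) ^ m
        ≤ 1 * ∫ t in (0 : ℝ)..(1 / 2), t ^ (A + k - 1) * (1 - t) ^ m := by
          gcongr; exact inv_le_one_of_one_le₀ hfact
      _ ≤ _ := by linarith
  refine ⟨(1 / 2) ^ A + ∑ k ∈ Finset.range N, |E k| * 2 ^ k, by positivity, fun k => ?_⟩
  have hS : 0 ≤ ∑ k ∈ Finset.range N, |E k| * 2 ^ k := Finset.sum_nonneg fun _ _ => by positivity
  rcases le_or_gt N k with hk | hk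
  · exact (hbig k hk).trans (by gcongr; linarith)
  · have h1 : |E k| * 2 ^ k ≤ ∑ k ∈ Finset.range N, |E k| * 2 ^ k :=
      Finset.single_le_sum (f := fun k => |E k| * 2 ^ k) (fun _ _ => by positivity)
        (Finset.mem_range.2 hk)
    have h2 : |E k| = |E k| * 2 ^ k * (1 / 2) ^ k := by
      rw [mul_assoc, ← mul_pow]; norm_num
    have h3 : (0 : ℝ) ≤ (1 / 2) ^ A := by positivity
    change |E k| ≤ _
    rw [h2]
    gcongr
    linarith

/-- Inversion of the differential operator along a radius. If `G(t) = ∑ c_k f_k t^k` with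
`c_k = (A + k) ⋯ (A + k + m)`, then `∑ f_k` is controlled by the integral of `(1 - t)^m |G(t)|`
over `[1/2, 1]` and by the size of the coefficients of `G`. -/
lemma exists_norm_le_radial_integral (A : ℝ) (hA : ∀ k : ℕ, A ≠ -(k : ℝ)) (m : ℕ) :
    ∃ C : ℝ, 0 < C ∧ ∀ (f : ℕ → ℂ) (M : ℝ) (F : ℂ) (G : ℝ → ℂ), 0 ≤ M →
      (∀ k : ℕ, ‖((∏ j ∈ Finset.range (m + 1), (A + k + j) : ℝ) : ℂ) * f k‖ ≤ M * (4 / 3) ^ k) →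
      HasSum f F →
      (∀ t ∈ Icc (1 / 2 : ℝ) 1,
        HasSum (fun k : ℕ => (t : ℂ) ^ k *
          (((∏ j ∈ Finset.range (m + 1), (A + k + j) : ℝ) : ℂ) * f k)) (G t)) →
      ContinuousOn G (Icc (1 / 2) 1) →
      ‖F‖ ≤ C * (M + ∫ t in (1 / 2 : ℝ)..1, (1 - t) ^ m * ‖G t‖) := by
  obtain ⟨K, hK0, hK⟩ := exists_abs_inv_prod_sub_moment_le A m
  obtain ⟨D, hD⟩ := (isCompact_Icc (a := (1 / 2 : ℝ)) (b := 1)).exists_bound_of_continuousOn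
    (f := fun t : ℝ => t ^ (A - 1))
    (ContinuousOn.rpow_const continuousOn_id fun t ht => Or.inl (by
      have : (1 / 2 : ℝ) ≤ t := ht.1
      change t ≠ 0
      linarith))
  have hD0 : 0 ≤ D := (norm_nonneg _).trans (hD 1 (by norm_num))
  refine ⟨3 * K + D + 1, by positivity, fun f M F G hM hg hF hG hGc => ?_⟩
  set c : ℕ → ℝ := fun k => ∏ j ∈ Finset.range (m + 1), (A + k + j) with hc
  have hc0 : ∀ k, c k ≠ 0 := fun k => Finset.prod_ne_zero_iff.2 fun j _ h =>
    hA (k + j) (by push_cast; linarith)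
  set g : ℕ → ℂ := fun k => (c k : ℂ) * f k with hgdef
  set I : ℕ → ℝ := fun k => ∫ t in (1 / 2 : ℝ)..1, t ^ (A + k - 1) * (1 - t) ^ m with hI
  have hfk : ∀ k, f k = (((c k)⁻¹ - (m.factorial : ℝ)⁻¹ * I k : ℝ) : ℂ) * g k +
      (m.factorial : ℂ)⁻¹ * ((I k : ℂ) * g k) := by
    intro k
    have : (c k : ℂ) ≠ 0 := by exact_mod_cast hc0 k
    simp only [hgdef]
    push_cast
    field_simp
    ring
  -- the exponentially small part
  have hE : ∀ k, ‖(((c k)⁻¹ - (m.factorial : ℝ)⁻¹ * I k : ℝ) : ℂ) * g k‖ ≤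
      K * M * (2 / 3) ^ k := by
    intro k
    rw [norm_mul, Complex.norm_real, Real.norm_eq_abs]
    calc _ ≤ (K * (1 / 2) ^ k) * (M * (4 / 3) ^ k) :=
          mul_le_mul (hK k) (hg k) (norm_nonneg _) (by positivity)
      _ = K * M * ((1 / 2) ^ k * (4 / 3) ^ k) := by ring
      _ = _ := by rw [← mul_pow]; norm_num
  have hgeo : HasSum (fun k : ℕ => K * M * (2 / 3 : ℝ) ^ k) (K * M * 3) := by
    have := (hasSum_geometric_of_lt_one (r := (2 / 3 : ℝ)) (by norm_num) (by norm_num)).mul_left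
      (K * M)
    norm_num at this ⊢
    exact this
  have hEsum := Summable.of_norm_bounded hgeo.summable hE
  have hEle := tsum_of_norm_bounded hgeo hE
  -- the part carried by `[1/2, 1]`
  have hgs : Summable fun k => ‖g k‖ := by
    have := (hG 1 (by norm_num)).summable.norm
    simpa only [Complex.ofReal_one, one_pow, one_mul] using this
  have hQ : HasSum (fun k => (I k : ℂ) * g k)
      (∫ t in (1 / 2 : ℝ)..1, ((t ^ (A - 1) * (1 - t) ^ m : ℝ) : ℂ) * G t) := by
    have hIk : ∀ k, (I k : ℂ) * g k = ∫ t in (1 / 2 : ℝ)..1,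
        ((t ^ (A - 1) * (1 - t) ^ m : ℝ) : ℂ) * ((t : ℂ) ^ k * g k) := by
      intro k
      simp only [hI]
      rw [← intervalIntegral.integral_ofReal, ← intervalIntegral.integral_mul_const]
      refine intervalIntegral.integral_congr fun t ht => ?_
      rw [uIcc_of_le (by norm_num)] at ht
      have ht0 : 0 < t := by linarith [ht.1]
      have : t ^ (A + k - 1) = t ^ (A - 1) * t ^ k := by
        rw [← Real.rpow_natCast, ← Real.rpow_add ht0]; congr 1; ring
      simp only [this]
      push_cast
      ring
    simp only [hIk]
    refine intervalIntegral.hasSum_integral_of_dominated_convergence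
      (fun k _ => D * ‖g k‖) (fun k => ?_) (fun k => ?_) ?_ ?_ ?_
    · refine Measurable.aestronglyMeasurable ?_
      fun_prop
    · refine Filter.Eventually.of_forall fun t ht => ?_
      rw [uIoc_of_le (by norm_num)] at ht
      have htm : t ∈ Icc (1 / 2 : ℝ) 1 := ⟨ht.1.le, ht.2⟩
      have ht0 : 0 ≤ t := by linarith [ht.1]
      have h1 : |t ^ (A - 1)| ≤ D := hD t htm
      have h2 : |(1 - t) ^ m| ≤ 1 := by
        rw [abs_of_nonneg (pow_nonneg (by linarith [ht.2]) m)]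
        exact pow_le_one₀ (by linarith [ht.2]) (by linarith)
      have h3 : |t| ^ k ≤ 1 := by
        rw [abs_of_nonneg ht0]; exact pow_le_one₀ ht0 ht.2
      rw [norm_mul, norm_mul, Complex.norm_real, norm_pow, Complex.norm_real, Real.norm_eq_abs,
        Real.norm_eq_abs, abs_mul]
      calc |t ^ (A - 1)| * |(1 - t) ^ m| * (|t| ^ k * ‖g k‖) ≤ D * 1 * (1 * ‖g k‖) := by gcongr
        _ = D * ‖g k‖ := by ring
    · exact Filter.Eventually.of_forall fun t _ => hgs.mul_left D
    · exact intervalIntegrable_const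
    · refine Filter.Eventually.of_forall fun t ht => ?_
      rw [uIoc_of_le (by norm_num)] at ht
      exact (hG t ⟨ht.1.le, ht.2⟩).mul_left _
  have hFeq : F = (∑' k, (((c k)⁻¹ - (m.factorial : ℝ)⁻¹ * I k : ℝ) : ℂ) * g k) +
      (m.factorial : ℂ)⁻¹ *
        ∫ t in (1 / 2 : ℝ)..1, ((t ^ (A - 1) * (1 - t) ^ m : ℝ) : ℂ) * G t := by
    refine hF.unique ?_
    have := hEsum.hasSum.add (hQ.mul_left (m.factorial : ℂ)⁻¹)
    exact this.congr_fun hfk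
  have hfact : (1 : ℝ) ≤ m.factorial := by
    exact_mod_cast Nat.one_le_iff_ne_zero.2 m.factorial_ne_zero
  have hGi : IntervalIntegrable (fun t => (1 - t) ^ m * ‖G t‖) volume (1 / 2) 1 := by
    refine ContinuousOn.intervalIntegrable ?_
    rw [uIcc_of_le (by norm_num)]
    exact ContinuousOn.mul (by fun_prop) hGc.norm
  have hint : ‖∫ t in (1 / 2 : ℝ)..1, ((t ^ (A - 1) * (1 - t) ^ m : ℝ) : ℂ) * G t‖ ≤
      D * ∫ t in (1 / 2 : ℝ)..1, (1 - t) ^ m * ‖G t‖ := by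
    rw [← intervalIntegral.integral_const_mul]
    refine intervalIntegral.norm_integral_le_of_norm_le (by norm_num) ?_ (hGi.const_mul D)
    refine Filter.Eventually.of_forall fun t ht => ?_
    have h1 : |t ^ (A - 1)| ≤ D := hD t ⟨ht.1.le, ht.2⟩
    have h2 : 0 ≤ (1 - t) ^ m := pow_nonneg (by linarith [ht.2]) m
    rw [norm_mul, Complex.norm_real, Real.norm_eq_abs, abs_mul, abs_of_nonneg h2, mul_assoc]
    gcongr
  set J := ∫ t in (1 / 2 : ℝ)..1, (1 - t) ^ m * ‖G t‖ with hJ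
  have hJ0 : 0 ≤ J := intervalIntegral.integral_nonneg (by norm_num) fun t ht =>
    mul_nonneg (pow_nonneg (by linarith [ht.2]) m) (norm_nonneg _)
  rw [hFeq]
  refine (norm_add_le _ _).trans ?_
  rw [norm_mul, norm_inv, Complex.norm_natCast]
  have h1 : (m.factorial : ℝ)⁻¹ * ‖∫ t in (1 / 2 : ℝ)..1,
      ((t ^ (A - 1) * (1 - t) ^ m : ℝ) : ℂ) * G t‖ ≤ 1 * (D * J) :=
    mul_le_mul (inv_le_one_of_one_le₀ hfact) hint (norm_nonneg _) zero_le_one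
  nlinarith [mul_nonneg hD0 hM, mul_nonneg hK0 hJ0]

/-! ### Nonisotropic dilations, volumes of tents, polar coordinates -/

/-- The nonisotropic dilation with factor `s²` along the complex line of a unit vector `ζ` and
factor `s` in the orthogonal directions. -/
def anisoDilation (s : ℝ) (ζ : Cn n) : Cn n →ₗ[ℂ] Cn n :=
  (s : ℂ) • LinearMap.transvection (innerSL ℂ ζ : Cn n →ₗ[ℂ] ℂ) (((s - 1 : ℝ) : ℂ) • ζ)

lemma anisoDilation_apply (s : ℝ) (ζ v : Cn n) :
    anisoDilation s ζ v = (s : ℂ) • (v + (inner ℂ ζ v * ((s - 1 : ℝ) : ℂ)) • ζ) := by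
  change (s : ℂ) • (v + (inner ℂ ζ v : ℂ) • ((s - 1 : ℝ) : ℂ) • ζ) = _
  rw [smul_smul]

lemma inner_anisoDilation (s : ℝ) {ζ : Cn n} (hζ : ‖ζ‖ = 1) (v : Cn n) :
    inner ℂ ζ (anisoDilation s ζ v) = ((s ^ 2 : ℝ) : ℂ) * inner ℂ ζ v := by
  rw [anisoDilation_apply, inner_smul_right, inner_add_right, inner_smul_right,
    inner_self_eq_norm_sq_to_K, hζ]
  push_cast
  simp
  ring

lemma norm_anisoDilation_le {s : ℝ} (hs : 0 ≤ s) {ζ : Cn n} (hζ : ‖ζ‖ = 1) (v : Cn n) :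
    ‖anisoDilation s ζ v‖ ≤ s * (2 * ‖v‖) + s ^ 2 * ‖inner ℂ ζ v‖ := by
  have hi : ‖(inner ℂ ζ v : ℂ)‖ ≤ ‖v‖ := by simpa [hζ] using norm_inner_le_norm (𝕜 := ℂ) ζ v
  have e : anisoDilation s ζ v = (s : ℂ) • (v - (inner ℂ ζ v : ℂ) • ζ) +
      ((s ^ 2 : ℝ) * inner ℂ ζ v : ℂ) • ζ := by
    rw [anisoDilation_apply]
    push_cast
    module
  rw [e]
  refine (norm_add_le _ _).trans ?_
  rw [norm_smul, norm_smul, norm_mul, hζ, mul_one, Complex.norm_real, Complex.norm_real,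
    Real.norm_eq_abs, Real.norm_eq_abs, abs_of_nonneg hs, abs_of_nonneg (by positivity)]
  gcongr
  refine (norm_sub_le _ _).trans ?_
  rw [norm_smul, hζ, mul_one]
  linarith

lemma norm_anisoDilation_le_two {s : ℝ} (hs : 0 ≤ s) (hs2 : s ≤ 2) {ζ : Cn n} (hζ : ‖ζ‖ = 1)
    (v : Cn n) : ‖anisoDilation s ζ v‖ ≤ s * (2 * ‖v‖) := by
  have hi : ‖(inner ℂ ζ v : ℂ)‖ ≤ ‖v‖ := by simpa [hζ] using norm_inner_le_norm (𝕜 := ℂ) ζ v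
  rw [anisoDilation_apply, norm_smul, Complex.norm_real, Real.norm_eq_abs, abs_of_nonneg hs]
  gcongr
  refine (norm_add_le _ _).trans ?_
  rw [norm_smul, hζ, mul_one, norm_mul, Complex.norm_real, Real.norm_eq_abs]
  have : |s - 1| ≤ 1 := abs_le.2 ⟨by linarith, by linarith⟩
  nlinarith [norm_nonneg (inner ℂ ζ v : ℂ), norm_nonneg v, abs_nonneg (s - 1)]

lemma volume_image_anisoDilation {s : ℝ} (hs : 0 ≤ s) {ζ : Cn n} (hζ : ‖ζ‖ = 1)
    (S : Set (Cn n)) :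
    volume (anisoDilation s ζ '' S) = ENNReal.ofReal ((s ^ 2) ^ (n + 1)) * volume S := by
  have hdet : LinearMap.det (anisoDilation s ζ) = ((s ^ (n + 1) : ℝ) : ℂ) := by
    rw [anisoDilation, LinearMap.det_smul, LinearMap.transvection.det, finrank_euclideanSpace_fin]
    have : (innerSL ℂ ζ : Cn n →ₗ[ℂ] ℂ) (((s - 1 : ℝ) : ℂ) • ζ) = ((s - 1 : ℝ) : ℂ) := by
      simp [inner_self_eq_norm_sq_to_K, hζ]
    rw [this]
    push_cast
    ring
  have h := Measure.addHaar_image_linearMap (volume : Measure (Cn n))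
    ((anisoDilation s ζ).restrictScalars ℝ) S
  rw [LinearMap.det_restrictScalars, hdet, Algebra.norm_complex_apply, Complex.normSq_ofReal] at h
  rw [LinearMap.coe_restrictScalars] at h
  rw [h, abs_of_nonneg (by positivity)]
  congr 2
  ring

lemma isOpen_carlesonTent (δ : ℝ) (ξ : Cn n) : IsOpen (carlesonTent n δ ξ) :=
  isOpen_unitBall.inter
    (isOpen_lt (f := fun z : Cn n => ‖1 - (inner ℂ ξ z : ℂ)‖) (by fun_prop) continuous_const)

lemma measurableSet_carlesonTent (δ : ℝ) (ξ : Cn n) : MeasurableSet (carlesonTent n δ ξ) :=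
  (isOpen_carlesonTent δ ξ).measurableSet

/-- The tent `Q_δ(ξ)` is contained in a translate of a nonisotropic ball, so its volume is
`O(δ^{n+1})`. -/
lemma volume_carlesonTent_le {δ : ℝ} (hδ : 0 < δ) {ξ : Cn n} (hξ : ‖ξ‖ = 1) :
    volume (carlesonTent n δ ξ) ≤
      ENNReal.ofReal (δ ^ (n + 1)) * volume (ball (0 : Cn n) 5) := by
  set s : ℝ := (√δ)⁻¹ with hs
  have hsq : 0 < √δ := Real.sqrt_pos.2 hδ
  have hs0 : 0 < s := by positivity
  have hs2 : s ^ 2 = δ⁻¹ := by rw [hs, inv_pow, Real.sq_sqrt hδ.le]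
  have hsub : anisoDilation s ξ '' ((fun z => -ξ + z) '' carlesonTent n δ ξ) ⊆ ball 0 5 := by
    rintro _ ⟨_, ⟨z, ⟨hzB, hz⟩, rfl⟩, rfl⟩
    rw [mem_unitBall] at hzB
    rw [mem_ball_zero_iff]
    refine (norm_anisoDilation_le hs0.le hξ _).trans_lt ?_
    have hin : (inner ℂ ξ (-ξ + z) : ℂ) = -(1 - inner ℂ ξ z) := by
      rw [inner_add_right, inner_neg_right, inner_self_eq_norm_sq_to_K, hξ]
      simp; ring
    have h1 : s ^ 2 * ‖(inner ℂ ξ (-ξ + z) : ℂ)‖ ≤ 1 := by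
      rw [hin, norm_neg, hs2, inv_mul_le_iff₀ hδ]
      linarith
    have h2 : ‖-ξ + z‖ ^ 2 ≤ 2 * δ := by
      have e : ‖-ξ + z‖ ^ 2 = ‖ξ‖ ^ 2 + ‖z‖ ^ 2 - 2 * Complex.re (inner ℂ ξ z) := by
        rw [norm_add_sq (𝕜 := ℂ), inner_neg_left, norm_neg]
        simp
        ring
      have hre : 1 - Complex.re (inner ℂ ξ z) ≤ ‖1 - (inner ℂ ξ z : ℂ)‖ := by
        simpa using Complex.re_le_norm (1 - (inner ℂ ξ z : ℂ))
      rw [e, hξ]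
      nlinarith [norm_nonneg z]
    have h3 : s * ‖-ξ + z‖ < 2 := by
      refine lt_of_pow_lt_pow_left₀ 2 (by norm_num) ?_
      rw [mul_pow, hs2, inv_mul_lt_iff₀ hδ]
      linarith
    linarith
  have hvol := measure_mono (μ := volume) hsub
  rw [volume_image_anisoDilation hs0.le hξ, image_add_left, measure_preimage_add, hs2] at hvol
  have hpos : 0 < δ⁻¹ ^ (n + 1) := by positivity
  calc volume (carlesonTent n δ ξ)
      = ENNReal.ofReal (δ ^ (n + 1)) *
          (ENNReal.ofReal (δ⁻¹ ^ (n + 1)) * volume (carlesonTent n δ ξ)) := by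
        rw [← mul_assoc, ← ENNReal.ofReal_mul (by positivity), ← mul_pow, mul_inv_cancel₀ hδ.ne']
        simp
    _ ≤ _ := by gcongr

/-- The nonisotropic neighbourhood of `t z`, of size `√ρ` in general and of size `ρ` along the
direction of `z`. -/
def anisoBall (ρ : ℝ) (t : ℝ) (z : Cn n) : Set (Cn n) :=
  {w | ‖(inner ℂ z (w - (t : ℂ) • z) : ℂ)‖ < ρ ∧ ‖w - (t : ℂ) • z‖ ^ 2 < ρ}

lemma exists_unit_smul_eq (hn : 0 < n) (z : Cn n) :
    ∃ ζ : Cn n, ‖ζ‖ = 1 ∧ z = (‖z‖ : ℂ) • ζ := by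
  rcases eq_or_ne z 0 with rfl | hz
  · exact ⟨EuclideanSpace.single ⟨0, hn⟩ 1, by simp, by simp⟩
  · have h0 : (‖z‖ : ℂ) ≠ 0 := by exact_mod_cast norm_ne_zero_iff.2 hz
    refine ⟨(‖z‖ : ℂ)⁻¹ • z, ?_, by rw [smul_smul, mul_inv_cancel₀ h0, one_smul]⟩
    rw [norm_smul, norm_inv, Complex.norm_real, norm_norm, inv_mul_cancel₀ (norm_ne_zero_iff.2 hz)]

lemma le_volume_anisoBall (hn : 0 < n) {ρ : ℝ} (hρ : 0 < ρ) (hρ2 : ρ ≤ 4) (t : ℝ) {z : Cn n}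
    (hz : ‖z‖ ≤ 1) :
    ENNReal.ofReal (ρ ^ (n + 1)) * volume (ball (0 : Cn n) (1 / 2)) ≤
      volume (anisoBall ρ t z) := by
  obtain ⟨ζ, hζ, hzζ⟩ := exists_unit_smul_eq hn z
  have hs0 : 0 < √ρ := Real.sqrt_pos.2 hρ
  have hsq : √ρ ^ 2 = ρ := Real.sq_sqrt hρ.le
  have hs2 : √ρ ≤ 2 := by
    rw [Real.sqrt_le_left (by norm_num)]; linarith
  have hsub : (fun v => (t : ℂ) • z + v) '' (anisoDilation (√ρ) ζ '' ball 0 (1 / 2)) ⊆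
      anisoBall ρ t z := by
    rintro _ ⟨_, ⟨v, hv, rfl⟩, rfl⟩
    rw [mem_ball_zero_iff] at hv
    simp only [anisoBall, mem_ofPred_eq, add_sub_cancel_left]
    constructor
    · have hi : ‖(inner ℂ ζ v : ℂ)‖ ≤ ‖v‖ := by
        simpa [hζ] using norm_inner_le_norm (𝕜 := ℂ) ζ v
      rw [hzζ, inner_smul_left, inner_anisoDilation _ hζ, norm_mul, norm_mul, hsq]
      simp only [Complex.conj_ofReal, Complex.norm_real, Real.norm_eq_abs, abs_of_pos hρ, abs_norm]
      have h0 := norm_nonneg z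
      have h1 := norm_nonneg (inner ℂ ζ v : ℂ)
      calc ‖z‖ * (ρ * ‖(inner ℂ ζ v : ℂ)‖) ≤ 1 * (ρ * ‖v‖) := by gcongr
        _ < ρ := by nlinarith
    · have h := norm_anisoDilation_le_two hs0.le hs2 hζ v
      have h2 : ‖anisoDilation (√ρ) ζ v‖ < √ρ := h.trans_lt (by nlinarith)
      calc ‖anisoDilation (√ρ) ζ v‖ ^ 2 < √ρ ^ 2 := by gcongr
        _ = ρ := hsq
  have := measure_mono (μ := volume) hsub
  rwa [image_add_left, measure_preimage_add, volume_image_anisoDilation hs0.le hζ, hsq] at this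

lemma norm_sq_lt_of_mem_anisoBall {ρ t : ℝ} (ht0 : 0 ≤ t) (ht1 : t ≤ 1) {z w : Cn n}
    (hw : w ∈ anisoBall ρ t z) : ‖w‖ ^ 2 < t ^ 2 * ‖z‖ ^ 2 + 3 * ρ := by
  obtain ⟨h1, h2⟩ := hw
  have e : w = (t : ℂ) • z + (w - (t : ℂ) • z) := by abel
  have h3 := norm_add_sq (𝕜 := ℂ) ((t : ℂ) • z) (w - (t : ℂ) • z)
  rw [← e, inner_smul_left, norm_smul] at h3
  have h4 : RCLike.re ((starRingEnd ℂ) (t : ℂ) * inner ℂ z (w - (t : ℂ) • z)) ≤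
      t * ‖(inner ℂ z (w - (t : ℂ) • z) : ℂ)‖ := by
    refine (RCLike.re_le_norm _).trans ?_
    rw [norm_mul]
    simp [abs_of_nonneg ht0]
  rw [h3]
  simp only [Complex.norm_real, Real.norm_eq_abs, abs_of_nonneg ht0]
  nlinarith [norm_nonneg (inner ℂ z (w - (t : ℂ) • z) : ℂ)]

/-- Integration in polar coordinates. -/
lemma lintegral_eq_lintegral_sphere (hn : 0 < n) {F : Cn n → ℝ≥0∞} (hF : Measurable F) :
    ∫⁻ z, F z = ∫⁻ ζ : sphere (0 : Cn n) 1, ∫⁻ r in Ioi (0 : ℝ),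
      ENNReal.ofReal (r ^ (Module.finrank ℝ (Cn n) - 1)) * F (r • (ζ : Cn n))
      ∂volume ∂(volume : Measure (Cn n)).toSphere := by
  have : Nonempty (Fin n) := ⟨⟨0, hn⟩⟩
  have hmp := Measure.measurePreserving_homeomorphUnitSphereProd (volume : Measure (Cn n))
  have hne : (volume : Measure (Cn n)) {0} = 0 := measure_singleton 0
  have h1 : ∫⁻ z, F z = ∫⁻ z in ({0}ᶜ : Set (Cn n)), F z := by
    rw [← lintegral_add_compl F (measurableSet_singleton (0 : Cn n)),
      Measure.restrict_eq_zero.2 hne]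
    simp
  rw [h1, ← lintegral_subtype_comap (measurableSet_singleton (0 : Cn n)).compl,
    ← (hmp.symm (homeomorphUnitSphereProd (Cn n)).toMeasurableEquiv).lintegral_comp_emb
      (MeasurableEquiv.measurableEmbedding _), lintegral_prod]
  · refine lintegral_congr fun ζ => ?_
    rw [Measure.volumeIoiPow, lintegral_withDensity_eq_lintegral_mul]
    · rw [← lintegral_subtype_comap measurableSet_Ioi]
      rfl
    · fun_prop
    · refine hF.comp ?_
      exact measurable_subtype_coe.comp
        ((homeomorphUnitSphereProd (Cn n)).symm.continuous.measurable.comp measurable_prodMk_left)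
  · exact ((hF.comp measurable_subtype_coe).comp
      (homeomorphUnitSphereProd (Cn n)).symm.continuous.measurable).aemeasurable

/-! ### Weighted volumes of tents -/

/-- The measure with density `(1 - |z|²)^c` on the unit ball. -/
def ballWeight (n : ℕ) (c : ℝ) : Measure (Cn n) :=
  (volume.restrict (unitBall n)).withDensity fun z => ENNReal.ofReal ((1 - ‖z‖ ^ 2) ^ c)

lemma measurable_weight (c : ℝ) :
    Measurable fun z : Cn n => ENNReal.ofReal ((1 - ‖z‖ ^ 2) ^ c) := by
  fun_prop

lemma carlesonTent_subset (δ : ℝ) (ξ : Cn n) : carlesonTent n δ ξ ⊆ unitBall n := fun _ h => h.1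

lemma ballWeight_carlesonTent (c δ : ℝ) (ξ : Cn n) :
    ballWeight n c (carlesonTent n δ ξ) =
      ∫⁻ z in carlesonTent n δ ξ, ENNReal.ofReal ((1 - ‖z‖ ^ 2) ^ c) := by
  rw [ballWeight, withDensity_apply _ (measurableSet_carlesonTent δ ξ),
    Measure.restrict_restrict (measurableSet_carlesonTent δ ξ),
    inter_eq_left.2 (carlesonTent_subset δ ξ)]

lemma real_smul_mem_carlesonTent {δ r : ℝ} (hr : 0 < r) {ξ ζ : Cn n} (hζ : ‖ζ‖ = 1) :
    r • ζ ∈ carlesonTent n δ ξ ↔ r < 1 ∧ ‖1 - (r : ℂ) * inner ℂ ξ ζ‖ < δ := by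
  have : r • ζ = (r : ℂ) • ζ := (Complex.coe_smul r ζ).symm
  rw [carlesonTent, mem_ofPred_eq, mem_unitBall, this, inner_smul_right, norm_smul, hζ, mul_one,
    Complex.norm_real, Real.norm_eq_abs, abs_of_pos hr]

lemma lintegral_one_sub_rpow {c δ : ℝ} (hc : -1 < c) (hδ : 0 < δ) :
    ∫⁻ r in Ioo (1 - δ) 1, ENNReal.ofReal ((1 - r) ^ c) =
      ENNReal.ofReal (δ ^ (c + 1) / (c + 1)) := by
  have hi : IntervalIntegrable (fun r : ℝ => (1 - r) ^ c) volume (1 - δ) 1 := by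
    have := (intervalIntegral.intervalIntegrable_rpow' (a := 0) (b := δ) hc).comp_sub_left 1
    simpa using this.symm
  have hint : ∫ r in (1 - δ)..1, (1 - r) ^ c = δ ^ (c + 1) / (c + 1) := by
    rw [intervalIntegral.integral_comp_sub_left (fun x : ℝ => x ^ c) 1, integral_rpow (Or.inl hc)]
    simp [Real.zero_rpow (by linarith : c + 1 ≠ 0)]
  rw [intervalIntegral.integral_of_le (by linarith), integral_Ioc_eq_integral_Ioo] at hint
  rw [← hint, ofReal_integral_eq_lintegral_ofReal]
  · exact ((intervalIntegrable_iff_integrableOn_Ioo_of_le (by linarith)).1 hi)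
  · refine (ae_restrict_mem measurableSet_Ioo).mono fun r hr => ?_
    exact Real.rpow_nonneg (by linarith [hr.2]) c

/-- On a radius, a weight `(1 - r)^c` with `-1 < c ≤ 0` integrates over a tent to at most a constant
times `δ^c` times the `r^N dr` measure of the intersection with the tent `Q_{3δ}(ξ)`. -/
lemma radial_lintegral_le {c : ℝ} (hc : -1 < c) (hc0 : c ≤ 0) (N : ℕ) {δ : ℝ} (hδ : 0 < δ)
    (hδ3 : δ ≤ 3) {ξ ζ : Cn n} (hξ : ‖ξ‖ = 1) (hζ : ‖ζ‖ = 1) :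
    ∫⁻ r in Ioi (0 : ℝ), ENNReal.ofReal (r ^ N) * (carlesonTent n δ ξ).indicator
        (fun z => ENNReal.ofReal ((1 - ‖z‖ ^ 2) ^ c)) (r • ζ) ≤
      ENNReal.ofReal (6 * 2 ^ N / (c + 1) * δ ^ c) *
        ∫⁻ r in Ioi (0 : ℝ), ENNReal.ofReal (r ^ N) *
          (carlesonTent n (3 * δ) ξ).indicator (fun _ => 1) (r • ζ) := by
  set u : ℂ := inner ℂ ξ ζ with hu
  have hu1 : ‖u‖ ≤ 1 := by simpa [hξ, hζ] using norm_inner_le_norm (𝕜 := ℂ) ξ ζ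
  have hnear : ∀ r : ℝ, 0 < r → r < 1 → 1 - r ≤ ‖1 - (r : ℂ) * u‖ := by
    intro r h0 h1
    have h2 := norm_sub_norm_le (1 : ℂ) ((r : ℂ) * u)
    rw [norm_one, norm_mul, Complex.norm_real, Real.norm_eq_abs, abs_of_pos h0] at h2
    nlinarith
  have hdiff : ∀ r : ℝ, r < 1 → ‖((1 : ℂ) - u) - (1 - (r : ℂ) * u)‖ ≤ 1 - r := by
    intro r h1
    have : ((1 : ℂ) - u) - (1 - (r : ℂ) * u) = -(((1 - r : ℝ) : ℂ) * u) := by push_cast; ring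
    rw [this, norm_neg, norm_mul, Complex.norm_real, Real.norm_eq_abs, abs_of_pos (by linarith)]
    nlinarith
  -- a radius far from `ξ` misses the tent; a radius close to `ξ` meets `Q_δ` in at most the outer
  -- segment of length `δ`, and `Q_{3δ}` in at least the outer segment of length `δ / 6`
  rcases le_or_gt (2 * δ) ‖1 - u‖ with hfar | hclose
  · refine le_trans (le_of_eq ?_) zero_le
    refine (setLIntegral_congr_fun measurableSet_Ioi fun r hr => ?_).trans lintegral_zero
    rw [indicator_of_notMem, mul_zero]
    rw [real_smul_mem_carlesonTent hr hζ]
    rintro ⟨h1, h2⟩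
    have := norm_sub_norm_le ((1 : ℂ) - u) (1 - (r : ℂ) * u)
    linarith [hnear r hr h1, hdiff r h1]
  · have hL : ∫⁻ r in Ioi (0 : ℝ), ENNReal.ofReal (r ^ N) * (carlesonTent n δ ξ).indicator
        (fun z => ENNReal.ofReal ((1 - ‖z‖ ^ 2) ^ c)) (r • ζ) ≤
        ENNReal.ofReal (δ ^ (c + 1) / (c + 1)) := by
      rw [← lintegral_one_sub_rpow hc hδ, ← lintegral_indicator measurableSet_Ioi,
        ← lintegral_indicator measurableSet_Ioo]
      refine lintegral_mono fun r => ?_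
      by_cases hr : r ∈ Ioi (0 : ℝ)
      swap
      · rw [indicator_of_notMem hr]; exact zero_le
      rw [indicator_of_mem hr]
      by_cases hm : r • ζ ∈ carlesonTent n δ ξ
      swap
      · rw [indicator_of_notMem hm, mul_zero]; exact zero_le
      rw [indicator_of_mem hm]
      obtain ⟨h1, h2⟩ := (real_smul_mem_carlesonTent hr hζ).1 hm
      have hr0 : 0 < r := hr
      have hmem : r ∈ Ioo (1 - δ) 1 := ⟨by linarith [hnear r hr h1], h1⟩
      rw [indicator_of_mem hmem, ← ENNReal.ofReal_mul (by positivity)]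
      refine ENNReal.ofReal_le_ofReal ?_
      rw [norm_smul, hζ, mul_one, Real.norm_eq_abs, abs_of_pos hr0]
      have h3 : (1 - r ^ 2) ^ c ≤ (1 - r) ^ c :=
        Real.rpow_le_rpow_of_nonpos (by linarith) (by nlinarith) hc0
      have h4 : r ^ N ≤ 1 := pow_le_one₀ hr0.le h1.le
      have h5 : 0 ≤ (1 - r ^ 2) ^ c := Real.rpow_nonneg (by nlinarith) c
      nlinarith
    have hR : ENNReal.ofReal ((1 / 2) ^ N * (δ / 6)) ≤
        ∫⁻ r in Ioi (0 : ℝ), ENNReal.ofReal (r ^ N) *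
          (carlesonTent n (3 * δ) ξ).indicator (fun _ => 1) (r • ζ) := by
      have hconst : ENNReal.ofReal ((1 / 2) ^ N * (δ / 6)) =
          ∫⁻ _ in Ioo (1 - δ / 6) (1 : ℝ), ENNReal.ofReal ((1 / 2) ^ N) := by
        rw [setLIntegral_const, Real.volume_Ioo, ENNReal.ofReal_mul (by positivity)]
        congr 2
        ring
      rw [hconst, ← lintegral_indicator measurableSet_Ioi, ← lintegral_indicator measurableSet_Ioo]
      refine lintegral_mono fun r => ?_
      by_cases hr : r ∈ Ioo (1 - δ / 6) (1 : ℝ)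
      swap
      · rw [indicator_of_notMem hr]; exact zero_le
      have hr2 : 1 / 2 ≤ r := by linarith [hr.1]
      have hr0 : r ∈ Ioi (0 : ℝ) := by rw [mem_Ioi]; linarith
      have hm : r • ζ ∈ carlesonTent n (3 * δ) ξ := by
        rw [real_smul_mem_carlesonTent hr0 hζ]
        refine ⟨hr.2, ?_⟩
        have := norm_sub_norm_le (1 - (r : ℂ) * u) ((1 : ℂ) - u)
        rw [norm_sub_rev (1 - (r : ℂ) * u)] at this
        linarith [hdiff r hr.2, hr.1]
      rw [indicator_of_mem hr, indicator_of_mem hr0, indicator_of_mem hm, mul_one]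
      refine ENNReal.ofReal_le_ofReal ?_
      gcongr
    refine hL.trans (le_trans (le_of_eq ?_) (mul_le_mul_right hR _))
    have hc1 : c + 1 ≠ 0 := by linarith
    have hc2 : 0 < c + 1 := by linarith
    rw [← ENNReal.ofReal_mul (by positivity), Real.rpow_add_one hδ.ne']
    congr 1
    have : (2 : ℝ) ^ N * (1 / 2) ^ N = 1 := by rw [← mul_pow]; norm_num
    field_simp
    linear_combination (-1 : ℝ) * this

/-- The weighted volume of a tent `Q_δ(ξ)` is at most a constant times `δ^{n+1+c}`. For `c ≥ 0` the
weight is `O(δ^c)` on the tent; for `c < 0` it is averaged along radii. -/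
lemma exists_ballWeight_carlesonTent_le_of_le_three (hn : 0 < n) {c : ℝ} (hc : -1 < c) :
    ∃ C : ℝ, 0 < C ∧ ∀ ξ : Cn n, ‖ξ‖ = 1 → ∀ δ : ℝ, 0 < δ → δ ≤ 3 →
      ballWeight n c (carlesonTent n δ ξ) ≤ ENNReal.ofReal (C * δ ^ ((n : ℝ) + 1 + c)) := by
  set V : ℝ := (volume (ball (0 : Cn n) 5)).toReal with hV
  have hVe : volume (ball (0 : Cn n) 5) = ENNReal.ofReal V :=
    (ENNReal.ofReal_toReal measure_ball_lt_top.ne).symm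
  have hV0 : 0 ≤ V := ENNReal.toReal_nonneg
  have hpow : ∀ δ : ℝ, 0 < δ → δ ^ ((n : ℝ) + 1 + c) = δ ^ (n + 1) * δ ^ c := fun δ hδ => by
    rw [Real.rpow_add hδ, ← Real.rpow_natCast]; push_cast; rfl
  rcases le_or_gt 0 c with hc0 | hc0
  · refine ⟨V * 2 ^ c + 1, by positivity, fun ξ hξ δ hδ hδ3 => ?_⟩
    rw [ballWeight_carlesonTent]
    have hb : ∀ z ∈ carlesonTent n δ ξ, ENNReal.ofReal ((1 - ‖z‖ ^ 2) ^ c) ≤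
        ENNReal.ofReal ((2 * δ) ^ c) := by
      rintro z ⟨hzB, hz⟩
      rw [mem_unitBall] at hzB
      have h0 := norm_nonneg z
      have h1 : ‖(inner ℂ ξ z : ℂ)‖ ≤ ‖z‖ := by
        simpa [hξ] using norm_inner_le_norm (𝕜 := ℂ) ξ z
      have h2 := norm_sub_norm_le (1 : ℂ) (inner ℂ ξ z)
      rw [norm_one] at h2
      refine ENNReal.ofReal_le_ofReal (Real.rpow_le_rpow (by nlinarith) (by nlinarith) hc0)
    refine (setLIntegral_mono' (measurableSet_carlesonTent δ ξ) hb).trans ?_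
    rw [setLIntegral_const]
    refine (mul_le_mul_right (volume_carlesonTent_le hδ hξ) _).trans ?_
    rw [hVe, ← ENNReal.ofReal_mul (by positivity), ← ENNReal.ofReal_mul (by positivity), hpow δ hδ,
      Real.mul_rpow (by norm_num) hδ.le]
    refine ENNReal.ofReal_le_ofReal ?_
    have : 0 ≤ δ ^ (n + 1) * δ ^ c := by positivity
    nlinarith
  · set N := Module.finrank ℝ (Cn n) - 1 with hN
    set K := 6 * 2 ^ N / (c + 1) with hK
    have hK0 : 0 < K := div_pos (by positivity) (by linarith)
    refine ⟨K * 3 ^ (n + 1) * V + 1, by positivity, fun ξ hξ δ hδ hδ3 => ?_⟩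
    rw [ballWeight_carlesonTent, ← lintegral_indicator (measurableSet_carlesonTent δ ξ),
      lintegral_eq_lintegral_sphere hn
        ((measurable_weight c).indicator (measurableSet_carlesonTent δ ξ))]
    calc _ ≤ ∫⁻ ζ : sphere (0 : Cn n) 1, ENNReal.ofReal (K * δ ^ c) *
          (∫⁻ r in Ioi (0 : ℝ), ENNReal.ofReal (r ^ N) *
          (carlesonTent n (3 * δ) ξ).indicator (fun _ => 1) (r • (ζ : Cn n)))
          ∂(volume : Measure (Cn n)).toSphere :=
          lintegral_mono fun ζ => radial_lintegral_le hc hc0.le N hδ hδ3 hξ (by simp)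
      _ = ENNReal.ofReal (K * δ ^ c) * volume (carlesonTent n (3 * δ) ξ) := by
          rw [lintegral_const_mul' _ _ ENNReal.ofReal_ne_top, ← lintegral_eq_lintegral_sphere hn
            (measurable_const.indicator (measurableSet_carlesonTent (3 * δ) ξ)),
            lintegral_indicator (measurableSet_carlesonTent (3 * δ) ξ), setLIntegral_one]
      _ ≤ ENNReal.ofReal (K * δ ^ c) * (ENNReal.ofReal ((3 * δ) ^ (n + 1)) * ENNReal.ofReal V) := by
          rw [← hVe]
          gcongr
          exact volume_carlesonTent_le (by positivity) hξ
      _ ≤ _ := by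
          rw [← ENNReal.ofReal_mul (by positivity), ← ENNReal.ofReal_mul (by positivity),
            hpow δ hδ, mul_pow]
          refine ENNReal.ofReal_le_ofReal ?_
          have : 0 ≤ δ ^ (n + 1) * δ ^ c := by positivity
          nlinarith

lemma carlesonTent_eq_unitBall {δ : ℝ} (hδ : 2 ≤ δ) {ξ : Cn n} (hξ : ‖ξ‖ = 1) :
    carlesonTent n δ ξ = unitBall n := by
  refine Subset.antisymm (carlesonTent_subset δ ξ) fun z hz => ⟨hz, ?_⟩
  rw [mem_unitBall] at hz
  have h1 : ‖(inner ℂ ξ z : ℂ)‖ ≤ ‖z‖ := by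
    simpa [hξ] using norm_inner_le_norm (𝕜 := ℂ) ξ z
  have h2 := norm_sub_le (1 : ℂ) (inner ℂ ξ z)
  rw [norm_one] at h2
  linarith

lemma ballWeight_unitBall_lt_top (hn : 0 < n) {c : ℝ} (hc : -1 < c) :
    ballWeight n c (unitBall n) < ⊤ := by
  obtain ⟨C, -, hC⟩ := exists_ballWeight_carlesonTent_le_of_le_three hn hc
  have hξ : ‖EuclideanSpace.single (⟨0, hn⟩ : Fin n) (1 : ℂ)‖ = 1 := by simp
  rw [← carlesonTent_eq_unitBall (by norm_num : (2 : ℝ) ≤ 3) hξ]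
  exact (hC _ hξ 3 (by norm_num) le_rfl).trans_lt ENNReal.ofReal_lt_top

/-! ### Reformulation of the hypotheses; test functions -/

/-- Finiteness of the supremum in the tent conditions as a uniform bound. Positivity of `φ` rules
out the quotients by `0`, which are `0` or `⊤`. -/
lemma iSup_tent_lt_top_iff {T : Set ℝ} {φ : ℝ → ℝ} (hφ : ∀ δ ∈ T, 0 < φ δ) (μ : Measure (Cn n)) :
    (⨆ ξ ∈ sphere (0 : Cn n) 1, ⨆ δ ∈ T, μ (carlesonTent n δ ξ) / ENNReal.ofReal (φ δ) < ⊤) ↔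
      ∃ K : ℝ, 0 < K ∧ ∀ ξ : Cn n, ‖ξ‖ = 1 → ∀ δ ∈ T,
        μ (carlesonTent n δ ξ) ≤ ENNReal.ofReal (K * φ δ) := by
  have key : ∀ (K : ℝ), 0 < K → ∀ (ξ : Cn n), ∀ δ ∈ T,
      (μ (carlesonTent n δ ξ) / ENNReal.ofReal (φ δ) ≤ ENNReal.ofReal K ↔
        μ (carlesonTent n δ ξ) ≤ ENNReal.ofReal (K * φ δ)) := by
    intro K hK ξ δ hδ
    rw [ENNReal.div_le_iff (ENNReal.ofReal_pos.2 (hφ δ hδ)).ne' ENNReal.ofReal_ne_top,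
      ENNReal.ofReal_mul hK.le]
  constructor
  · intro h
    set S := ⨆ ξ ∈ sphere (0 : Cn n) 1, ⨆ δ ∈ T, μ (carlesonTent n δ ξ) / ENNReal.ofReal (φ δ)
      with hS
    refine ⟨S.toReal + 1, by positivity, fun ξ hξ δ hδ => ?_⟩
    rw [← key _ (by positivity) ξ δ hδ]
    have h1 : μ (carlesonTent n δ ξ) / ENNReal.ofReal (φ δ) ≤ S :=
      (le_iSup₂ (f := fun δ (_ : δ ∈ T) =>
        μ (carlesonTent n δ ξ) / ENNReal.ofReal (φ δ)) δ hδ).trans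
        (le_iSup₂ (f := fun ξ (_ : ξ ∈ sphere (0 : Cn n) 1) =>
          ⨆ δ ∈ T, μ (carlesonTent n δ ξ) / ENNReal.ofReal (φ δ)) ξ (by simpa using hξ))
    refine h1.trans ?_
    rw [← ENNReal.ofReal_toReal h.ne]
    refine ENNReal.ofReal_le_ofReal ?_
    rw [ENNReal.ofReal_toReal h.ne]
    linarith
  · rintro ⟨K, hK, h⟩
    refine lt_of_le_of_lt (b := ENNReal.ofReal K) ?_ ENNReal.ofReal_lt_top
    refine iSup₂_le fun ξ hξ => iSup₂_le fun δ hδ => ?_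
    rw [key K hK ξ δ hδ]
    exact h ξ (by simpa using hξ) δ hδ

lemma isPowerCarleson_iff (hn : 0 < n) (s : ℝ) (μ : Measure (Cn n)) :
    IsPowerCarleson n (s / n) μ ↔ ∃ K : ℝ, 0 < K ∧ ∀ ξ : Cn n, ‖ξ‖ = 1 → ∀ δ : ℝ, 0 < δ →
      μ (carlesonTent n δ ξ) ≤ ENNReal.ofReal (K * δ ^ s) := by
  have hn' : (n : ℝ) * (s / n) = s := mul_div_cancel₀ s (by positivity)
  have := iSup_tent_lt_top_iff (T := Ioi 0) (φ := fun δ => δ ^ s)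
    (fun δ hδ => Real.rpow_pos_of_pos hδ s) μ
  rw [IsPowerCarleson, hn']
  exact this

lemma log_two_div_pos {δ : ℝ} (hδ : δ ∈ Ioo (0 : ℝ) 2) : 0 < Real.log (2 / δ) :=
  Real.log_pos ((one_lt_div hδ.1).2 hδ.2)

lemma isLogCarleson_iff (a : ℝ) (μ : Measure (Cn n)) :
    IsLogCarleson n a μ ↔ ∃ K : ℝ, 0 < K ∧ ∀ ξ : Cn n, ‖ξ‖ = 1 → ∀ δ ∈ Ioo (0 : ℝ) 2,
      μ (carlesonTent n δ ξ) ≤ ENNReal.ofReal (K * Real.log (2 / δ) ^ a) :=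
  iSup_tent_lt_top_iff (fun _ hδ => Real.rpow_pos_of_pos (log_two_div_pos hδ) a) μ

lemma volume_unitBall_pos : 0 < volume (unitBall n) := measure_ball_pos _ _ one_pos

lemma volume_unitBall_lt_top : volume (unitBall n) < ⊤ := measure_ball_lt_top

lemma lintegral_normalizedVolume (F : Cn n → ℝ≥0∞) :
    ∫⁻ z, F z ∂(normalizedVolume n) = (volume (unitBall n))⁻¹ * ∫⁻ z in unitBall n, F z := by
  rw [normalizedVolume, lintegral_smul_measure, smul_eq_mul]

lemma lintegral_ballWeight (c : ℝ) (F : Cn n → ℝ≥0∞) :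
    ∫⁻ z, F z ∂(ballWeight n c) =
      ∫⁻ z in unitBall n, ENNReal.ofReal ((1 - ‖z‖ ^ 2) ^ c) * F z := by
  rw [ballWeight, lintegral_withDensity_eq_lintegral_mul_non_measurable _ (measurable_weight c)
    (Filter.Eventually.of_forall fun _ => ENNReal.ofReal_lt_top)]
  rfl

/-- The norm of `B_p^σ` as a weighted `L^p` norm of the image under the differential operator. -/
lemma besovNormPow_eq {m : ℕ} {σ p α : ℝ}
    (hα : ∀ k : ℕ, (n : ℝ) + 1 + α ≠ -(k : ℝ)) {f : Cn n → ℂ} (hf : IsHolomorphicOnBall n f) :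
    besovNormPow n m σ p α f = (volume (unitBall n))⁻¹ *
      (ENNReal.ofReal (|∏ j ∈ Finset.range m, ((n : ℝ) + 1 + α + j)|⁻¹ ^ p) *
        ∫⁻ z, ENNReal.ofReal (‖eulerIter (n + 1 + α) m f z‖ ^ p)
          ∂(ballWeight n (m * p + σ * p - n - 1))) := by
  rw [besovNormPow, lintegral_normalizedVolume, lintegral_ballWeight,
    ← lintegral_const_mul' _ _ ENNReal.ofReal_ne_top]
  congr 1
  refine setLIntegral_congr_fun isOpen_unitBall.measurableSet fun z hz => ?_
  have hz1 := mem_unitBall.1 hz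
  have h1 : 0 ≤ 1 - ‖z‖ ^ 2 := by nlinarith [norm_nonneg z]
  have h2 : 0 ≤ (1 - ‖z‖ ^ 2) ^ ((m : ℝ) * p + σ * p - n - 1) := Real.rpow_nonneg h1 _
  rw [radialOp_eq_eulerIter hα m hf hz, norm_mul, norm_inv, Complex.norm_real, Real.norm_eq_abs,
    Real.mul_rpow (by positivity) (norm_nonneg _), ← ENNReal.ofReal_mul h2,
    ← ENNReal.ofReal_mul (by positivity)]
  congr 1
  ring

lemma eulerOp_congr {F G : Cn n → ℂ} (h : EqOn F G (unitBall n)) (a : ℝ) :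
    EqOn (eulerOp a F) (eulerOp a G) (unitBall n) := fun z hz => by
  have : F =ᶠ[𝓝 z] G := by
    filter_upwards [isOpen_unitBall.mem_nhds hz] with x hx using h hx
  rw [eulerOp, eulerOp, h hz, this.fderiv_eq]

open Polynomial in
/-- The test functions `-l log(1 - ⟨z,w⟩) + P(1 / (1 - ⟨z,w⟩))`, a class stable under the operators
`a + R`. -/
def testFun (w : Cn n) (l : ℂ) (P : ℂ[X]) (z : Cn n) : ℂ :=
  l * (-Complex.log (1 - inner ℂ w z)) + P.eval ((1 - inner ℂ w z)⁻¹)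

lemma one_sub_inner_mem_slitPlane {w z : Cn n} (h : ‖w‖ * ‖z‖ < 1) :
    1 - (inner ℂ w z : ℂ) ∈ Complex.slitPlane := by
  refine Or.inl ?_
  have h1 := norm_inner_le_norm (𝕜 := ℂ) w z
  have h2 := Complex.re_le_norm (inner ℂ w z : ℂ)
  simp only [Complex.sub_re, Complex.one_re]
  linarith

open Polynomial in
lemma hasFDerivAt_testFun {w z : Cn n} (h : ‖w‖ * ‖z‖ < 1) (l : ℂ) (P : ℂ[X]) :
    HasFDerivAt (testFun w l P) ((l * (1 - inner ℂ w z)⁻¹ +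
      P.derivative.eval ((1 - inner ℂ w z)⁻¹) * ((1 - inner ℂ w z)⁻¹) ^ 2) • innerSL ℂ w) z := by
  have hs := one_sub_inner_mem_slitPlane h
  have hne := Complex.slitPlane_ne_zero hs
  have hu : HasFDerivAt (fun z : Cn n => (inner ℂ w z : ℂ)) (innerSL ℂ w) z :=
    (innerSL ℂ w).hasFDerivAt
  have h1 : HasDerivAt (fun u : ℂ => 1 - u) (-1) (inner ℂ w z : ℂ) := by
    simpa using (hasDerivAt_id (inner ℂ w z : ℂ)).const_sub 1
  have hlog := ((h1.clog hs).neg).const_mul l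
  have hinv := h1.inv hne
  have hP := (P.hasDerivAt ((1 - (inner ℂ w z : ℂ))⁻¹)).comp (inner ℂ w z : ℂ) hinv
  have hsum := (hlog.add hP).comp_hasFDerivAt z hu
  refine hsum.congr_fderiv ?_
  congr 1
  field_simp

lemma isHolomorphicOnBall_testFun {w : Cn n} (hw : ‖w‖ ≤ 1) (l : ℂ) (P : Polynomial ℂ) :
    IsHolomorphicOnBall n (testFun w l P) := fun z hz =>
  (hasFDerivAt_testFun (by
    have := mem_unitBall.1 hz
    nlinarith [norm_nonneg z, norm_nonneg w]) l P).differentiableAt.differentiableWithinAt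

open Polynomial in
/-- The radial derivative maps `-log(1 - ⟨z,w⟩)` to `x - 1` and `P(x)` to `P'(x) (x² - x)`, where
`x = 1 / (1 - ⟨z,w⟩)`. -/
lemma eulerOp_testFun {w : Cn n} (hw : ‖w‖ ≤ 1) (a : ℝ) (l : ℂ) (P : ℂ[X]) :
    EqOn (eulerOp a (testFun w l P))
      (testFun w (a * l) (C (a : ℂ) * P + (X ^ 2 - X) * P.derivative + C l * (X - 1)))
      (unitBall n) := by
  intro z hz
  have hwz : ‖w‖ * ‖z‖ < 1 := by
    have := mem_unitBall.1 hz
    nlinarith [norm_nonneg z, norm_nonneg w]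
  have hne := Complex.slitPlane_ne_zero (one_sub_inner_mem_slitPlane hwz)
  rw [eulerOp, (hasFDerivAt_testFun hwz l P).fderiv]
  simp only [testFun, smul_apply, innerSL_apply_apply, smul_eq_mul, eval_add,
    eval_mul, eval_C, eval_sub, eval_pow, eval_X, eval_one]
  field_simp
  ring

open Polynomial in
lemma natDegree_eulerOp_le (a l : ℂ) {P : ℂ[X]} {N : ℕ} (hP : P.natDegree ≤ N) :
    (C a * P + (X ^ 2 - X) * P.derivative + C l * (X - 1)).natDegree ≤ N + 1 := by
  have h1 : (C a * P).natDegree ≤ N + 1 := (natDegree_C_mul_le _ _).trans (by omega)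
  have h2 : ((X ^ 2 - X) * P.derivative).natDegree ≤ N + 1 := by
    rcases Nat.eq_zero_or_pos P.natDegree with h0 | h0
    · rw [derivative_of_natDegree_zero h0, mul_zero, natDegree_zero]; omega
    · refine natDegree_mul_le.trans ?_
      have h3 : (X ^ 2 - X : ℂ[X]).natDegree ≤ 2 := by compute_degree
      have h4 := natDegree_derivative_le P
      omega
  have h3 : (C l * (X - 1)).natDegree ≤ N + 1 :=
    (natDegree_C_mul_le _ _).trans ((by compute_degree : (X - 1 : ℂ[X]).natDegree ≤ 1).trans
      (by omega))
  exact natDegree_add_le_of_degree_le (natDegree_add_le_of_degree_le h1 h2) h3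

open Polynomial in
lemma exists_eulerIter_testFun (A : ℝ) (m : ℕ) (l : ℂ) {P : ℂ[X]} {N : ℕ}
    (hP : P.natDegree ≤ N) :
    ∃ (l' : ℂ) (P' : ℂ[X]), P'.natDegree ≤ N + m ∧ ∀ w : Cn n, ‖w‖ ≤ 1 →
      EqOn (eulerIter A m (testFun w l P)) (testFun w l' P') (unitBall n) := by
  induction m with
  | zero => exact ⟨l, P, hP, fun w _ z _ => rfl⟩
  | succ m ih =>
    obtain ⟨l', P', hdeg, h⟩ := ih
    refine ⟨((A + m : ℝ) : ℂ) * l', _, natDegree_eulerOp_le ((A + m : ℝ) : ℂ) l' hdeg,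
      fun w hw => ?_⟩
    exact (eulerOp_congr (h w hw) _).trans (eulerOp_testFun hw _ _ _)

open Polynomial in
/-- The logarithm is dominated by the first power of the kernel, and lower powers by higher ones,
because `|1 - ⟨z,w⟩| ≤ 2`. -/
lemma exists_norm_testFun_le (l : ℂ) {P : ℂ[X]} {N : ℕ} (hN : 1 ≤ N) (hP : P.natDegree ≤ N) :
    ∃ K : ℝ, 0 < K ∧ ∀ w z : Cn n, ‖w‖ ≤ 1 → z ∈ unitBall n →
      ‖testFun w l P z‖ ≤ K * ‖1 - (inner ℂ w z : ℂ)‖⁻¹ ^ N := by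
  refine ⟨‖l‖ * ((3 + 2 * Real.pi) * 2 ^ N) +
    ∑ i ∈ Finset.range (N + 1), ‖P.coeff i‖ * 2 ^ N + 1, by positivity, fun w z hw hz => ?_⟩
  have hz1 := mem_unitBall.1 hz
  have hwz : ‖w‖ * ‖z‖ < 1 := by nlinarith [norm_nonneg z, norm_nonneg w]
  have hs := one_sub_inner_mem_slitPlane hwz
  have hne := Complex.slitPlane_ne_zero hs
  set v : ℂ := 1 - inner ℂ w z with hv
  set x := ‖v‖ with hx
  have hx0 : 0 < x := norm_pos_iff.2 hne
  have hx2 : x ≤ 2 := by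
    have h1 := norm_inner_le_norm (𝕜 := ℂ) w z
    have h2 := norm_sub_le (1 : ℂ) (inner ℂ w z)
    rw [norm_one] at h2
    linarith
  have hy : 1 / 2 ≤ x⁻¹ := by
    rw [one_div]; exact inv_anti₀ hx0 hx2
  have hpow : ∀ i ≤ N, x⁻¹ ^ i ≤ 2 ^ N * x⁻¹ ^ N := by
    intro i hi
    have h1 : 1 ≤ (2 * x⁻¹) ^ (N - i) := one_le_pow₀ (by linarith)
    calc x⁻¹ ^ i ≤ x⁻¹ ^ i * (2 ^ i * (2 * x⁻¹) ^ (N - i)) :=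
          le_mul_of_one_le_right (by positivity)
            (one_le_mul_of_one_le_of_one_le (one_le_pow₀ (by norm_num)) h1)
      _ = 2 ^ N * x⁻¹ ^ N := by
          rw [mul_pow, ← mul_assoc (2 ^ i), ← pow_add, Nat.add_sub_cancel' hi, mul_left_comm,
            ← pow_add, Nat.add_sub_cancel' hi]
  have hlog : ‖Complex.log v‖ ≤ (3 + 2 * Real.pi) * x⁻¹ := by
    have h1 := Complex.norm_le_abs_re_add_abs_im (Complex.log v)
    rw [Complex.log_re, Complex.log_im] at h1
    have h2 := Complex.abs_arg_le_pi v
    have h3 := Real.log_le_sub_one_of_pos hx0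
    have h4 := Real.log_le_sub_one_of_pos (inv_pos.2 hx0)
    rw [Real.log_inv] at h4
    have h5 : |Real.log x| ≤ 3 * x⁻¹ := abs_le.2 ⟨by linarith, by linarith⟩
    have h6 : Real.pi ≤ 2 * Real.pi * x⁻¹ := by nlinarith [Real.pi_pos]
    linarith
  have hP' : ‖P.eval v⁻¹‖ ≤ (∑ i ∈ Finset.range (N + 1), ‖P.coeff i‖ * 2 ^ N) * x⁻¹ ^ N := by
    rw [eval_eq_sum_range' (Nat.lt_succ_of_le hP), Finset.sum_mul]
    refine norm_sum_le_of_le _ fun i hi => ?_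
    rw [norm_mul, norm_pow, norm_inv, mul_assoc]
    gcongr
    exact hpow i (by simpa [Nat.lt_succ_iff] using hi)
  have h1 := hpow 1 hN
  rw [pow_one] at h1
  calc ‖testFun w l P z‖ ≤ ‖l‖ * ‖Complex.log v‖ + ‖P.eval v⁻¹‖ := by
        refine (norm_add_le _ _).trans ?_
        rw [norm_mul, norm_neg]
    _ ≤ ‖l‖ * ((3 + 2 * Real.pi) * (2 ^ N * x⁻¹ ^ N)) +
        (∑ i ∈ Finset.range (N + 1), ‖P.coeff i‖ * 2 ^ N) * x⁻¹ ^ N := by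
        gcongr
        exact hlog.trans (by gcongr)
    _ ≤ _ := by
        have : 0 ≤ x⁻¹ ^ N := by positivity
        nlinarith

/-! ### Forelli–Rudin estimates and the norms of the test functions -/

lemma exists_ballWeight_carlesonTent_le (hn : 0 < n) {c : ℝ} (hc : -1 < c) :
    ∃ C : ℝ, 0 < C ∧ ∀ ξ : Cn n, ‖ξ‖ = 1 → ∀ δ : ℝ, 0 < δ →
      ballWeight n c (carlesonTent n δ ξ) ≤ ENNReal.ofReal (C * δ ^ ((n : ℝ) + 1 + c)) := by
  obtain ⟨C, hC0, hC⟩ := exists_ballWeight_carlesonTent_le_of_le_three hn hc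
  refine ⟨C, hC0, fun ξ hξ δ hδ => ?_⟩
  rcases le_or_gt δ 3 with h | h
  · exact hC ξ hξ δ hδ h
  · rw [carlesonTent_eq_unitBall (by linarith) hξ,
      ← carlesonTent_eq_unitBall (by norm_num : (2 : ℝ) ≤ 3) hξ]
    refine (hC ξ hξ 3 (by norm_num) le_rfl).trans (ENNReal.ofReal_le_ofReal ?_)
    have : 0 ≤ (n : ℝ) + 1 + c := by
      have : (0 : ℝ) ≤ n := n.cast_nonneg
      linarith
    gcongr

lemma norm_one_sub_inner_shrink {ξ z : Cn n} (hξ : ‖ξ‖ = 1) (hz : ‖z‖ ≤ 1) {δ : ℝ} (hδ : 0 ≤ δ) :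
    ‖(1 - inner ℂ (((1 - δ : ℝ) : ℂ) • ξ) z : ℂ) - (1 - inner ℂ ξ z)‖ ≤ δ := by
  have h1 : ‖(inner ℂ ξ z : ℂ)‖ ≤ 1 := by
    have := norm_inner_le_norm (𝕜 := ℂ) ξ z
    rw [hξ, one_mul] at this
    exact this.trans hz
  have h2 : (1 - inner ℂ (((1 - δ : ℝ) : ℂ) • ξ) z : ℂ) - (1 - inner ℂ ξ z) =
      (δ : ℂ) * inner ℂ ξ z := by
    rw [inner_smul_left, Complex.conj_ofReal]
    push_cast
    ring
  rw [h2, norm_mul, Complex.norm_real, Real.norm_eq_abs, abs_of_nonneg hδ]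
  nlinarith [norm_nonneg (inner ℂ ξ z : ℂ)]

lemma norm_shrink {ξ : Cn n} (hξ : ‖ξ‖ = 1) {δ : ℝ} (hδ1 : δ ≤ 1) :
    ‖((1 - δ : ℝ) : ℂ) • ξ‖ = 1 - δ := by
  rw [norm_smul, hξ, mul_one, Complex.norm_real, Real.norm_eq_abs, abs_of_nonneg (by linarith)]

lemma le_norm_one_sub_inner_shrink {ξ z : Cn n} (hξ : ‖ξ‖ = 1) (hz : ‖z‖ ≤ 1) {δ : ℝ}
    (hδ1 : δ ≤ 1) : δ ≤ ‖(1 - inner ℂ (((1 - δ : ℝ) : ℂ) • ξ) z : ℂ)‖ := by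
  have h1 := norm_inner_le_norm (𝕜 := ℂ) (((1 - δ : ℝ) : ℂ) • ξ) z
  rw [norm_shrink hξ hδ1] at h1
  have h2 := norm_sub_norm_le (1 : ℂ) (inner ℂ (((1 - δ : ℝ) : ℂ) • ξ) z)
  rw [norm_one] at h2
  nlinarith [norm_nonneg z]

/-- Forelli–Rudin type estimate: splitting the ball into the dyadic shells between the tents
`Q_{2^j δ}(ξ)` bounds the integral of a power of the kernel with pole `(1 - δ) ξ` by a finite
geometric sum. -/
lemma exists_lintegral_kernel_le (hn : 0 < n) {c d : ℝ} (hc : -1 < c) (hd : 0 ≤ d) :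
    ∃ C : ℝ, 0 < C ∧ ∀ ξ : Cn n, ‖ξ‖ = 1 → ∀ δ : ℝ, 0 < δ → δ ≤ 1 → ∀ J : ℕ, 2 ≤ 2 ^ J * δ →
      ∫⁻ z, ENNReal.ofReal (‖(1 - inner ℂ (((1 - δ : ℝ) : ℂ) • ξ) z : ℂ)‖⁻¹ ^ d)
          ∂(ballWeight n c) ≤
        ENNReal.ofReal (C * ∑ j ∈ Finset.range (J + 1), (2 ^ j * δ) ^ ((n : ℝ) + 1 + c - d)) := by
  obtain ⟨C, hC0, hC⟩ := exists_ballWeight_carlesonTent_le hn hc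
  refine ⟨4 ^ d * C, by positivity, fun ξ hξ δ hδ hδ1 J hJ => ?_⟩
  have hae : ∀ᵐ z ∂(ballWeight n c), z ∈ unitBall n :=
    (withDensity_absolutelyContinuous _ _).ae_le (ae_restrict_mem isOpen_unitBall.measurableSet)
  calc _ ≤ ∫⁻ z, ∑ j ∈ Finset.range (J + 1), (carlesonTent n (2 ^ j * δ) ξ).indicator
          (fun _ => ENNReal.ofReal ((2 ^ j * δ / 4)⁻¹ ^ d)) z ∂(ballWeight n c) := by
        refine lintegral_mono_ae (hae.mono fun z hz => ?_)
        have hz1 := mem_unitBall.1 hz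
        set x := ‖(1 - inner ℂ ξ z : ℂ)‖ with hx
        set y := ‖(1 - inner ℂ (((1 - δ : ℝ) : ℂ) • ξ) z : ℂ)‖ with hy
        have hyδ : δ ≤ y := le_norm_one_sub_inner_shrink hξ hz1.le hδ1
        have hyx : x / 2 ≤ y := by
          have h1 := norm_one_sub_inner_shrink hξ hz1.le hδ.le
          have h2 := norm_sub_norm_le (1 - inner ℂ ξ z : ℂ)
            (1 - inner ℂ (((1 - δ : ℝ) : ℂ) • ξ) z)
          rw [norm_sub_rev (1 - inner ℂ ξ z : ℂ)] at h2
          linarith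
        have hex : ∃ j : ℕ, x < 2 ^ j * δ := by
          refine ⟨J, lt_of_lt_of_le ?_ hJ⟩
          have : z ∈ carlesonTent n 2 ξ := by rwa [carlesonTent_eq_unitBall le_rfl hξ]
          exact this.2
        classical
        set j := Nat.find hex with hj
        have hjx : x < 2 ^ j * δ := Nat.find_spec hex
        have hjJ : j ≤ J := Nat.find_min' hex (lt_of_lt_of_le (by
          have : z ∈ carlesonTent n 2 ξ := by rwa [carlesonTent_eq_unitBall le_rfl hξ]
          exact this.2) hJ)
        have hylow : 2 ^ j * δ / 4 ≤ y := by
          rcases Nat.eq_zero_or_pos j with h0 | h0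
          · rw [h0]; linarith
          · have := Nat.find_min hex (Nat.sub_lt h0 one_pos)
            rw [not_lt] at this
            have e : (2 : ℝ) ^ j = 2 * 2 ^ (j - 1) := by
              rw [← pow_succ', Nat.sub_add_cancel h0]
            rw [e]
            linarith
        have hmem : z ∈ carlesonTent n (2 ^ j * δ) ξ := ⟨hz, hjx⟩
        refine le_trans ?_ (Finset.single_le_sum (f := fun j =>
          (carlesonTent n (2 ^ j * δ) ξ).indicator
          (fun _ => ENNReal.ofReal ((2 ^ j * δ / 4)⁻¹ ^ d)) z) (fun _ _ => zero_le)
          (Finset.mem_range.2 (Nat.lt_succ_of_le hjJ)))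
        rw [indicator_of_mem hmem]
        refine ENNReal.ofReal_le_ofReal ?_
        gcongr
    _ = ∑ j ∈ Finset.range (J + 1), ENNReal.ofReal ((2 ^ j * δ / 4)⁻¹ ^ d) *
          ballWeight n c (carlesonTent n (2 ^ j * δ) ξ) := by
        rw [lintegral_finsetSum _ fun j _ =>
          measurable_const.indicator (measurableSet_carlesonTent _ ξ)]
        refine Finset.sum_congr rfl fun j _ => ?_
        rw [lintegral_indicator_const (measurableSet_carlesonTent _ ξ)]
    _ ≤ ∑ j ∈ Finset.range (J + 1), ENNReal.ofReal
          (4 ^ d * C * (2 ^ j * δ) ^ ((n : ℝ) + 1 + c - d)) := by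
        refine Finset.sum_le_sum fun j _ => ?_
        have h0 : 0 < 2 ^ j * δ := by positivity
        refine (mul_le_mul_right (hC ξ hξ _ h0) _).trans ?_
        rw [← ENNReal.ofReal_mul (by positivity)]
        refine ENNReal.ofReal_le_ofReal (le_of_eq ?_)
        rw [Real.rpow_sub h0, inv_div, Real.div_rpow (by norm_num) h0.le]
        ring
    _ = _ := by
        rw [← ENNReal.ofReal_sum_of_nonneg fun j _ => by positivity, Finset.mul_sum]

lemma exists_dyadic {δ : ℝ} (hδ : 0 < δ) (hδ1 : δ ≤ 1) :
    ∃ J : ℕ, 2 ≤ 2 ^ J * δ ∧ ((J + 1 : ℕ) : ℝ) ≤ 3 / Real.log 2 * Real.log (2 / δ) := by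
  have hl2 : 0 < Real.log 2 := Real.log_pos one_lt_two
  have hlog : Real.log 2 ≤ Real.log (2 / δ) :=
    Real.log_le_log two_pos (by rw [le_div_iff₀ hδ]; linarith)
  have h1 : 1 ≤ Real.log (2 / δ) / Real.log 2 := (one_le_div hl2).2 hlog
  refine ⟨⌈Real.log (2 / δ) / Real.log 2⌉₊, ?_, ?_⟩
  · have h2 := Nat.le_ceil (Real.log (2 / δ) / Real.log 2)
    rw [div_le_iff₀ hl2, ← Real.log_pow] at h2
    rw [← div_le_iff₀ hδ]
    exact (Real.log_le_log_iff (by positivity) (by positivity)).1 h2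
  · have h2 := (Nat.ceil_lt_add_one (by linarith : 0 ≤ Real.log (2 / δ) / Real.log 2)).le
    push_cast
    have : 3 / Real.log 2 * Real.log (2 / δ) = 3 * (Real.log (2 / δ) / Real.log 2) := by ring
    linarith

/-- In the supercritical case the geometric sum is dominated by its first term. -/
lemma exists_lintegral_kernel_le_rpow (hn : 0 < n) {c d : ℝ} (hc : -1 < c)
    (hd : (n : ℝ) + 1 + c < d) :
    ∃ C : ℝ, 0 < C ∧ ∀ ξ : Cn n, ‖ξ‖ = 1 → ∀ δ : ℝ, 0 < δ → δ ≤ 1 →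
      ∫⁻ z, ENNReal.ofReal (‖(1 - inner ℂ (((1 - δ : ℝ) : ℂ) • ξ) z : ℂ)‖⁻¹ ^ d)
          ∂(ballWeight n c) ≤ ENNReal.ofReal (C * δ ^ ((n : ℝ) + 1 + c - d)) := by
  have hn0 : (0 : ℝ) ≤ n := n.cast_nonneg
  obtain ⟨C, hC0, hC⟩ := exists_lintegral_kernel_le hn hc (d := d) (by linarith)
  set e := (n : ℝ) + 1 + c - d with he
  have he0 : e < 0 := by linarith
  have hr1 : (2 : ℝ) ^ e < 1 := Real.rpow_lt_one_of_one_lt_of_neg one_lt_two he0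
  have hr0 : 0 < (2 : ℝ) ^ e := by positivity
  have h1 : 0 < 1 - (2 : ℝ) ^ e := by linarith
  refine ⟨C * (1 - 2 ^ e)⁻¹, by positivity, fun ξ hξ δ hδ hδ1 => ?_⟩
  obtain ⟨J, hJ, -⟩ := exists_dyadic hδ hδ1
  refine (hC ξ hξ δ hδ hδ1 J hJ).trans (ENNReal.ofReal_le_ofReal ?_)
  rw [mul_assoc]
  gcongr
  have : ∀ j : ℕ, ((2 : ℝ) ^ j * δ) ^ e = ((2 : ℝ) ^ e) ^ j * δ ^ e := fun j => by
    rw [Real.mul_rpow (by positivity) hδ.le, ← Real.rpow_natCast, ← Real.rpow_natCast,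
      ← Real.rpow_mul (by norm_num), ← Real.rpow_mul (by norm_num), mul_comm (j : ℝ)]
  simp only [this]
  rw [← Finset.sum_mul]
  gcongr
  rw [← tsum_geometric_of_lt_one hr0.le hr1]
  exact (summable_geometric_of_lt_one hr0.le hr1).sum_le_tsum _ fun _ _ => by positivity

/-- In the critical case all terms of the sum are `1`, and there are `O(log (2/δ))` of them. -/
lemma exists_lintegral_kernel_le_log (hn : 0 < n) {c : ℝ} (hc : -1 < c) :
    ∃ C : ℝ, 0 < C ∧ ∀ ξ : Cn n, ‖ξ‖ = 1 → ∀ δ : ℝ, 0 < δ → δ ≤ 1 →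
      ∫⁻ z, ENNReal.ofReal (‖(1 - inner ℂ (((1 - δ : ℝ) : ℂ) • ξ) z : ℂ)‖⁻¹ ^ ((n : ℝ) + 1 + c))
          ∂(ballWeight n c) ≤ ENNReal.ofReal (C * Real.log (2 / δ)) := by
  have hn0 : (0 : ℝ) ≤ n := n.cast_nonneg
  have hl2 : 0 < Real.log 2 := Real.log_pos one_lt_two
  obtain ⟨C, hC0, hC⟩ := exists_lintegral_kernel_le hn hc (d := (n : ℝ) + 1 + c) (by linarith)
  refine ⟨C * (3 / Real.log 2), by positivity, fun ξ hξ δ hδ hδ1 => ?_⟩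
  obtain ⟨J, hJ, hJ2⟩ := exists_dyadic hδ hδ1
  refine (hC ξ hξ δ hδ hδ1 J hJ).trans (ENNReal.ofReal_le_ofReal ?_)
  rw [mul_assoc]
  gcongr
  simpa using hJ2

lemma exists_norm_iteratedFDeriv_testFun_le {w : Cn n} (hw : ‖w‖ < 1) (l : ℂ) (P : Polynomial ℂ)
    (m : ℕ) : ∃ K : ℝ, 0 < K ∧ ∀ z ∈ unitBall n, ‖iteratedFDeriv ℂ m (testFun w l P) z‖ ≤ K := by
  have hU : IsOpen {z : Cn n | ‖w‖ * ‖z‖ < 1} :=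
    isOpen_lt (by fun_prop) continuous_const
  have hd : DifferentiableOn ℂ (testFun w l P) {z : Cn n | ‖w‖ * ‖z‖ < 1} := fun z hz =>
    (hasFDerivAt_testFun hz l P).differentiableAt.differentiableWithinAt
  have hc := (contDiffOn_of_differentiableOn hU hd).continuousOn_iteratedFDerivWithin (m := m)
    (by exact_mod_cast le_top) hU.uniqueDiffOn
  have hsub : closedBall (0 : Cn n) 1 ⊆ {z : Cn n | ‖w‖ * ‖z‖ < 1} := fun z hz => by
    rw [mem_closedBall, dist_zero_right] at hz
    change ‖w‖ * ‖z‖ < 1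
    nlinarith [norm_nonneg z, norm_nonneg w]
  obtain ⟨K, hK⟩ := (isCompact_closedBall (0 : Cn n) 1).exists_bound_of_continuousOn (hc.mono hsub)
  refine ⟨|K| + 1, by positivity, fun z hz => ?_⟩
  have hz' : z ∈ closedBall (0 : Cn n) 1 := ball_subset_closedBall hz
  have := hK z hz'
  rw [iteratedFDerivWithin_of_isOpen m hU (hsub hz')] at this
  linarith [le_abs_self K]

/-- A test function with pole parameter `|w| < 1` is smooth up to the boundary, and `(1 - |z|²)^c`
is integrable for `c = mp + σp - n - 1 > -1`. -/
lemma memBesov_testFun (hn : 0 < n) {m : ℕ} {σ p : ℝ} (hp : 0 < p)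
    (hq : (n : ℝ) < m * p + σ * p) {w : Cn n} (hw : ‖w‖ < 1) (l : ℂ) (P : Polynomial ℂ) :
    MemBesov n m σ p (testFun w l P) := by
  refine ⟨isHolomorphicOnBall_testFun hw.le l P, ?_⟩
  obtain ⟨K, hK0, hK⟩ := exists_norm_iteratedFDeriv_testFun_le hw l P m
  refine ENNReal.add_lt_top.2 ⟨ENNReal.sum_lt_top.2 fun k _ => ENNReal.ofReal_lt_top, ?_⟩
  rw [invariantMeasure, lintegral_withDensity_eq_lintegral_mul_non_measurable _
    (measurable_weight _) (Filter.Eventually.of_forall fun _ => ENNReal.ofReal_lt_top),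
    lintegral_normalizedVolume]
  refine ENNReal.mul_lt_top (ENNReal.inv_lt_top.2 volume_unitBall_pos) ?_
  calc _ ≤ ∫⁻ z in unitBall n, ENNReal.ofReal ((1 - ‖z‖ ^ 2) ^ ((m : ℝ) * p + σ * p - n - 1)) *
        ENNReal.ofReal (K ^ p) := by
        refine setLIntegral_mono' isOpen_unitBall.measurableSet fun z hz => ?_
        have hz1 := mem_unitBall.1 hz
        have h1 : 0 < 1 - ‖z‖ ^ 2 := by nlinarith [norm_nonneg z]
        rw [Pi.mul_apply, ← ENNReal.ofReal_mul (by positivity),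
          ← ENNReal.ofReal_mul (by positivity)]
        refine ENNReal.ofReal_le_ofReal ?_
        rw [Real.mul_rpow (by positivity) (norm_nonneg _), ← Real.rpow_mul h1.le, ← mul_assoc,
          ← Real.rpow_add h1]
        have e : -(n : ℝ) - 1 + ((m : ℝ) + σ) * p = (m : ℝ) * p + σ * p - n - 1 := by ring
        rw [e]
        gcongr
        exact hK z hz
    _ = ∫⁻ _, ENNReal.ofReal (K ^ p) ∂(ballWeight n ((m : ℝ) * p + σ * p - n - 1)) := by
        rw [lintegral_ballWeight]
    _ < ⊤ := by
        rw [lintegral_const]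
        refine ENNReal.mul_lt_top ENNReal.ofReal_lt_top ?_
        have h := ballWeight_unitBall_lt_top hn
          (by linarith : -1 < (m : ℝ) * p + σ * p - n - 1)
        rw [ballWeight, withDensity_apply _ isOpen_unitBall.measurableSet,
          Measure.restrict_restrict isOpen_unitBall.measurableSet, inter_self] at h
        rwa [ballWeight, withDensity_apply _ MeasurableSet.univ, Measure.restrict_univ]

open Polynomial in
/-- Uniformly in `w`, the norm of a test function built from a polynomial of degree at most `N` is
controlled by the integral of a power of the kernel. -/
lemma exists_besovNormPow_testFun_le {m : ℕ} (hm : 0 < m) (σ : ℝ) {p α : ℝ} (hp : 0 < p)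
    (hα : ∀ k : ℕ, (n : ℝ) + 1 + α ≠ -(k : ℝ)) (l : ℂ) {P : ℂ[X]} {N : ℕ}
    (hP : P.natDegree ≤ N) :
    ∃ K : ℝ, 0 < K ∧ ∀ w : Cn n, ‖w‖ ≤ 1 → besovNormPow n m σ p α (testFun w l P) ≤
      ENNReal.ofReal K * ∫⁻ z, ENNReal.ofReal (‖(1 - inner ℂ w z : ℂ)‖⁻¹ ^ (((N + m : ℕ) : ℝ) * p))
        ∂(ballWeight n (m * p + σ * p - n - 1)) := by
  obtain ⟨l', P', hdeg, hE⟩ := exists_eulerIter_testFun (n := n) (n + 1 + α) m l hP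
  obtain ⟨K, hK0, hK⟩ := exists_norm_testFun_le (n := n) l' (by omega : 1 ≤ N + m) hdeg
  set c₀ := ((volume (unitBall n))⁻¹).toReal *
    |∏ j ∈ Finset.range m, ((n : ℝ) + 1 + α + j)|⁻¹ ^ p with hc₀
  have hv : (volume (unitBall n))⁻¹ = ENNReal.ofReal ((volume (unitBall n))⁻¹).toReal :=
    (ENNReal.ofReal_toReal (ENNReal.inv_lt_top.2 volume_unitBall_pos).ne).symm
  have hc₀0 : 0 ≤ c₀ := by positivity
  refine ⟨c₀ * K ^ p + 1, by positivity, fun w hw => ?_⟩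
  rw [besovNormPow_eq hα (isHolomorphicOnBall_testFun hw l P), hv, ← mul_assoc,
    ← ENNReal.ofReal_mul ENNReal.toReal_nonneg, ← hc₀]
  have hae : ∀ᵐ z ∂(ballWeight n (m * p + σ * p - n - 1)), z ∈ unitBall n :=
    (withDensity_absolutelyContinuous _ _).ae_le (ae_restrict_mem isOpen_unitBall.measurableSet)
  have hle : ∫⁻ z, ENNReal.ofReal (‖eulerIter (n + 1 + α) m (testFun w l P) z‖ ^ p)
          ∂(ballWeight n (m * p + σ * p - n - 1)) ≤ ENNReal.ofReal (K ^ p) *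
      ∫⁻ z, ENNReal.ofReal (‖(1 - inner ℂ w z : ℂ)‖⁻¹ ^ (((N + m : ℕ) : ℝ) * p))
        ∂(ballWeight n (m * p + σ * p - n - 1)) := by
    rw [← lintegral_const_mul' _ _ ENNReal.ofReal_ne_top]
    refine lintegral_mono_ae (hae.mono fun z hz => ?_)
    rw [← ENNReal.ofReal_mul (by positivity), hE w hw hz]
    refine ENNReal.ofReal_le_ofReal ?_
    rw [Real.rpow_mul (by positivity), ← Real.mul_rpow (by positivity) (by positivity),
      Real.rpow_natCast]
    exact Real.rpow_le_rpow (norm_nonneg _) (hK w z hw hz) hp.le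
  refine (mul_le_mul_right hle _).trans ?_
  rw [← mul_assoc, ← ENNReal.ofReal_mul hc₀0]
  gcongr
  linarith

/-! ### Necessity of the tent conditions -/

lemma ofReal_mul_measure_le {μ : Measure (Cn n)} {p : ℝ} (hp : 0 ≤ p) {f : Cn n → ℂ} {b : ℝ}
    (hb : 0 ≤ b) {S : Set (Cn n)} (hS : S ⊆ unitBall n) (hSm : MeasurableSet S)
    (h : ∀ z ∈ S, b ≤ ‖f z‖) :
    ENNReal.ofReal (b ^ p) * μ S ≤ ∫⁻ z in unitBall n, ENNReal.ofReal (‖f z‖ ^ p) ∂μ :=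
  calc ENNReal.ofReal (b ^ p) * μ S = ∫⁻ _ in S, ENNReal.ofReal (b ^ p) ∂μ := by
        rw [setLIntegral_const]
    _ ≤ ∫⁻ z in S, ENNReal.ofReal (‖f z‖ ^ p) ∂μ :=
        setLIntegral_mono' hSm fun z hz =>
          ENNReal.ofReal_le_ofReal (Real.rpow_le_rpow hb (h z hz) hp)
    _ ≤ _ := lintegral_mono_set hS

lemma le_ofReal_of_ofReal_mul_le {a A : ℝ} (ha : 0 < a) {x : ℝ≥0∞}
    (h : ENNReal.ofReal a * x ≤ ENNReal.ofReal A) : x ≤ ENNReal.ofReal (a⁻¹ * A) := by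
  rw [ENNReal.ofReal_mul (by positivity), ENNReal.ofReal_inv_of_pos ha]
  rw [mul_comm, ← ENNReal.le_div_iff_mul_le
    (Or.inl (ENNReal.ofReal_pos.2 ha).ne') (Or.inl ENNReal.ofReal_ne_top)] at h
  rwa [mul_comm, ← div_eq_mul_inv]

/-- The constant function `1` shows that a Carleson measure has finite mass on the ball. -/
lemma exists_measure_unitBall_le (hn : 0 < n) {m : ℕ} (hm : 0 < m) {σ p α : ℝ} (hp : 0 < p)
    (hq : (n : ℝ) < m * p + σ * p) (hα : ∀ k : ℕ, (n : ℝ) + 1 + α ≠ -(k : ℝ))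
    {μ : Measure (Cn n)} (hμ : IsCarlesonForBesov n m σ p α μ) :
    ∃ M : ℝ, 0 < M ∧ μ (unitBall n) ≤ ENNReal.ofReal M := by
  obtain ⟨C, hC0, hC⟩ := hμ
  have hmem := memBesov_testFun hn (σ := σ) hp hq (w := 0) (by simp) 0 1
  obtain ⟨K, hK0, hK⟩ := exists_besovNormPow_testFun_le hm σ hp hα 0 (P := 1) (N := 0)
    (by simp)
  have h1 := ofReal_mul_measure_le (μ := μ) hp.le (f := testFun (0 : Cn n) 0 1) (b := 1)
    zero_le_one Subset.rfl isOpen_unitBall.measurableSet (fun z _ => by simp [testFun])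
  have h2 := h1.trans ((hC _ hmem).trans (mul_le_mul_right (hK 0 (by simp)) _))
  have hc : -1 < (m : ℝ) * p + σ * p - n - 1 := by linarith
  have hfin : ballWeight n ((m : ℝ) * p + σ * p - n - 1) univ < ⊤ := by
    have h := ballWeight_unitBall_lt_top hn hc
    rw [ballWeight, withDensity_apply _ isOpen_unitBall.measurableSet,
      Measure.restrict_restrict isOpen_unitBall.measurableSet, inter_self] at h
    rwa [ballWeight, withDensity_apply _ MeasurableSet.univ, Measure.restrict_univ]
  simp only [inner_zero_left, sub_zero, norm_one, inv_one, Real.one_rpow, ENNReal.ofReal_one,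
    lintegral_const, one_mul] at h2
  have htop := lt_of_le_of_lt h2 (ENNReal.mul_lt_top ENNReal.ofReal_lt_top
    (ENNReal.mul_lt_top ENNReal.ofReal_lt_top hfin))
  refine ⟨(μ (unitBall n)).toReal + 1, by positivity, ?_⟩
  rw [← ENNReal.ofReal_toReal htop.ne]
  refine ENNReal.ofReal_le_ofReal ?_
  rw [ENNReal.ofReal_toReal htop.ne]
  linarith

lemma norm_one_sub_inner_shrink_lt {ξ z : Cn n} (hξ : ‖ξ‖ = 1) {δ : ℝ} (hδ : 0 ≤ δ)
    (hz : z ∈ carlesonTent n δ ξ) :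
    ‖(1 - inner ℂ (((1 - δ : ℝ) : ℂ) • ξ) z : ℂ)‖ < 2 * δ := by
  have h1 := norm_one_sub_inner_shrink hξ (mem_unitBall.1 hz.1).le hδ
  have h2 := norm_sub_norm_le (1 - inner ℂ (((1 - δ : ℝ) : ℂ) • ξ) z : ℂ) (1 - inner ℂ ξ z)
  linarith [hz.2]

/-- For `σ > 0` the test functions are negative powers `(1 - ⟨z,w⟩)^{-b}` with `b > σ`. -/
theorem isPowerCarleson_of_isCarlesonForBesov (hn : 0 < n) {m : ℕ} (hm : 0 < m) {σ p α : ℝ}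
    (hσ : 0 < σ) (hp : 0 < p) (hq : (n : ℝ) < m * p + σ * p)
    (hα : ∀ k : ℕ, (n : ℝ) + 1 + α ≠ -(k : ℝ)) {μ : Measure (Cn n)}
    (hμ : IsCarlesonForBesov n m σ p α μ) : IsPowerCarleson n (σ * p / n) μ := by
  rw [isPowerCarleson_iff hn]
  obtain ⟨M, hM0, hM⟩ := exists_measure_unitBall_le hn hm hp hq hα hμ
  obtain ⟨C, hC0, hC⟩ := hμ
  obtain ⟨b, hb⟩ := exists_nat_gt σ
  obtain ⟨K, hK0, hK⟩ := exists_besovNormPow_testFun_le hm σ hp hα 0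
    (P := Polynomial.X ^ b) (N := b) (by simp)
  have hc : -1 < (m : ℝ) * p + σ * p - n - 1 := by linarith
  obtain ⟨D, hD0, hD⟩ := exists_lintegral_kernel_le_rpow (n := n) hn hc
    (d := ((b + m : ℕ) : ℝ) * p) (by push_cast; nlinarith)
  refine ⟨2 ^ (b * p) * (C * (K * D)) + M, by positivity, fun ξ hξ δ hδ => ?_⟩
  rcases le_or_gt δ 1 with hδ1 | hδ1
  · set w : Cn n := ((1 - δ : ℝ) : ℂ) • ξ with hw
    have hwn : ‖w‖ = 1 - δ := norm_shrink hξ hδ1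
    have hmem := memBesov_testFun hn (σ := σ) hp hq (w := w) (by linarith) 0 (Polynomial.X ^ b)
    have hlow : ∀ z ∈ carlesonTent n δ ξ,
        (2 * δ)⁻¹ ^ b ≤ ‖testFun w 0 (Polynomial.X ^ b) z‖ := by
      intro z hz
      have h1 := norm_one_sub_inner_shrink_lt hξ hδ.le hz
      have h2 := le_norm_one_sub_inner_shrink hξ (mem_unitBall.1 hz.1).le hδ1
      rw [testFun, zero_mul, zero_add, Polynomial.eval_pow, Polynomial.eval_X, norm_pow, norm_inv]
      gcongr
      exact hδ.trans_le h2
    have h1 := ofReal_mul_measure_le (μ := μ) hp.le (by positivity) (carlesonTent_subset δ ξ)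
      (measurableSet_carlesonTent δ ξ) hlow
    have h2 := h1.trans ((hC _ hmem).trans (mul_le_mul_right ((hK w (by linarith)).trans
      (mul_le_mul_right (hD ξ hξ δ hδ hδ1) _)) _))
    rw [← ENNReal.ofReal_mul hK0.le, ← ENNReal.ofReal_mul hC0.le] at h2
    refine (le_ofReal_of_ofReal_mul_le (by positivity) h2).trans (ENNReal.ofReal_le_ofReal ?_)
    have e1 : (n : ℝ) + 1 + (m * p + σ * p - n - 1) - ((b + m : ℕ) : ℝ) * p =
        σ * p - b * p := by push_cast; ring
    have e2 : (((2 * δ)⁻¹ ^ b) ^ p)⁻¹ = 2 ^ ((b : ℝ) * p) * δ ^ ((b : ℝ) * p) := by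
      rw [← Real.mul_rpow (by norm_num) hδ.le, inv_pow, Real.inv_rpow (by positivity), inv_inv,
        Real.rpow_mul (by positivity), Real.rpow_natCast]
    have e3 : δ ^ ((b : ℝ) * p) * δ ^ (σ * p - b * p) = δ ^ (σ * p) := by
      rw [← Real.rpow_add hδ]; congr 1; ring
    rw [e1, e2]
    have h0 : 0 ≤ M * δ ^ (σ * p) := by positivity
    calc _ = 2 ^ ((b : ℝ) * p) * (C * (K * D)) * (δ ^ ((b : ℝ) * p) * δ ^ (σ * p - b * p)) := by
          ring
      _ ≤ _ := by rw [e3]; linarith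
  · refine (measure_mono (carlesonTent_subset δ ξ)).trans (hM.trans (ENNReal.ofReal_le_ofReal ?_))
    have h1 : 1 ≤ δ ^ (σ * p) := Real.one_le_rpow hδ1.le (by positivity)
    have h2 : 0 ≤ 2 ^ (b * p) * (C * (K * D)) := by positivity
    nlinarith

/-- For `σ = 0` the test functions are the logarithms `-log(1 - ⟨z,w⟩)`, whose norm falls in the
critical case of the kernel estimate. -/
theorem isLogCarleson_of_isCarlesonForBesov (hn : 0 < n) {m : ℕ} (hm : 0 < m) {p α : ℝ}
    (hp : 1 < p) (hq : (n : ℝ) < m * p)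
    (hα : ∀ k : ℕ, (n : ℝ) + 1 + α ≠ -(k : ℝ)) {μ : Measure (Cn n)}
    (hμ : IsCarlesonForBesov n m 0 p α μ) : IsLogCarleson n (1 - p) μ := by
  rw [isLogCarleson_iff]
  have hp0 : 0 < p := by linarith
  have hq' : (n : ℝ) < m * p + 0 * p := by linarith
  obtain ⟨M, hM0, hM⟩ := exists_measure_unitBall_le hn hm hp0 hq' hα hμ
  obtain ⟨C, hC0, hC⟩ := hμ
  obtain ⟨K, hK0, hK⟩ := exists_besovNormPow_testFun_le hm 0 hp0 hα 1
    (P := 0) (N := 0) (by simp)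
  have hc : -1 < (m : ℝ) * p + 0 * p - n - 1 := by linarith
  obtain ⟨D, hD0, hD⟩ := exists_lintegral_kernel_le_log (n := n) hn hc
  have hl16 : 0 < Real.log 16 := Real.log_pos (by norm_num)
  refine ⟨2 ^ p * (C * (K * D)) + M * Real.log 16 ^ (p - 1), by positivity,
    fun ξ hξ δ hδ => ?_⟩
  have hδ0 := hδ.1
  have hL0 := log_two_div_pos hδ
  set L := Real.log (2 / δ) with hL
  have hLp : 0 < L ^ (1 - p) := Real.rpow_pos_of_pos hL0 _
  rcases le_or_gt δ (1 / 8) with hδ1 | hδ1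
  · set w : Cn n := ((1 - δ : ℝ) : ℂ) • ξ with hw
    have hwn : ‖w‖ = 1 - δ := norm_shrink hξ (by linarith)
    have hmem := memBesov_testFun hn (σ := 0) hp0 hq' (w := w) (by linarith) 1 0
    have hlow : ∀ z ∈ carlesonTent n δ ξ, L / 2 ≤ ‖testFun w 1 0 z‖ := by
      intro z hz
      have h1 := norm_one_sub_inner_shrink_lt hξ hδ0.le hz
      have h2 := le_norm_one_sub_inner_shrink hξ (mem_unitBall.1 hz.1).le (by linarith : δ ≤ 1)
      rw [testFun, one_mul, Polynomial.eval_zero, add_zero]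
      refine le_trans ?_ (Complex.re_le_norm _)
      rw [Complex.neg_re, Complex.log_re]
      have h3 := Real.log_lt_log (hδ0.trans_le h2) h1
      -- `log (1 / (2 δ)) ≥ log (2 / δ) / 2` amounts to `8 δ ≤ 1`
      have h4 : Real.log (8 * δ) ≤ 0 := Real.log_nonpos (by positivity) (by linarith)
      have e8 : Real.log 8 = 3 * Real.log 2 := by
        rw [show (8 : ℝ) = 2 ^ 3 by norm_num, Real.log_pow]; norm_num
      rw [Real.log_mul (by norm_num) hδ0.ne', e8] at h4
      rw [Real.log_mul (by norm_num) hδ0.ne'] at h3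
      rw [hL, Real.log_div (by norm_num) hδ0.ne']
      linarith
    have h1 := ofReal_mul_measure_le (μ := μ) hp0.le (by positivity) (carlesonTent_subset δ ξ)
      (measurableSet_carlesonTent δ ξ) hlow
    have hD' := hD ξ hξ δ hδ0 (by linarith)
    have e1 : (n : ℝ) + 1 + (m * p + 0 * p - n - 1) = ((0 + m : ℕ) : ℝ) * p := by
      push_cast; ring
    rw [e1] at hD'
    have h2 := h1.trans ((hC _ hmem).trans (mul_le_mul_right ((hK w (by linarith)).trans
      (mul_le_mul_right hD' _)) _))
    rw [← ENNReal.ofReal_mul hK0.le, ← ENNReal.ofReal_mul hC0.le] at h2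
    refine (le_ofReal_of_ofReal_mul_le (by positivity) h2).trans (ENNReal.ofReal_le_ofReal ?_)
    have e2 : ((L / 2) ^ p)⁻¹ * L = 2 ^ p * L ^ (1 - p) := by
      rw [Real.div_rpow hL0.le (by norm_num), inv_div, Real.rpow_sub hL0, Real.rpow_one]
      ring
    calc _ = (C * (K * D)) * (((L / 2) ^ p)⁻¹ * L) := by ring
      _ = 2 ^ p * (C * (K * D)) * L ^ (1 - p) := by rw [e2]; ring
      _ ≤ _ := by
        gcongr
        have : 0 ≤ M * Real.log 16 ^ (p - 1) := by positivity
        linarith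
  · refine (measure_mono (carlesonTent_subset δ ξ)).trans (hM.trans (ENNReal.ofReal_le_ofReal ?_))
    have hL16 : L ≤ Real.log 16 := by
      refine Real.log_le_log (by positivity) ?_
      rw [div_le_iff₀ hδ0]
      linarith
    have h1 : Real.log 16 ^ (1 - p) ≤ L ^ (1 - p) :=
      Real.rpow_le_rpow_of_nonpos hL0 hL16 (by linarith)
    have h2 : Real.log 16 ^ (p - 1) * Real.log 16 ^ (1 - p) = 1 := by
      rw [← Real.rpow_add hl16]; simp
    calc M = M * (Real.log 16 ^ (p - 1) * Real.log 16 ^ (1 - p)) := by rw [h2, mul_one]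
      _ ≤ M * (Real.log 16 ^ (p - 1) * L ^ (1 - p)) := by gcongr
      _ = M * Real.log 16 ^ (p - 1) * L ^ (1 - p) := by ring
      _ ≤ _ := by
        gcongr
        have : 0 ≤ 2 ^ p * (C * (K * D)) := by positivity
        linarith

/-! ### Hölder's inequality and mean value inequalities -/

/-- Hölder's inequality in the form used for powers of integrals. -/
lemma lintegral_mul_rpow_le {β : Type*} [MeasurableSpace β] (ν : Measure β) {p : ℝ} (hp : 1 < p)
    {F G : β → ℝ≥0∞} (hF : AEMeasurable F ν) (hG : AEMeasurable G ν) :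
    (∫⁻ x, F x * G x ∂ν) ^ p ≤
      (∫⁻ x, F x ^ p ∂ν) * (∫⁻ x, G x ^ (p / (p - 1)) ∂ν) ^ (p - 1) := by
  have hp0 : 0 < p := by linarith
  have hpq : p.HolderConjugate (p / (p - 1)) := Real.HolderConjugate.conjExponent hp
  have h := ENNReal.rpow_le_rpow (ENNReal.lintegral_mul_le_Lp_mul_Lq ν hpq hF hG) hp0.le
  rw [ENNReal.mul_rpow_of_nonneg _ _ hp0.le, ← ENNReal.rpow_mul, ← ENNReal.rpow_mul] at h
  have e1 : 1 / p * p = 1 := by field_simp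
  have e2 : 1 / (p / (p - 1)) * p = p - 1 := by
    have : p - 1 ≠ 0 := by linarith
    field_simp
  rwa [e1, e2, ENNReal.rpow_one] at h

/-- Multiplication by a unimodular scalar, as a real linear isometry. -/
def rotation (a : ℂ) (ha : ‖a‖ = 1) : Cn n ≃ₗᵢ[ℝ] Cn n where
  toFun v := a • v
  invFun v := a⁻¹ • v
  map_add' := smul_add a
  map_smul' r v := smul_comm a r v
  left_inv v := inv_smul_smul₀ (norm_ne_zero_iff.1 (by rw [ha]; exact one_ne_zero)) v
  right_inv v := smul_inv_smul₀ (norm_ne_zero_iff.1 (by rw [ha]; exact one_ne_zero)) v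
  norm_map' v := by
    change ‖a • v‖ = ‖v‖
    rw [norm_smul, ha, one_mul]

lemma lintegral_rotation {S : Set (Cn n)} (hS : Balanced ℂ S) (hSm : MeasurableSet S)
    {G : Cn n → ℝ≥0∞} {a : ℂ} (ha : ‖a‖ = 1) :
    ∫⁻ v in S, G (a • v) = ∫⁻ v in S, G v := by
  rw [← lintegral_indicator hSm, ← lintegral_indicator hSm]
  have hmp := (rotation (n := n) a ha).measurePreserving
  rw [← hmp.lintegral_comp_emb (rotation (n := n) a ha).toHomeomorph.measurableEmbedding
    (S.indicator G)]
  refine lintegral_congr fun v => ?_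
  change _ = S.indicator G (a • v)
  have hiff : a • v ∈ S ↔ v ∈ S := by
    simpa using hS.smul_mem_iff (x := v) (show ‖a‖ = ‖(1 : ℂ)‖ by rw [ha, norm_one])
  by_cases hv : v ∈ S
  · rw [indicator_of_mem hv, indicator_of_mem (hiff.2 hv)]
  · rw [indicator_of_notMem hv, indicator_of_notMem (mt hiff.1 hv)]

lemma measurable_indicator_of_holomorphic {F : Cn n → ℂ} (hF : IsHolomorphicOnBall n F) :
    Measurable ((unitBall n).indicator F) := by
  classical
  rw [← piecewise_eq_indicator]
  exact ContinuousOn.measurable_piecewise hF.continuousOn continuousOn_const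
    isOpen_unitBall.measurableSet

lemma enorm_le_lintegral_circle {F : Cn n → ℂ} (hF : IsHolomorphicOnBall n F) {c v : Cn n}
    (h : ∀ t : ℂ, ‖t‖ ≤ 1 → c + t • v ∈ unitBall n) :
    ENNReal.ofReal (2 * Real.pi) * ‖F c‖ₑ ≤
      ∫⁻ θ in Ioc 0 (2 * Real.pi), ‖F (c + circleMap 0 1 θ • v)‖ₑ := by
  have hline : Differentiable ℂ fun t : ℂ => c + t • v := by fun_prop
  have hd : DifferentiableOn ℂ (fun t : ℂ => F (c + t • v)) (closedBall 0 1) := fun t ht => by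
    have h1 := hF.differentiableAt (isOpen_unitBall.mem_nhds (h t (by simpa using ht)))
    exact (h1.comp t (hline t)).differentiableWithinAt
  have hd' : DiffContOnCl ℂ (fun t : ℂ => F (c + t • v)) (ball 0 |1|) := by
    rw [abs_one]
    exact (hd.mono closure_ball_subset_closedBall).diffContOnCl
  have hmean := hd'.circleAverage
  rw [Real.circleAverage_def, zero_smul, add_zero] at hmean
  have h2 : ENNReal.ofReal (2 * Real.pi) * ‖F c‖ₑ =
      ‖∫ θ in (0 : ℝ)..2 * Real.pi, F (c + circleMap 0 1 θ • v)‖ₑ := by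
    rw [← hmean, enorm_smul, ← mul_assoc, Real.enorm_eq_ofReal (by positivity),
      ← ENNReal.ofReal_mul (by positivity), mul_inv_cancel₀ (by positivity), ENNReal.ofReal_one,
      one_mul]
  rw [h2, intervalIntegral.integral_of_le (by positivity)]
  exact enorm_integral_le_lintegral_enorm _

/-- The mean value inequality for the modulus of a holomorphic function over a balanced set: average
the one-variable mean value property over circles and use the rotation invariance of the volume. -/
lemma enorm_mul_volume_le {F : Cn n → ℂ} (hF : IsHolomorphicOnBall n F) {c : Cn n}
    {S : Set (Cn n)} (hS : Balanced ℂ S) (hSm : MeasurableSet S)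
    (h : ∀ v ∈ S, c + v ∈ unitBall n) :
    ‖F c‖ₑ * volume S ≤ ∫⁻ v in S, ‖F (c + v)‖ₑ := by
  set G : Cn n → ℝ≥0∞ := fun z => ‖(unitBall n).indicator F z‖ₑ with hG
  have hGm : Measurable G := (measurable_indicator_of_holomorphic hF).enorm
  have hGF : ∀ z ∈ unitBall n, G z = ‖F z‖ₑ := fun z hz => by simp only [hG, indicator_of_mem hz]
  have h2pi : ENNReal.ofReal (2 * Real.pi) ≠ 0 :=
    (ENNReal.ofReal_pos.2 (by positivity)).ne'
  have hmeas : Measurable (Function.uncurry fun (v : Cn n) (θ : ℝ) =>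
      G (c + circleMap 0 1 θ • v)) := by
    refine hGm.comp ?_
    have : Continuous fun x : Cn n × ℝ => c + circleMap 0 1 x.2 • x.1 :=
      continuous_const.add (((continuous_circleMap 0 1).comp continuous_snd).smul continuous_fst)
    exact this.measurable
  have key : ENNReal.ofReal (2 * Real.pi) * (‖F c‖ₑ * volume S) ≤
      ENNReal.ofReal (2 * Real.pi) * ∫⁻ v in S, ‖F (c + v)‖ₑ :=
    calc _ = ∫⁻ _ in S, ENNReal.ofReal (2 * Real.pi) * ‖F c‖ₑ := by
          rw [setLIntegral_const, mul_assoc]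
      _ ≤ ∫⁻ v in S, ∫⁻ θ in Ioc 0 (2 * Real.pi), G (c + circleMap 0 1 θ • v) := by
          refine setLIntegral_mono' hSm fun v hv => ?_
          have hin : ∀ t : ℂ, ‖t‖ ≤ 1 → c + t • v ∈ unitBall n := fun t ht =>
            h _ (hS.smul_mem ht hv)
          refine (enorm_le_lintegral_circle hF hin).trans_eq ?_
          refine lintegral_congr fun θ => (hGF _ (hin _ ?_)).symm
          simp
      _ = ∫⁻ θ in Ioc 0 (2 * Real.pi), ∫⁻ v in S, G (c + circleMap 0 1 θ • v) :=
          lintegral_lintegral_swap hmeas.aemeasurable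
      _ = ∫⁻ _ in Ioc 0 (2 * Real.pi), ∫⁻ v in S, G (c + v) :=
          lintegral_congr fun θ =>
            lintegral_rotation (G := fun v => G (c + v)) hS hSm (by simp)
      _ = ENNReal.ofReal (2 * Real.pi) * ∫⁻ v in S, G (c + v) := by
          rw [setLIntegral_const, Real.volume_Ioc, sub_zero, mul_comm]
      _ = _ := by
          congr 1
          exact setLIntegral_congr_fun hSm fun v hv => hGF _ (h v hv)
  exact (ENNReal.mul_le_mul_iff_right h2pi ENNReal.ofReal_ne_top).1 key

/-- The mean value inequality for `|F|^p`, by Hölder's inequality. -/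
lemma enorm_rpow_mul_volume_le {F : Cn n → ℂ} (hF : IsHolomorphicOnBall n F) {c : Cn n}
    {S : Set (Cn n)} (hS : Balanced ℂ S) (hSm : MeasurableSet S)
    (h : ∀ v ∈ S, c + v ∈ unitBall n) {p : ℝ} (hp : 1 < p) (hfin : volume S ≠ ⊤) :
    ‖F c‖ₑ ^ p * volume S ≤ ∫⁻ v in S, ‖F (c + v)‖ₑ ^ p := by
  rcases eq_or_ne (volume S) 0 with h0 | h0
  · rw [h0, mul_zero]; exact zero_le
  have hp0 : 0 < p := by linarith
  have h1 := ENNReal.rpow_le_rpow (enorm_mul_volume_le hF hS hSm h) hp0.le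
  have hcont : ContinuousOn (fun v => F (c + v)) S :=
    hF.continuousOn.comp (continuous_const.add continuous_id).continuousOn h
  have hae : AEMeasurable (fun v => ‖F (c + v)‖ₑ) (volume.restrict S) :=
    (hcont.aemeasurable hSm).enorm
  have h2 := lintegral_mul_rpow_le (volume.restrict S) hp hae
    (aemeasurable_const (b := (1 : ℝ≥0∞)))
  simp only [mul_one, ENNReal.one_rpow, setLIntegral_one] at h2
  rw [ENNReal.mul_rpow_of_nonneg _ _ hp0.le] at h1
  have h3 := h1.trans h2
  have e : volume S ^ p = volume S * volume S ^ (p - 1) := by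
    nth_rewrite 2 [← ENNReal.rpow_one (volume S)]
    rw [← ENNReal.rpow_add _ _ h0 hfin]
    congr 1
    ring
  rw [e, ← mul_assoc] at h3
  exact (ENNReal.mul_le_mul_iff_left (ENNReal.rpow_pos (pos_iff_ne_zero.2 h0) hfin).ne'
    (ENNReal.rpow_ne_top_of_nonneg (by linarith) hfin)).1 h3

lemma enorm_rpow_mul_volume_anisoBall_le {F : Cn n → ℂ} (hF : IsHolomorphicOnBall n F)
    {ρ t : ℝ} {z : Cn n} (h : anisoBall ρ t z ⊆ unitBall n) {p : ℝ} (hp : 1 < p) :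
    ‖F ((t : ℂ) • z)‖ₑ ^ p * volume (anisoBall ρ t z) ≤
      ∫⁻ w in anisoBall ρ t z, ‖F w‖ₑ ^ p := by
  set S : Set (Cn n) := {v | ‖(inner ℂ z v : ℂ)‖ < ρ ∧ ‖v‖ ^ 2 < ρ} with hS
  have hSo : IsOpen S :=
    (isOpen_lt (f := fun v : Cn n => ‖(inner ℂ z v : ℂ)‖) (by fun_prop) continuous_const).inter
      (isOpen_lt (f := fun v : Cn n => ‖v‖ ^ 2) (by fun_prop) continuous_const)
  have hbal : Balanced ℂ S := by
    rw [balanced_iff_smul_mem]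
    rintro a ha v ⟨h1, h2⟩
    refine ⟨?_, ?_⟩
    · rw [inner_smul_right, norm_mul]
      exact (mul_le_of_le_one_left (norm_nonneg _) ha).trans_lt h1
    · rw [norm_smul, mul_pow]
      exact (mul_le_of_le_one_left (by positivity) (pow_le_one₀ (norm_nonneg _) ha)).trans_lt h2
  have heq : (fun v => (t : ℂ) • z + v) ⁻¹' anisoBall ρ t z = S := by
    ext v
    simp [anisoBall, hS]
  have hmem : ∀ v ∈ S, (t : ℂ) • z + v ∈ unitBall n := fun v hv => h (by rw [← heq] at hv; exact hv)
  have hfin : volume S ≠ ⊤ := by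
    rw [← heq, measure_preimage_add]
    exact (measure_mono h).trans_lt volume_unitBall_lt_top |>.ne
  have hmain := enorm_rpow_mul_volume_le hF hbal hSo.measurableSet hmem hp hfin
  have hmp := measurePreserving_add_left (volume : Measure (Cn n)) ((t : ℂ) • z)
  rw [← heq, measure_preimage_add,
    hmp.setLIntegral_comp_preimage_emb (measurableEmbedding_addLeft _) (fun w => ‖F w‖ₑ ^ p)]
    at hmain
  exact hmain

/-! ### Pointwise estimate and geometry of nonisotropic neighbourhoods -/

lemma norm_homogeneousTerm_le {g : Cn n → ℂ} (hg : IsHolomorphicOnBall n g) {M : ℝ}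
    (hM : ∀ w : Cn n, ‖w‖ ≤ 3 / 4 → ‖g w‖ ≤ M) {z : Cn n} (hz : z ∈ unitBall n) (k : ℕ) :
    ‖homogeneousTerm n g k z‖ ≤ M * (4 / 3) ^ k := by
  have hz1 := mem_unitBall.1 hz
  have hd : DiffContOnCl ℂ (fun t : ℂ => g (t • z)) (ball 0 (3 / 4)) := by
    refine ((differentiableOn_slice hg (r := 1) (by linarith)).mono ?_).diffContOnCl
    rw [closure_ball _ (by norm_num)]
    exact closedBall_subset_ball (by norm_num)
  have h := Complex.norm_iteratedDeriv_le_of_forall_mem_sphere_norm_le (C := M) k (by norm_num) hd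
    fun t ht => hM _ (by
      rw [mem_sphere_zero_iff_norm] at ht
      rw [norm_smul, ht]
      linarith)
  rw [homogeneousTerm_eq_iteratedDeriv hg, norm_mul, norm_inv, Complex.norm_natCast]
  have hk : (0 : ℝ) < k.factorial := by exact_mod_cast k.factorial_pos
  rw [inv_mul_le_iff₀ hk]
  refine h.trans (le_of_eq ?_)
  rw [mul_div_assoc, div_eq_mul_inv M, ← inv_pow]
  norm_num

/-- A holomorphic function is controlled by the radial integral of its image under the differential
operator. -/
lemma exists_norm_le_integral_eulerIter (A : ℝ) (hA : ∀ k : ℕ, A ≠ -(k : ℝ)) (m : ℕ) :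
    ∃ C : ℝ, 0 < C ∧ ∀ (f : Cn n → ℂ) (M : ℝ), IsHolomorphicOnBall n f → 0 ≤ M →
      (∀ w : Cn n, ‖w‖ ≤ 3 / 4 → ‖eulerIter A (m + 1) f w‖ ≤ M) → ∀ z ∈ unitBall n,
      ‖f z‖ ≤ C * (M + ∫ t in (1 / 2 : ℝ)..1,
        (1 - t) ^ m * ‖eulerIter A (m + 1) f ((t : ℂ) • z)‖) := by
  obtain ⟨C, hC0, hC⟩ := exists_norm_le_radial_integral A hA m
  refine ⟨C, hC0, fun f M hf hM0 hM z hz => ?_⟩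
  have hz1 := mem_unitBall.1 hz
  have hg := hf.eulerIter A (m + 1)
  have hmem : ∀ t ∈ Icc (1 / 2 : ℝ) 1, (t : ℂ) • z ∈ unitBall n := fun t ht =>
    smul_mem_unitBall (by
      rw [Complex.norm_real, Real.norm_eq_abs, abs_of_nonneg (by linarith [ht.1])]
      nlinarith [ht.1, ht.2, norm_nonneg z])
  refine hC (fun k => homogeneousTerm n f k z) M (f z)
    (fun t => eulerIter A (m + 1) f ((t : ℂ) • z)) hM0 (fun k => ?_) (hasSum_homogeneousTerm hf hz)
    (fun t ht => ?_) ?_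
  · rw [← homogeneousTerm_eulerIter hf]
    exact norm_homogeneousTerm_le hg hM hz k
  · have := hasSum_homogeneousTerm hg (hmem t ht)
    simp only [homogeneousTerm_smul, homogeneousTerm_eulerIter hf] at this
    exact this.congr_fun fun k => mul_left_comm _ _ _
  · exact hg.continuousOn.comp (by fun_prop) hmem

/-- The pointwise estimate raised to the power `p`, in terms of extended nonnegative integrals. -/
lemma exists_enorm_rpow_le (A : ℝ) (hA : ∀ k : ℕ, A ≠ -(k : ℝ)) (m : ℕ) {p : ℝ} (hp : 1 < p) :
    ∃ C : ℝ, 0 < C ∧ ∀ (f : Cn n → ℂ) (M : ℝ), IsHolomorphicOnBall n f → 0 ≤ M →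
      (∀ w : Cn n, ‖w‖ ≤ 3 / 4 → ‖eulerIter A (m + 1) f w‖ ≤ M) → ∀ z ∈ unitBall n,
      ‖f z‖ₑ ^ p ≤ ENNReal.ofReal C * (ENNReal.ofReal M ^ p + (∫⁻ t in Ioc (1 / 2 : ℝ) 1,
        ENNReal.ofReal ((1 - t) ^ m) * ‖eulerIter A (m + 1) f ((t : ℂ) • z)‖ₑ) ^ p) := by
  obtain ⟨C, hC0, hC⟩ := exists_norm_le_integral_eulerIter (n := n) A hA m
  refine ⟨C ^ p * 2 ^ (p - 1), by positivity, fun f M hf hM0 hM z hz => ?_⟩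
  have hp0 : 0 < p := by linarith
  have hz1 := mem_unitBall.1 hz
  have hg := hf.eulerIter A (m + 1)
  have hcont : ContinuousOn (fun t : ℝ => (1 - t) ^ m * ‖eulerIter A (m + 1) f ((t : ℂ) • z)‖)
      (Icc (1 / 2) 1) := by
    refine ContinuousOn.mul (by fun_prop) (hg.continuousOn.comp (by fun_prop) fun t ht => ?_).norm
    refine smul_mem_unitBall ?_
    rw [Complex.norm_real, Real.norm_eq_abs, abs_of_nonneg (by linarith [ht.1])]
    nlinarith [ht.1, ht.2, norm_nonneg z]
  have hint : ENNReal.ofReal (∫ t in (1 / 2 : ℝ)..1,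
      (1 - t) ^ m * ‖eulerIter A (m + 1) f ((t : ℂ) • z)‖) =
      ∫⁻ t in Ioc (1 / 2 : ℝ) 1,
        ENNReal.ofReal ((1 - t) ^ m) * ‖eulerIter A (m + 1) f ((t : ℂ) • z)‖ₑ := by
    rw [intervalIntegral.integral_of_le (by norm_num), ofReal_integral_eq_lintegral_ofReal]
    · refine setLIntegral_congr_fun measurableSet_Ioc fun t ht => ?_
      rw [ENNReal.ofReal_mul (pow_nonneg (by linarith [ht.2]) m), ofReal_norm]
    · exact (hcont.integrableOn_Icc).mono_set Ioc_subset_Icc_self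
    · refine (ae_restrict_mem measurableSet_Ioc).mono fun t ht => ?_
      exact mul_nonneg (pow_nonneg (by linarith [ht.2]) m) (norm_nonneg _)
  have h1 : ‖f z‖ₑ ≤ ENNReal.ofReal C * (ENNReal.ofReal M + ∫⁻ t in Ioc (1 / 2 : ℝ) 1,
        ENNReal.ofReal ((1 - t) ^ m) * ‖eulerIter A (m + 1) f ((t : ℂ) • z)‖ₑ) := by
    rw [← hint, ← ofReal_norm, ← ENNReal.ofReal_add hM0, ← ENNReal.ofReal_mul hC0.le]
    · exact ENNReal.ofReal_le_ofReal (hC f M hf hM0 hM z hz)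
    · refine intervalIntegral.integral_nonneg (by norm_num) fun t ht => ?_
      exact mul_nonneg (pow_nonneg (by linarith [ht.2]) m) (norm_nonneg _)
  refine (ENNReal.rpow_le_rpow h1 hp0.le).trans ?_
  rw [ENNReal.mul_rpow_of_nonneg _ _ hp0.le, ENNReal.ofReal_mul (by positivity), mul_assoc,
    ENNReal.ofReal_rpow_of_nonneg hC0.le hp0.le]
  gcongr
  refine (ENNReal.rpow_add_le_mul_rpow_add_rpow _ _ hp.le).trans (le_of_eq ?_)
  rw [← ENNReal.ofReal_rpow_of_pos two_pos, ENNReal.ofReal_ofNat]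

/-- The distance of `t z` to the sphere, up to a factor two, for `1/2 ≤ t ≤ 1`. -/
def boundaryDist (t : ℝ) (z : Cn n) : ℝ := (1 - t) + (1 - ‖z‖)

lemma boundaryDist_pos {t : ℝ} (ht : t ≤ 1) {z : Cn n} (hz : z ∈ unitBall n) :
    0 < boundaryDist t z := by
  have := mem_unitBall.1 hz
  rw [boundaryDist]; linarith

/-- Hölder's inequality for the radial integral, with an auxiliary weight `h` for which
`h(x)^{1/(p-1)} / x` is integrable at the origin. -/
lemma radial_lintegral_rpow_le {h : ℝ → ℝ} (hm : Measurable h) (hpos : ∀ x, 0 < x → 0 < h x)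
    (m : ℕ) {p : ℝ} (hp : 1 < p) {g : Cn n → ℂ} (hg : IsHolomorphicOnBall n g) {z : Cn n}
    (hz : z ∈ unitBall n) :
    (∫⁻ t in Ioc (1 / 2 : ℝ) 1, ENNReal.ofReal ((1 - t) ^ m) * ‖g ((t : ℂ) • z)‖ₑ) ^ p ≤
      (∫⁻ t in Ioc (1 / 2 : ℝ) 1, ENNReal.ofReal (boundaryDist t z ^ (((m + 1 : ℕ) : ℝ) * p - 1) /
        h (boundaryDist t z)) * ‖g ((t : ℂ) • z)‖ₑ ^ p) *
      (∫⁻ x in Ioo (0 : ℝ) 2, ENNReal.ofReal (h x ^ (1 / (p - 1)) / x)) ^ (p - 1) := by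
  have hp0 : 0 < p := by linarith
  have hp1 : p - 1 ≠ 0 := by linarith
  have hz1 := mem_unitBall.1 hz
  have hrm : Measurable fun t : ℝ => boundaryDist t z := by
    unfold boundaryDist; fun_prop
  have hgm : AEMeasurable (fun t : ℝ => ‖g ((t : ℂ) • z)‖ₑ)
      (volume.restrict (Ioc (1 / 2 : ℝ) 1)) := by
    have : ContinuousOn (fun t : ℝ => g ((t : ℂ) • z)) (Ioc (1 / 2) 1) := by
      refine hg.continuousOn.comp (by fun_prop) fun t ht => ?_
      refine smul_mem_unitBall ?_
      rw [Complex.norm_real, Real.norm_eq_abs, abs_of_nonneg (by linarith [ht.1])]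
      nlinarith [ht.1, ht.2, norm_nonneg z]
    exact (this.aemeasurable measurableSet_Ioc).enorm
  set F : ℝ → ℝ≥0∞ := fun t => ENNReal.ofReal ((boundaryDist t z ^ (((m + 1 : ℕ) : ℝ) * p - 1) /
    h (boundaryDist t z)) ^ (1 / p)) * ‖g ((t : ℂ) • z)‖ₑ with hF
  set G : ℝ → ℝ≥0∞ := fun t => ENNReal.ofReal ((h (boundaryDist t z) ^ (1 / (p - 1)) /
    boundaryDist t z) ^ ((p - 1) / p)) with hG
  have hFm : AEMeasurable F (volume.restrict (Ioc (1 / 2 : ℝ) 1)) := by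
    refine AEMeasurable.mul ?_ hgm
    exact ((((hrm.pow_const _).div (hm.comp hrm)).pow_const _).ennreal_ofReal).aemeasurable
  have hGm : AEMeasurable G (volume.restrict (Ioc (1 / 2 : ℝ) 1)) :=
    (((((hm.comp hrm).pow_const _).div hrm).pow_const _).ennreal_ofReal).aemeasurable
  have hle : ∫⁻ t in Ioc (1 / 2 : ℝ) 1, ENNReal.ofReal ((1 - t) ^ m) * ‖g ((t : ℂ) • z)‖ₑ ≤
      ∫⁻ t in Ioc (1 / 2 : ℝ) 1, F t * G t := by
    refine setLIntegral_mono' measurableSet_Ioc fun t ht => ?_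
    have hr := boundaryDist_pos ht.2 hz
    have hh := hpos _ hr
    simp only [hF, hG]
    rw [mul_right_comm, ← ENNReal.ofReal_mul (by positivity)]
    gcongr
    have e : (boundaryDist t z ^ (((m + 1 : ℕ) : ℝ) * p - 1) / h (boundaryDist t z)) ^ (1 / p) *
        (h (boundaryDist t z) ^ (1 / (p - 1)) / boundaryDist t z) ^ ((p - 1) / p) =
        boundaryDist t z ^ m := by
      rw [Real.div_rpow (by positivity) hh.le, Real.div_rpow (by positivity) hr.le,
        ← Real.rpow_mul hr.le, ← Real.rpow_mul hh.le]
      have e1 : 1 / (p - 1) * ((p - 1) / p) = 1 / p := by field_simp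
      have e2 : (((m + 1 : ℕ) : ℝ) * p - 1) * (1 / p) = m + (p - 1) / p := by
        push_cast; field_simp; ring
      rw [e1, e2, Real.rpow_add hr, Real.rpow_natCast]
      have := (Real.rpow_pos_of_pos hh (1 / p)).ne'
      have := (Real.rpow_pos_of_pos hr ((p - 1) / p)).ne'
      field_simp
    rw [e]
    refine pow_le_pow_left₀ (by linarith [ht.2]) ?_ m
    rw [boundaryDist]
    linarith
  refine (ENNReal.rpow_le_rpow hle hp0.le).trans
    ((lintegral_mul_rpow_le _ hp hFm hGm).trans ?_)
  refine mul_le_mul' (le_of_eq ?_) (ENNReal.rpow_le_rpow ?_ (by linarith))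
  · refine setLIntegral_congr_fun measurableSet_Ioc fun t ht => ?_
    have hr := boundaryDist_pos ht.2 hz
    have hh := hpos _ hr
    simp only [hF]
    rw [ENNReal.mul_rpow_of_nonneg _ _ hp0.le, ENNReal.ofReal_rpow_of_nonneg (by positivity) hp0.le,
      ← Real.rpow_mul (by positivity)]
    congr 2
    rw [one_div, inv_mul_cancel₀ hp0.ne', Real.rpow_one]
  · have e : ∀ t ∈ Ioc (1 / 2 : ℝ) 1, G t ^ (p / (p - 1)) =
        (Ioo (0 : ℝ) 2).indicator (fun x => ENNReal.ofReal (h x ^ (1 / (p - 1)) / x))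
          ((2 - ‖z‖) - t) := by
      intro t ht
      have hr := boundaryDist_pos ht.2 hz
      have hh := hpos _ hr
      have hrt : (2 - ‖z‖) - t = boundaryDist t z := by rw [boundaryDist]; ring
      have hmem : boundaryDist t z ∈ Ioo (0 : ℝ) 2 :=
        ⟨hr, by rw [boundaryDist]; linarith [ht.1, norm_nonneg z]⟩
      rw [hrt, indicator_of_mem hmem]
      simp only [hG]
      rw [ENNReal.ofReal_rpow_of_nonneg (by positivity) (div_nonneg hp0.le (by linarith)),
        ← Real.rpow_mul (by positivity)]
      have : (p - 1) / p * (p / (p - 1)) = 1 := by field_simp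
      rw [this, Real.rpow_one]
    rw [setLIntegral_congr_fun measurableSet_Ioc e, ← lintegral_indicator measurableSet_Ioo]
    refine (setLIntegral_le_lintegral _ _).trans_eq ?_
    exact lintegral_sub_left_eq_self (fun x => (Ioo (0 : ℝ) 2).indicator
      (fun x => ENNReal.ofReal (h x ^ (1 / (p - 1)) / x)) x) (2 - ‖z‖)

section Geometry

variable {t : ℝ} {z w : Cn n}

lemma one_sub_norm_sq_ge_of_mem_anisoBall (ht : 1 / 2 < t) (ht1 : t ≤ 1) (hz : z ∈ unitBall n)
    (hw : w ∈ anisoBall (boundaryDist t z / 12) t z) :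
    boundaryDist t z ≤ 4 * (1 - ‖w‖ ^ 2) := by
  have h := norm_sq_lt_of_mem_anisoBall (by linarith) ht1 hw
  have hz1 := mem_unitBall.1 hz
  have h0 := norm_nonneg z
  have h1 : t * ‖z‖ ≤ 1 := by nlinarith
  have h2 : boundaryDist t z / 2 ≤ 1 - t * ‖z‖ := by rw [boundaryDist]; nlinarith
  have h3 : 0 ≤ t * ‖z‖ := by positivity
  nlinarith

lemma norm_one_sub_inner_le_of_mem_anisoBall (ht1 : t ≤ 1)
    (hz : z ∈ unitBall n) (hw : w ∈ anisoBall (boundaryDist t z / 12) t z) :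
    ‖(1 - inner ℂ z w : ℂ)‖ ≤ 3 * boundaryDist t z := by
  have hz1 := mem_unitBall.1 hz
  have h0 := norm_nonneg z
  have e : (1 - inner ℂ z w : ℂ) =
      ((1 - t * ‖z‖ ^ 2 : ℝ) : ℂ) - inner ℂ z (w - (t : ℂ) • z) := by
    rw [inner_sub_right, inner_smul_right, inner_self_eq_norm_sq_to_K]
    push_cast
    simp
  have h1 : 0 ≤ 1 - t * ‖z‖ ^ 2 := by nlinarith [sq_nonneg ‖z‖]
  have h2 : 1 - t * ‖z‖ ^ 2 ≤ 2 * boundaryDist t z := by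
    rw [boundaryDist]
    nlinarith [sq_nonneg (1 - ‖z‖), mul_nonneg (by linarith : (0 : ℝ) ≤ 1 - t)
      (by nlinarith : (0 : ℝ) ≤ 1 - ‖z‖ ^ 2)]
  rw [e]
  refine (norm_sub_le _ _).trans ?_
  rw [Complex.norm_real, Real.norm_eq_abs, abs_of_nonneg h1]
  have := boundaryDist_pos ht1 hz
  linarith [hw.1]

lemma mem_unitBall_of_mem_anisoBall (ht : 1 / 2 < t) (ht1 : t ≤ 1) (hz : z ∈ unitBall n)
    (hw : w ∈ anisoBall (boundaryDist t z / 12) t z) : w ∈ unitBall n := by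
  have h1 := one_sub_norm_sq_ge_of_mem_anisoBall ht ht1 hz hw
  have h2 := boundaryDist_pos ht1 hz
  rw [mem_unitBall]
  by_contra h
  nlinarith

lemma one_sub_norm_sq_le_of_mem_anisoBall (ht : 1 / 2 < t) (ht1 : t ≤ 1) (hz : z ∈ unitBall n)
    (hw : w ∈ anisoBall (boundaryDist t z / 12) t z) :
    1 - ‖w‖ ^ 2 ≤ 6 * boundaryDist t z := by
  have h1 := norm_one_sub_inner_le_of_mem_anisoBall ht1 hz hw
  have h2 := norm_sub_norm_le (1 : ℂ) (inner ℂ z w)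
  rw [norm_one] at h2
  have h3 := norm_inner_le_norm (𝕜 := ℂ) z w
  have hz1 := mem_unitBall.1 hz
  have hw1 := mem_unitBall.1 (mem_unitBall_of_mem_anisoBall ht ht1 hz hw)
  nlinarith [norm_nonneg z, norm_nonneg w]

/-- If `w` is near `t z`, then `z` lies in the tent over `w` of size comparable to `1 - |w|²`. -/
lemma mem_carlesonTent_of_mem_anisoBall (ht : 1 / 2 < t) (ht1 : t ≤ 1) (hz : z ∈ unitBall n)
    (hw : w ∈ anisoBall (boundaryDist t z / 12) t z) {ξ : Cn n} (hξ : ‖ξ‖ = 1)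
    (hwξ : w = (‖w‖ : ℂ) • ξ) : z ∈ carlesonTent n (40 * (1 - ‖w‖ ^ 2)) ξ := by
  refine ⟨hz, ?_⟩
  have h1 := norm_one_sub_inner_le_of_mem_anisoBall ht1 hz hw
  have h2 := one_sub_norm_sq_ge_of_mem_anisoBall ht ht1 hz hw
  have hr := boundaryDist_pos ht1 hz
  have hz1 := mem_unitBall.1 hz
  have hw1 := mem_unitBall.1 (mem_unitBall_of_mem_anisoBall ht ht1 hz hw)
  have hs : ‖(1 - inner ℂ w z : ℂ)‖ = ‖(1 - inner ℂ z w : ℂ)‖ := by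
    rw [← inner_conj_symm w z, ← Complex.norm_conj, map_sub, map_one, Complex.conj_conj]
  have e : (1 - inner ℂ ξ z : ℂ) = (1 - inner ℂ w z) - ((1 - ‖w‖ : ℝ) : ℂ) * inner ℂ ξ z := by
    have : (inner ℂ w z : ℂ) = (‖w‖ : ℂ) * inner ℂ ξ z := by
      conv_lhs => rw [hwξ]
      rw [inner_smul_left, Complex.conj_ofReal]
    rw [this]
    push_cast
    ring
  have h3 : ‖(inner ℂ ξ z : ℂ)‖ ≤ 1 := by
    have := norm_inner_le_norm (𝕜 := ℂ) ξ z
    rw [hξ] at this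
    linarith
  rw [e]
  refine (norm_sub_le _ _).trans_lt ?_
  rw [norm_mul, Complex.norm_real, Real.norm_eq_abs, abs_of_nonneg (by linarith), hs]
  nlinarith [norm_nonneg w, norm_nonneg (inner ℂ ξ z : ℂ)]

end Geometry

/-- The mean value inequality over the nonisotropic neighbourhood of `t z` of size comparable to its
distance `d` to the sphere, whose volume is comparable to `d^{n+1}`. The factor `1/12` keeps the
neighbourhood inside the ball. -/
lemma exists_enorm_rpow_le_lintegral_anisoBall (hn : 0 < n) {p : ℝ} (hp : 1 < p) :
    ∃ C : ℝ, 0 < C ∧ ∀ g : Cn n → ℂ, IsHolomorphicOnBall n g → ∀ z ∈ unitBall n,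
      ∀ t ∈ Ioc (1 / 2 : ℝ) 1, ‖g ((t : ℂ) • z)‖ₑ ^ p ≤
        ENNReal.ofReal (C * (boundaryDist t z ^ (n + 1))⁻¹) *
          ∫⁻ w in anisoBall (boundaryDist t z / 12) t z, ‖g w‖ₑ ^ p := by
  set V := (volume (ball (0 : Cn n) (1 / 2))).toReal with hV
  have hVe : volume (ball (0 : Cn n) (1 / 2)) = ENNReal.ofReal V :=
    (ENNReal.ofReal_toReal measure_ball_lt_top.ne).symm
  have hV0 : 0 < V := ENNReal.toReal_pos (measure_ball_pos _ _ (by norm_num)).ne'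
    measure_ball_lt_top.ne
  refine ⟨12 ^ (n + 1) * V⁻¹, by positivity, fun g hg z hz t ht => ?_⟩
  have hr := boundaryDist_pos ht.2 hz
  have hz1 := mem_unitBall.1 hz
  have hr4 : boundaryDist t z / 12 ≤ 4 := by
    rw [boundaryDist]; linarith [norm_nonneg z, ht.1]
  have h1 := enorm_rpow_mul_volume_anisoBall_le hg
    (fun w hw => mem_unitBall_of_mem_anisoBall ht.1 ht.2 hz hw) hp
  have h2 := le_volume_anisoBall hn (by positivity) hr4 t hz1.le
  rw [hVe, ← ENNReal.ofReal_mul (by positivity)] at h2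
  have h3 := (mul_le_mul_right h2 _).trans h1
  have hpos : 0 < (boundaryDist t z / 12) ^ (n + 1) * V := by positivity
  calc ‖g ((t : ℂ) • z)‖ₑ ^ p = ENNReal.ofReal (((boundaryDist t z / 12) ^ (n + 1) * V)⁻¹) *
        (‖g ((t : ℂ) • z)‖ₑ ^ p * ENNReal.ofReal ((boundaryDist t z / 12) ^ (n + 1) * V)) := by
        rw [mul_left_comm, ← ENNReal.ofReal_mul (by positivity), inv_mul_cancel₀ hpos.ne']
        simp
    _ ≤ ENNReal.ofReal (((boundaryDist t z / 12) ^ (n + 1) * V)⁻¹) * _ := mul_le_mul_right h3 _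
    _ = _ := by
        congr 2
        rw [div_pow]
        field_simp

/-! ### Averaging and the sufficiency criterion -/

lemma rpow_abs_le_rpow {a b c : ℝ} (hb : 0 < b) (hba : b ≤ a) (ha : a ≤ 1) :
    b ^ |c| ≤ a ^ c :=
  (Real.rpow_le_rpow hb.le hba (abs_nonneg c)).trans
    (Real.rpow_le_rpow_of_exponent_ge (hb.trans_le hba) ha (le_abs_self c))

/-- Near the origin a holomorphic function is bounded by its weighted `L^p` norm. -/
lemma exists_enorm_rpow_le_lintegral_ballWeight (n : ℕ) {p : ℝ} (hp : 1 < p) (c : ℝ) :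
    ∃ C : ℝ, 0 < C ∧ ∀ g : Cn n → ℂ, IsHolomorphicOnBall n g → ∀ w : Cn n, ‖w‖ ≤ 3 / 4 →
      ‖g w‖ₑ ^ p ≤ ENNReal.ofReal C * ∫⁻ z, ‖g z‖ₑ ^ p ∂(ballWeight n c) := by
  set V := (volume (ball (0 : Cn n) (1 / 8))).toReal with hV
  have hVe : volume (ball (0 : Cn n) (1 / 8)) = ENNReal.ofReal V :=
    (ENNReal.ofReal_toReal measure_ball_lt_top.ne).symm
  have hV0 : 0 < V := ENNReal.toReal_pos (measure_ball_pos _ _ (by norm_num)).ne'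
    measure_ball_lt_top.ne
  set κ : ℝ := (15 / 64) ^ |c| with hκ
  have hκ0 : 0 < κ := by positivity
  refine ⟨κ⁻¹ * V⁻¹, by positivity, fun g hg w hw => ?_⟩
  have hnear : ∀ v ∈ ball (0 : Cn n) (1 / 8), ‖w + v‖ < 7 / 8 := fun v hv => by
    rw [mem_ball_zero_iff] at hv
    linarith [norm_add_le w v]
  have h1 := enorm_rpow_mul_volume_le hg (c := w) (balanced_ball_zero (𝕜 := ℂ) (r := 1 / 8))
    measurableSet_ball (fun v hv => mem_unitBall.2 (by linarith [hnear v hv])) hp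
    measure_ball_lt_top.ne
  have hpre : (fun v => w + v) ⁻¹' ball w (1 / 8) = ball (0 : Cn n) (1 / 8) := by
    ext v
    simp [mem_ball, dist_eq_norm]
  have hmp := measurePreserving_add_left (volume : Measure (Cn n)) w
  rw [← hpre, hmp.setLIntegral_comp_preimage_emb (measurableEmbedding_addLeft _)
    (fun z => ‖g z‖ₑ ^ p), hpre, hVe] at h1
  have h2 : ∫⁻ z in ball w (1 / 8), ‖g z‖ₑ ^ p ≤
      ENNReal.ofReal κ⁻¹ * ∫⁻ z, ‖g z‖ₑ ^ p ∂(ballWeight n c) := by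
    rw [lintegral_ballWeight, ← lintegral_const_mul' _ _ ENNReal.ofReal_ne_top]
    have hsub : ∀ z ∈ ball w (1 / 8), ‖z‖ < 7 / 8 := fun z hz => by
      have := hnear (z - w) (by rwa [mem_ball_zero_iff, ← dist_eq_norm])
      rwa [add_sub_cancel] at this
    refine (setLIntegral_mono' measurableSet_ball fun z hz => ?_).trans
      (lintegral_mono_set fun z hz => mem_unitBall.2 (by linarith [hsub z hz]))
    rw [← mul_assoc, ← ENNReal.ofReal_mul (by positivity)]
    refine le_mul_of_one_le_left zero_le ?_
    rw [ENNReal.one_le_ofReal]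
    have h3 : κ ≤ (1 - ‖z‖ ^ 2) ^ c := rpow_abs_le_rpow (by norm_num)
      (by nlinarith [hsub z hz, norm_nonneg z]) (by nlinarith [sq_nonneg ‖z‖])
    calc (1 : ℝ) = κ⁻¹ * κ := (inv_mul_cancel₀ hκ0.ne').symm
      _ ≤ _ := by gcongr
  calc ‖g w‖ₑ ^ p = ENNReal.ofReal V⁻¹ * (‖g w‖ₑ ^ p * ENNReal.ofReal V) := by
        rw [mul_left_comm, ← ENNReal.ofReal_mul (by positivity), inv_mul_cancel₀ hV0.ne']
        simp
    _ ≤ ENNReal.ofReal V⁻¹ * (ENNReal.ofReal κ⁻¹ * ∫⁻ z, ‖g z‖ₑ ^ p ∂(ballWeight n c)) :=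
        mul_le_mul_right (h1.trans h2) _
    _ = _ := by
        rw [← mul_assoc, ← ENNReal.ofReal_mul (by positivity), mul_comm V⁻¹]

/-- The kernel which arises from averaging over nonisotropic neighbourhoods of `t z`: with
`d = boundaryDist t z`, it is `d^e / h(d)` if `w` lies in the neighbourhood of `t z` of size
`d / 12`, and `0` otherwise. -/
def averagingKernel (h : ℝ → ℝ) (e : ℝ) (z : Cn n) (t : ℝ) (w : Cn n) : ℝ≥0∞ :=
  (anisoBall (boundaryDist t z / 12) t z).indicator
    (fun _ => ENNReal.ofReal (boundaryDist t z ^ e / h (boundaryDist t z))) w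

lemma measurable_averagingKernel {h : ℝ → ℝ} (hm : Measurable h) (e : ℝ) :
    Measurable fun x : (Cn n × ℝ) × Cn n => averagingKernel h e x.1.1 x.1.2 x.2 := by
  have hr : Continuous fun x : (Cn n × ℝ) × Cn n => boundaryDist x.1.2 x.1.1 := by
    unfold boundaryDist; fun_prop
  have hS : IsOpen {x : (Cn n × ℝ) × Cn n |
      ‖(inner ℂ x.1.1 (x.2 - (x.1.2 : ℂ) • x.1.1) : ℂ)‖ < boundaryDist x.1.2 x.1.1 / 12 ∧
      ‖x.2 - (x.1.2 : ℂ) • x.1.1‖ ^ 2 < boundaryDist x.1.2 x.1.1 / 12} := by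
    have hc : Continuous fun x : (Cn n × ℝ) × Cn n => x.2 - (x.1.2 : ℂ) • x.1.1 := by fun_prop
    exact (isOpen_lt (continuous_fst.fst.inner hc).norm (hr.div_const _)).inter
      (isOpen_lt (hc.norm.pow 2) (hr.div_const _))
  have hv : Measurable fun x : (Cn n × ℝ) × Cn n =>
      ENNReal.ofReal (boundaryDist x.1.2 x.1.1 ^ e / h (boundaryDist x.1.2 x.1.1)) :=
    ((hr.measurable.pow_const _).div (hm.comp hr.measurable)).ennreal_ofReal
  exact hv.indicator hS.measurableSet

/-- Schur-type bound: for fixed `w` the averaging kernel is supported in a tent over `w` of size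
comparable to `1 - |w|²`, where the growth hypothesis on `μ` applies. The constant `240 = 40 * 6`
comes from comparing the size `40 (1 - |w|²)` of this tent with the distance of `t z` to the sphere,
which is at least `(1 - |w|²) / 6`. -/
lemma exists_lintegral_averagingKernel_le (hn : 0 < n) {h : ℝ → ℝ} (hpos : ∀ x, 0 < x → 0 < h x)
    {D : ℝ} (hD : ∀ x y, 0 < x → x ≤ 240 * y → h x ≤ D * h y) {s K : ℝ} (hK : 0 < K)
    {μ : Measure (Cn n)} (hμ : ∀ ξ : Cn n, ‖ξ‖ = 1 → ∀ δ : ℝ, 0 < δ →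
      μ (carlesonTent n δ ξ) ≤ ENNReal.ofReal (K * (δ ^ s * h δ))) (e : ℝ) :
    ∃ C : ℝ, 0 < C ∧ ∀ w ∈ unitBall n,
      ∫⁻ z in unitBall n, ∫⁻ t in Ioc (1 / 2 : ℝ) 1, averagingKernel h e z t w ∂volume ∂μ ≤
        ENNReal.ofReal (C * (1 - ‖w‖ ^ 2) ^ (e + 1 + s)) := by
  have hD0 : 0 < D := by
    have h1 := hD 1 1 one_pos (by norm_num)
    have h2 := hpos 1 one_pos
    by_contra hneg
    nlinarith
  refine ⟨6 ^ |e| * D * 4 * K * 40 ^ s, by positivity, fun w hw => ?_⟩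
  obtain ⟨ξ, hξ, hwξ⟩ := exists_unit_smul_eq hn w
  have hw1 := mem_unitBall.1 hw
  set a := 1 - ‖w‖ ^ 2 with ha
  have ha0 : 0 < a := by nlinarith [norm_nonneg w]
  have hh := hpos (40 * a) (by positivity)
  set B := 6 ^ |e| * a ^ e * (D / h (40 * a)) with hB
  have hB0 : 0 ≤ B := by positivity
  have hker : ∀ z ∈ unitBall n, ∀ t ∈ Ioc (1 / 2 : ℝ) 1, averagingKernel h e z t w ≤
      (carlesonTent n (40 * a) ξ).indicator (fun _ => ENNReal.ofReal B) z *
        (Icc (1 - 4 * a) 1).indicator (fun _ => 1) t := by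
    intro z hz t ht
    rw [averagingKernel]
    by_cases hmem : w ∈ anisoBall (boundaryDist t z / 12) t z
    swap
    · rw [indicator_of_notMem hmem]; exact zero_le
    have hr := boundaryDist_pos ht.2 hz
    have h1 : boundaryDist t z ≤ 4 * a := one_sub_norm_sq_ge_of_mem_anisoBall ht.1 ht.2 hz hmem
    have h2 : a ≤ 6 * boundaryDist t z := one_sub_norm_sq_le_of_mem_anisoBall ht.1 ht.2 hz hmem
    have htmem : t ∈ Icc (1 - 4 * a) 1 := by
      refine ⟨?_, ht.2⟩
      have := mem_unitBall.1 hz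
      rw [boundaryDist] at h1
      linarith
    rw [indicator_of_mem hmem, indicator_of_mem (mem_carlesonTent_of_mem_anisoBall ht.1 ht.2 hz
      hmem hξ hwξ), indicator_of_mem htmem, mul_one]
    refine ENNReal.ofReal_le_ofReal ?_
    have hhr := hpos _ hr
    rw [div_eq_mul_inv, hB]
    refine mul_le_mul ?_ ?_ (by positivity) (by positivity)
    · -- both `r / a` and `a / r` are at most `6`
      have hq : (boundaryDist t z / a) ^ e ≤ 6 ^ |e| := by
        rcases le_or_gt 0 e with he | he
        · rw [abs_of_nonneg he]
          refine Real.rpow_le_rpow (by positivity) ?_ he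
          rw [div_le_iff₀ ha0]; linarith
        · rw [abs_of_neg he, Real.rpow_neg (by norm_num), ← Real.inv_rpow (by norm_num)]
          refine Real.rpow_le_rpow_of_nonpos (by norm_num) ?_ he.le
          rw [le_div_iff₀ ha0]; linarith
      rw [Real.div_rpow hr.le ha0.le, div_le_iff₀ (by positivity)] at hq
      exact hq
    · have := hD (40 * a) (boundaryDist t z) (by positivity) (by linarith)
      rw [le_div_iff₀ hh, inv_mul_le_iff₀ hhr]
      linarith
  calc _ ≤ ∫⁻ z in unitBall n, ∫⁻ t in Ioc (1 / 2 : ℝ) 1,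
          (carlesonTent n (40 * a) ξ).indicator (fun _ => ENNReal.ofReal B) z *
          (Icc (1 - 4 * a) 1).indicator (fun _ => 1) t ∂volume ∂μ :=
        setLIntegral_mono' isOpen_unitBall.measurableSet fun z hz =>
          setLIntegral_mono' measurableSet_Ioc fun t ht => hker z hz t ht
    _ ≤ ∫⁻ z, (carlesonTent n (40 * a) ξ).indicator (fun _ => ENNReal.ofReal B) z *
          ENNReal.ofReal (4 * a) ∂μ := by
        refine (setLIntegral_le_lintegral _ _).trans (lintegral_mono fun z => ?_)
        rw [lintegral_const_mul _ (measurable_const.indicator measurableSet_Icc)]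
        gcongr
        refine (setLIntegral_le_lintegral _ _).trans ?_
        rw [lintegral_indicator measurableSet_Icc, setLIntegral_one, Real.volume_Icc]
        exact ENNReal.ofReal_le_ofReal (by linarith)
    _ = ENNReal.ofReal B * μ (carlesonTent n (40 * a) ξ) * ENNReal.ofReal (4 * a) := by
        rw [lintegral_mul_const' _ _ ENNReal.ofReal_ne_top,
          lintegral_indicator_const (measurableSet_carlesonTent _ _)]
    _ ≤ ENNReal.ofReal B * ENNReal.ofReal (K * ((40 * a) ^ s * h (40 * a))) *
          ENNReal.ofReal (4 * a) := by
        gcongr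
        exact hμ ξ hξ _ (by positivity)
    _ = _ := by
        rw [← ENNReal.ofReal_mul hB0, ← ENNReal.ofReal_mul (by positivity)]
        congr 1
        rw [Real.mul_rpow (by norm_num) ha0.le, Real.rpow_add ha0, Real.rpow_add ha0, Real.rpow_one,
          hB]
        field_simp

lemma measurableSet_anisoBall (ρ t : ℝ) (z : Cn n) : MeasurableSet (anisoBall ρ t z) := by
  refine IsOpen.measurableSet (IsOpen.inter ?_ ?_)
  · exact isOpen_lt (f := fun w : Cn n => ‖(inner ℂ z (w - (t : ℂ) • z) : ℂ)‖)
      (by fun_prop) continuous_const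
  · exact isOpen_lt (f := fun w : Cn n => ‖w - (t : ℂ) • z‖ ^ 2) (by fun_prop) continuous_const

/-- The mean value inequality, weighted by `d^{e+n+1} / h(d)` with `d = boundaryDist t z`. -/
lemma exists_mul_enorm_rpow_le_lintegral_averagingKernel (hn : 0 < n) {h : ℝ → ℝ}
    (hpos : ∀ x, 0 < x → 0 < h x) {p : ℝ} (hp : 1 < p) (e : ℝ) :
    ∃ C : ℝ, 0 < C ∧ ∀ g : Cn n → ℂ, IsHolomorphicOnBall n g → ∀ z ∈ unitBall n,
      ∀ t ∈ Ioc (1 / 2 : ℝ) 1,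
        ENNReal.ofReal (boundaryDist t z ^ (e + (n + 1)) / h (boundaryDist t z)) *
          ‖g ((t : ℂ) • z)‖ₑ ^ p ≤
        ENNReal.ofReal C * ∫⁻ w, averagingKernel h e z t w *
          (unitBall n).indicator (fun w => ‖g w‖ₑ ^ p) w := by
  obtain ⟨C, hC, hsub⟩ := exists_enorm_rpow_le_lintegral_anisoBall (n := n) hn hp
  refine ⟨C, hC, fun g hg z hz t ht => ?_⟩
  have hr := boundaryDist_pos ht.2 hz
  have hh := hpos _ hr
  refine (mul_le_mul_right (hsub g hg z hz t ht) _).trans (le_of_eq ?_)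
  have e1 : ∫⁻ w, averagingKernel h e z t w * (unitBall n).indicator (fun w => ‖g w‖ₑ ^ p) w =
      ENNReal.ofReal (boundaryDist t z ^ e / h (boundaryDist t z)) *
        ∫⁻ w in anisoBall (boundaryDist t z / 12) t z, ‖g w‖ₑ ^ p := by
    rw [← lintegral_const_mul' _ _ ENNReal.ofReal_ne_top,
      ← lintegral_indicator (measurableSet_anisoBall _ _ _)]
    refine lintegral_congr fun w => ?_
    rw [averagingKernel]
    by_cases hw : w ∈ anisoBall (boundaryDist t z / 12) t z
    · rw [indicator_of_mem hw, indicator_of_mem hw,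
        indicator_of_mem (mem_unitBall_of_mem_anisoBall ht.1 ht.2 hz hw)]
    · rw [indicator_of_notMem hw, indicator_of_notMem hw, zero_mul]
  have e2 : boundaryDist t z ^ (e + (n + 1)) =
      boundaryDist t z ^ e * boundaryDist t z ^ (n + 1) := by
    rw [Real.rpow_add hr, ← Real.rpow_natCast]
    push_cast
    rfl
  rw [e1, ← mul_assoc, ← mul_assoc, ← ENNReal.ofReal_mul (by positivity),
    ← ENNReal.ofReal_mul hC.le, e2]
  congr 2
  have h1 : boundaryDist t z ^ (n + 1) ≠ 0 := by positivity
  field_simp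

/-- Tonelli's theorem for a kernel in three variables. -/
lemma lintegral_lintegral_lintegral_mul {X Y Z : Type*} [MeasurableSpace X] [MeasurableSpace Y]
    [MeasurableSpace Z] {k : (X × Y) × Z → ℝ≥0∞} (hk : Measurable k) {G : Z → ℝ≥0∞}
    (hG : Measurable G) (ν : Measure X) [SFinite ν] (τ : Measure Y) [SFinite τ] (ρ : Measure Z)
    [SFinite ρ] :
    ∫⁻ x, ∫⁻ y, ∫⁻ z, k ((x, y), z) * G z ∂ρ ∂τ ∂ν =
      ∫⁻ z, (∫⁻ x, ∫⁻ y, k ((x, y), z) ∂τ ∂ν) * G z ∂ρ := by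
  have hm3 : Measurable fun x : (X × Y) × Z => k x * G x.2 := hk.mul (hG.comp measurable_snd)
  have hm3' : Measurable fun x : (X × Z) × Y => k ((x.1.1, x.2), x.1.2) * G x.1.2 :=
    hm3.comp ((measurable_fst.fst.prodMk measurable_snd).prodMk measurable_fst.snd)
  calc _ = ∫⁻ x, ∫⁻ z, ∫⁻ y, k ((x, y), z) * G z ∂τ ∂ρ ∂ν := by
        refine lintegral_congr fun x => ?_
        refine lintegral_lintegral_swap (Measurable.aemeasurable ?_)
        exact hm3.comp ((measurable_const.prodMk measurable_fst).prodMk measurable_snd)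
    _ = ∫⁻ z, ∫⁻ x, ∫⁻ y, k ((x, y), z) * G z ∂τ ∂ν ∂ρ := by
        refine lintegral_lintegral_swap (Measurable.aemeasurable ?_)
        exact hm3'.lintegral_prod_right'
    _ = _ := by
        refine lintegral_congr fun z => ?_
        have hmw : Measurable fun x : X × Y => k (x, z) :=
          hk.comp (measurable_id.prodMk measurable_const)
        rw [← lintegral_mul_const _ hmw.lintegral_prod_right']
        refine lintegral_congr fun x => ?_
        exact lintegral_mul_const _ (hmw.comp (measurable_const.prodMk measurable_id))

/-- The sufficiency criterion with the norm of `f` replaced by the weighted norm of its image under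
the differential operator. -/
lemma exists_lintegral_enorm_rpow_le (hn : 0 < n) (m : ℕ) {σ p A : ℝ}
    (hp : 1 < p) (hA : ∀ k : ℕ, A ≠ -(k : ℝ)) {h : ℝ → ℝ} (hmeas : Measurable h)
    (hpos : ∀ x, 0 < x → 0 < h x) {D : ℝ} (hD : ∀ x y, 0 < x → x ≤ 240 * y → h x ≤ D * h y)
    (hint : ∫⁻ x in Ioo (0 : ℝ) 2, ENNReal.ofReal (h x ^ (1 / (p - 1)) / x) < ⊤)
    {μ : Measure (Cn n)} {K : ℝ} (hK : 0 < K) (hμ : ∀ ξ : Cn n, ‖ξ‖ = 1 → ∀ δ : ℝ, 0 < δ →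
      μ (carlesonTent n δ ξ) ≤ ENNReal.ofReal (K * (δ ^ (σ * p) * h δ))) :
    ∃ Q : ℝ≥0∞, Q ≠ ⊤ ∧ ∀ f : Cn n → ℂ, IsHolomorphicOnBall n f →
      ∫⁻ z in unitBall n, ‖f z‖ₑ ^ p ∂μ ≤ Q * ∫⁻ z, ‖eulerIter A (m + 1) f z‖ₑ ^ p
        ∂(ballWeight n (((m + 1 : ℕ) : ℝ) * p + σ * p - n - 1)) := by
  have hp0 : 0 < p := by linarith
  set c : ℝ := ((m + 1 : ℕ) : ℝ) * p + σ * p - n - 1 with hc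
  set e : ℝ := ((m + 1 : ℕ) : ℝ) * p - 1 - (n + 1) with he
  have hec : e + 1 + σ * p = c := by rw [he, hc]; ring
  have hen : e + (n + 1) = ((m + 1 : ℕ) : ℝ) * p - 1 := by rw [he]; ring
  obtain ⟨C₁, hC₁, hpt⟩ := exists_enorm_rpow_le (n := n) A hA m hp
  obtain ⟨C₂, hC₂, hM⟩ := exists_enorm_rpow_le_lintegral_ballWeight n hp c
  obtain ⟨C₃, hC₃, hav⟩ :=
    exists_mul_enorm_rpow_le_lintegral_averagingKernel (n := n) hn hpos hp e
  obtain ⟨C₄, hC₄, hker⟩ := exists_lintegral_averagingKernel_le hn hpos hD hK hμ e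
  rw [hen] at hav
  rw [hec] at hker
  clear_value c e
  have hμB : μ (unitBall n) < ⊤ := by
    have hξ : ‖EuclideanSpace.single (⟨0, hn⟩ : Fin n) (1 : ℂ)‖ = 1 := by simp
    rw [← carlesonTent_eq_unitBall le_rfl hξ]
    exact (hμ _ hξ 2 two_pos).trans_lt ENNReal.ofReal_lt_top
  have : IsFiniteMeasure (μ.restrict (unitBall n)) :=
    ⟨by rwa [Measure.restrict_apply_univ]⟩
  set H := (∫⁻ x in Ioo (0 : ℝ) 2, ENNReal.ofReal (h x ^ (1 / (p - 1)) / x)) ^ (p - 1) with hH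
  have hHfin : H < ⊤ := ENNReal.rpow_lt_top_of_nonneg (by linarith) hint.ne
  refine ⟨ENNReal.ofReal C₁ * (ENNReal.ofReal C₂ * μ (unitBall n) +
    ENNReal.ofReal C₃ * ENNReal.ofReal C₄ * H), ENNReal.mul_ne_top ENNReal.ofReal_ne_top
    (ENNReal.add_ne_top.2 ⟨ENNReal.mul_ne_top ENNReal.ofReal_ne_top hμB.ne,
      ENNReal.mul_ne_top (ENNReal.mul_ne_top ENNReal.ofReal_ne_top ENNReal.ofReal_ne_top)
        hHfin.ne⟩), fun f hf => ?_⟩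
  have hg : IsHolomorphicOnBall n (eulerIter A (m + 1) f) := hf.eulerIter A (m + 1)
  have hpt' := fun M => hpt f M hf
  generalize eulerIter A (m + 1) f = g at hg hpt' ⊢
  have hhol := fun z (hz : z ∈ unitBall n) => radial_lintegral_rpow_le hmeas hpos m hp hg hz
  rw [← hH] at hhol
  clear_value H
  set N := ∫⁻ z, ‖g z‖ₑ ^ p ∂(ballWeight n c) with hN
  -- if `N = ⊤` the right-hand side is `⊤`, unless `μ` vanishes on the ball
  rcases eq_or_ne N ⊤ with hNtop | hNtop
  · rcases eq_or_ne (μ (unitBall n)) 0 with h0 | h0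
    · rw [Measure.restrict_eq_zero.2 h0, lintegral_zero_measure]; exact zero_le
    · rw [hNtop, ENNReal.mul_top]
      · exact le_top
      · refine mul_ne_zero (ENNReal.ofReal_pos.2 hC₁).ne' ?_
        exact (add_pos_of_pos_of_nonneg
          (ENNReal.mul_pos (ENNReal.ofReal_pos.2 hC₂).ne' h0) zero_le).ne'
  set M := (ENNReal.ofReal C₂ * N).toReal ^ (1 / p) with hMdef
  have hM0 : 0 ≤ M := by positivity
  have hMfin : ENNReal.ofReal C₂ * N ≠ ⊤ := ENNReal.mul_ne_top ENNReal.ofReal_ne_top hNtop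
  have hMp : ENNReal.ofReal M ^ p = ENNReal.ofReal C₂ * N := by
    rw [ENNReal.ofReal_rpow_of_nonneg hM0 hp0.le, hMdef,
      ← Real.rpow_mul ENNReal.toReal_nonneg, one_div, inv_mul_cancel₀ hp0.ne', Real.rpow_one,
      ENNReal.ofReal_toReal hMfin]
  have hgM : ∀ w : Cn n, ‖w‖ ≤ 3 / 4 → ‖g w‖ ≤ M := fun w hw => by
    have h1 := hM g hg w hw
    rw [← hN, ← hMp] at h1
    have h2 := (ENNReal.rpow_le_rpow_iff hp0).1 h1
    rw [← ofReal_norm] at h2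
    exact (ENNReal.ofReal_le_ofReal_iff hM0).1 h2
  clear_value M
  set G : Cn n → ℝ≥0∞ := (unitBall n).indicator (fun w => ‖g w‖ₑ ^ p) with hG
  have hGm : Measurable G := by
    have e1 : G = fun w => ‖(unitBall n).indicator g w‖ₑ ^ p := by
      ext w
      by_cases hw : w ∈ unitBall n
      · simp only [hG, indicator_of_mem hw]
      · simp only [hG, indicator_of_notMem hw, enorm_zero, ENNReal.zero_rpow_of_pos hp0]
    rw [e1]
    exact (measurable_indicator_of_holomorphic hg).enorm.pow_const p
  have hfub : ∫⁻ z in unitBall n, ∫⁻ t in Ioc (1 / 2 : ℝ) 1,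
      ∫⁻ w, averagingKernel h e z t w * G w ∂volume ∂volume ∂μ ≤ ENNReal.ofReal C₄ * N := by
    refine (lintegral_lintegral_lintegral_mul
      (measurable_averagingKernel hmeas e) hGm _ _ _).trans_le ?_
    calc _ ≤ ∫⁻ w in unitBall n, ENNReal.ofReal C₄ *
            (ENNReal.ofReal ((1 - ‖w‖ ^ 2) ^ c) * ‖g w‖ₑ ^ p) := by
          rw [← lintegral_indicator isOpen_unitBall.measurableSet]
          refine lintegral_mono fun w => ?_
          by_cases hw : w ∈ unitBall n
          · rw [hG, indicator_of_mem hw, indicator_of_mem hw, ← mul_assoc,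
              ← ENNReal.ofReal_mul hC₄.le]
            exact mul_le_mul_left (hker w hw) _
          · rw [hG, indicator_of_notMem hw, mul_zero]; exact zero_le
      _ = _ := by
          rw [lintegral_const_mul' _ _ ENNReal.ofReal_ne_top, hN, lintegral_ballWeight]
  calc ∫⁻ z in unitBall n, ‖f z‖ₑ ^ p ∂μ
      ≤ ∫⁻ z in unitBall n, ENNReal.ofReal C₁ * (ENNReal.ofReal C₂ * N +
          (ENNReal.ofReal C₃ * ∫⁻ t in Ioc (1 / 2 : ℝ) 1,
            ∫⁻ w, averagingKernel h e z t w * G w) * H) ∂μ := by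
        refine setLIntegral_mono' isOpen_unitBall.measurableSet fun z hz => ?_
        refine (hpt' M hM0 hgM z hz).trans ?_
        rw [hMp]
        refine mul_le_mul_right (add_le_add_right ((hhol z hz).trans ?_) _) _
        refine mul_le_mul_left ?_ H
        rw [← lintegral_const_mul' _ _ ENNReal.ofReal_ne_top]
        exact setLIntegral_mono' measurableSet_Ioc fun t ht => hav g hg z hz t ht
    _ = ENNReal.ofReal C₁ * (ENNReal.ofReal C₂ * N * μ (unitBall n) +
          (ENNReal.ofReal C₃ * ∫⁻ z in unitBall n, ∫⁻ t in Ioc (1 / 2 : ℝ) 1,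
            ∫⁻ w, averagingKernel h e z t w * G w ∂volume ∂volume ∂μ) * H) := by
        rw [lintegral_const_mul' _ _ ENNReal.ofReal_ne_top,
          lintegral_add_left measurable_const, setLIntegral_const,
          lintegral_mul_const' _ _ hHfin.ne, lintegral_const_mul' _ _ ENNReal.ofReal_ne_top]
    _ ≤ ENNReal.ofReal C₁ * (ENNReal.ofReal C₂ * N * μ (unitBall n) +
          (ENNReal.ofReal C₃ * (ENNReal.ofReal C₄ * N)) * H) :=
        mul_le_mul_right (add_le_add_right (mul_le_mul_left (mul_le_mul_right hfub _) _) _) _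
    _ = _ := by ring

/-- The sufficiency criterion: if `μ(Q_δ(ξ))` is `O(δ^{σp} h(δ))`, where `h` is increasing and
doubling up to constants and `h(x)^{1/(p-1)} / x` is integrable at the origin, then `μ` is a
Carleson measure. -/
theorem isCarlesonForBesov_of_tent_bound (hn : 0 < n) {m : ℕ} (hm : 0 < m) {σ p α : ℝ}
    (hp : 1 < p) (hα : ∀ k : ℕ, (n : ℝ) + 1 + α ≠ -(k : ℝ)) {h : ℝ → ℝ} (hmeas : Measurable h)
    (hpos : ∀ x, 0 < x → 0 < h x) {D : ℝ} (hD : ∀ x y, 0 < x → x ≤ 240 * y → h x ≤ D * h y)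
    (hint : ∫⁻ x in Ioo (0 : ℝ) 2, ENNReal.ofReal (h x ^ (1 / (p - 1)) / x) < ⊤)
    {μ : Measure (Cn n)} {K : ℝ} (hK : 0 < K) (hμ : ∀ ξ : Cn n, ‖ξ‖ = 1 → ∀ δ : ℝ, 0 < δ →
      μ (carlesonTent n δ ξ) ≤ ENNReal.ofReal (K * (δ ^ (σ * p) * h δ))) :
    IsCarlesonForBesov n m σ p α μ := by
  have hp0 : 0 < p := by linarith
  obtain ⟨m, rfl⟩ : ∃ k, m = k + 1 := ⟨m - 1, by omega⟩
  obtain ⟨Q, hQfin, main⟩ := exists_lintegral_enorm_rpow_le hn m hp hα hmeas hpos hD hint hK hμ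
  set b : ℝ := |∏ j ∈ Finset.range (m + 1), ((n : ℝ) + 1 + α + j)|⁻¹ ^ p with hb
  have hb0 : 0 < b := by
    have : ∏ j ∈ Finset.range (m + 1), ((n : ℝ) + 1 + α + j) ≠ 0 :=
      Finset.prod_ne_zero_iff.2 fun j _ h0 => hα j (by linarith)
    positivity
  set v := volume (unitBall n) with hv
  have hv0 : v ≠ 0 := volume_unitBall_pos.ne'
  have hvt : v ≠ ⊤ := volume_unitBall_lt_top.ne
  set T := Q * (v * ENNReal.ofReal b⁻¹) with hT
  have hTfin : T ≠ ⊤ := ENNReal.mul_ne_top hQfin (ENNReal.mul_ne_top hvt ENNReal.ofReal_ne_top)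
  refine ⟨T.toReal + 1, by positivity, fun f hf => ?_⟩
  have hconv : ∀ x : ℂ, ENNReal.ofReal (‖x‖ ^ p) = ‖x‖ₑ ^ p := fun x => by
    rw [← ENNReal.ofReal_rpow_of_nonneg (norm_nonneg _) hp0.le, ofReal_norm]
  rw [besovNormPow_eq hα hf.1]
  simp only [hconv]
  refine (main f hf.1).trans ?_
  have hTle : T ≤ ENNReal.ofReal (T.toReal + 1) := by
    conv_lhs => rw [← ENNReal.ofReal_toReal hTfin]
    exact ENNReal.ofReal_le_ofReal (by linarith)
  refine le_trans (le_of_eq ?_) (mul_le_mul_left hTle _)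
  have hbb : ENNReal.ofReal b⁻¹ * ENNReal.ofReal b = 1 := by
    rw [← ENNReal.ofReal_mul (by positivity), inv_mul_cancel₀ hb0.ne', ENNReal.ofReal_one]
  set N := ∫⁻ z, ‖eulerIter (n + 1 + α) (m + 1) f z‖ₑ ^ p
    ∂(ballWeight n (((m + 1 : ℕ) : ℝ) * p + σ * p - n - 1)) with hN
  calc Q * N = Q * ((v * v⁻¹) * (ENNReal.ofReal b⁻¹ * ENNReal.ofReal b) * N) := by
        rw [ENNReal.mul_inv_cancel hv0 hvt, hbb, one_mul, one_mul]
    _ = _ := by rw [hT]; ring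

/-! ### Power and logarithmic weights -/

/-- The case `h(x) = x^ε` of the sufficiency criterion. -/
theorem isCarlesonForBesov_of_isPowerCarleson (hn : 0 < n) {m : ℕ} (hm : 0 < m) {σ p α ε : ℝ}
    (hp : 1 < p) (hα : ∀ k : ℕ, (n : ℝ) + 1 + α ≠ -(k : ℝ)) (hε : 0 < ε) {μ : Measure (Cn n)}
    (hμ : IsPowerCarleson n ((σ * p + ε) / n) μ) : IsCarlesonForBesov n m σ p α μ := by
  rw [isPowerCarleson_iff hn] at hμ
  obtain ⟨K, hK, hμ⟩ := hμ
  have hη : 0 < ε * (1 / (p - 1)) := mul_pos hε (one_div_pos.2 (by linarith))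
  refine isCarlesonForBesov_of_tent_bound hn hm hp hα (h := fun x => x ^ ε) (D := 240 ^ ε)
    (measurable_id.pow_const ε) (fun x hx => Real.rpow_pos_of_pos hx ε) (fun x y hx hxy => ?_) ?_
    hK (fun ξ hξ δ hδ => ?_)
  · rw [← Real.mul_rpow (by norm_num) (by linarith)]
    exact Real.rpow_le_rpow hx.le hxy hε.le
  · have hi : IntervalIntegrable (fun x : ℝ => x ^ (ε * (1 / (p - 1)) - 1)) volume 0 2 :=
      intervalIntegral.intervalIntegrable_rpow' (by linarith)
    rw [intervalIntegrable_iff_integrableOn_Ioo_of_le (by norm_num)] at hi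
    refine lt_of_eq_of_lt (setLIntegral_congr_fun measurableSet_Ioo fun x hx => ?_)
      hi.lintegral_lt_top
    rw [Real.rpow_sub_one hx.1.ne', Real.rpow_mul hx.1.le]
  · refine (hμ ξ hξ δ hδ).trans_eq ?_
    rw [Real.rpow_add hδ]

/-- The positive function `1 + log(1 + 1/x)`, comparable to `log(2/x)` for small `x`. -/
def logWeight (x : ℝ) : ℝ := 1 + Real.log (1 + 1 / x)

lemma one_le_logWeight {x : ℝ} (hx : 0 < x) : 1 ≤ logWeight x := by
  have : 0 ≤ Real.log (1 + 1 / x) := Real.log_nonneg (by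
    have : 0 < 1 / x := by positivity
    linarith)
  rw [logWeight]; linarith

lemma measurable_logWeight : Measurable logWeight := by
  unfold logWeight; fun_prop

lemma logWeight_le_of_le {x y : ℝ} (hx : 0 < x) (hxy : x ≤ 240 * y) :
    logWeight y ≤ (1 + Real.log 240) * logWeight x := by
  have hy : 0 < y := by linarith
  have h1 := one_le_logWeight hx
  have h240 : 0 ≤ Real.log 240 := Real.log_nonneg (by norm_num)
  have h2 : 1 + 1 / y ≤ 240 * (1 + 1 / x) := by
    have : 1 / y ≤ 240 * (1 / x) := by
      rw [mul_one_div, div_le_div_iff₀ hy hx]; linarith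
    linarith
  have h3 : Real.log (1 + 1 / y) ≤ Real.log 240 + Real.log (1 + 1 / x) := by
    rw [← Real.log_mul (by norm_num) (by positivity)]
    exact Real.log_le_log (by positivity) h2
  have h4 : logWeight y ≤ Real.log 240 + logWeight x := by
    rw [logWeight, logWeight]; linarith
  nlinarith

lemma one_sub_log_le_logWeight {x : ℝ} (hx : 0 < x) : 1 - Real.log x ≤ logWeight x := by
  have : Real.log (1 / x) ≤ Real.log (1 + 1 / x) := Real.log_le_log (by positivity) (by linarith)
  rw [one_div, Real.log_inv, ← one_div] at this
  rw [logWeight]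
  linarith

/-- `(1 - log x)^{-1-η} / x` is integrable at the origin: it is the derivative of
`(1 - log x)^{-η} / η`, which tends to `0` there. -/
lemma integrableOn_one_sub_log_rpow_div {η : ℝ} (hη : 0 < η) :
    IntegrableOn (fun x : ℝ => (1 - Real.log x) ^ (-η - 1) / x) (Ioc 0 2) := by
  have hlog : ∀ x : ℝ, 0 < x → x ≤ 2 → 0 < 1 - Real.log x := fun x hx hx2 => by
    have h1 := Real.log_le_log hx hx2
    have h2 := Real.log_two_lt_d9
    linarith
  have hder : ∀ x : ℝ, 0 < x → x ≤ 2 → HasDerivAt (fun x => (1 - Real.log x) ^ (-η) / η)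
      ((1 - Real.log x) ^ (-η - 1) / x) x := fun x hx hx2 => by
    have h1 := ((Real.hasDerivAt_log hx.ne').const_sub 1).rpow_const (p := -η)
      (Or.inl (hlog x hx hx2).ne')
    refine (h1.div_const η).congr_deriv ?_
    field_simp
  refine intervalIntegral.integrableOn_deriv_of_nonneg
    (g := Function.update (fun x => (1 - Real.log x) ^ (-η) / η) 0 0) ?_ ?_ ?_
  · intro x hx
    rcases eq_or_lt_of_le hx.1 with rfl | hx0
    · rw [continuousWithinAt_update_same]
      have h1 : Filter.Tendsto (fun x : ℝ => 1 - Real.log x) (𝓝[>] 0) Filter.atTop := by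
        have h0 : Filter.Tendsto (fun x : ℝ => -Real.log x) (𝓝[>] 0) Filter.atTop :=
          Filter.tendsto_neg_atBot_atTop.comp Real.tendsto_log_nhdsGT_zero
        simpa only [sub_eq_add_neg] using Filter.tendsto_atTop_add_const_left _ 1 h0
      have h2 := ((tendsto_rpow_neg_atTop hη).comp h1).div_const η
      rw [zero_div] at h2
      refine h2.mono_left (nhdsWithin_mono _ fun y hy => ?_)
      exact lt_of_le_of_ne hy.1.1 (Ne.symm hy.2)
    · refine ContinuousAt.continuousWithinAt ?_
      rw [continuousAt_update_of_ne hx0.ne']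
      exact (hder x hx0 hx.2).continuousAt
  · intro x hx
    refine (hder x hx.1 hx.2.le).congr_of_eventuallyEq ?_
    filter_upwards [isOpen_ne.mem_nhds hx.1.ne'] with y hy
    exact Function.update_of_ne hy _ _
  · intro x hx
    have := hlog x hx.1 hx.2.le
    have := hx.1
    positivity

/-- A logarithmic Carleson measure has finite mass, because two opposite tents cover the ball. -/
lemma exists_measure_unitBall_le_of_isLogCarleson (hn : 0 < n) {a : ℝ} {μ : Measure (Cn n)}
    (hμ : IsLogCarleson n a μ) : ∃ M : ℝ, 0 < M ∧ μ (unitBall n) ≤ ENNReal.ofReal M := by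
  rw [isLogCarleson_iff] at hμ
  obtain ⟨K, hK, hμ⟩ := hμ
  set ξ : Cn n := EuclideanSpace.single (⟨0, hn⟩ : Fin n) (1 : ℂ) with hξdef
  have hξ : ‖ξ‖ = 1 := by simp [hξdef]
  have hδ : (3 / 2 : ℝ) ∈ Ioo (0 : ℝ) 2 := by norm_num
  have hb : 0 < K * Real.log (2 / (3 / 2)) ^ a :=
    mul_pos hK (Real.rpow_pos_of_pos (log_two_div_pos hδ) a)
  have hcov : unitBall n ⊆ carlesonTent n (3 / 2) ξ ∪ carlesonTent n (3 / 2) (-ξ) := by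
    have key : ∀ u : ℂ, ‖u‖ ≤ 1 → 0 ≤ u.re → ‖1 - u‖ < 3 / 2 := fun u hu hre => by
      refine lt_of_pow_lt_pow_left₀ 2 (by norm_num) ?_
      have h1 : ‖u‖ ^ 2 ≤ 1 := pow_le_one₀ (norm_nonneg u) hu
      rw [← Complex.normSq_eq_norm_sq, Complex.normSq_apply] at h1 ⊢
      simp only [Complex.sub_re, Complex.sub_im, Complex.one_re, Complex.one_im]
      nlinarith
    intro z hz
    have hu : ‖(inner ℂ ξ z : ℂ)‖ ≤ 1 := by
      have h1 := norm_inner_le_norm (𝕜 := ℂ) ξ z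
      rw [hξ, one_mul] at h1
      exact h1.trans (mem_unitBall.1 hz).le
    rcases le_total 0 (inner ℂ ξ z : ℂ).re with h0 | h0
    · exact Or.inl ⟨hz, key _ hu h0⟩
    · refine Or.inr ⟨hz, ?_⟩
      rw [inner_neg_left]
      exact key _ (by rwa [norm_neg]) (by rw [Complex.neg_re]; linarith)
  refine ⟨_, add_pos hb hb, ?_⟩
  rw [ENNReal.ofReal_add hb.le hb.le]
  exact (measure_mono hcov).trans ((measure_union_le _ _).trans
    (add_le_add (hμ ξ hξ _ hδ) (hμ (-ξ) (by rwa [norm_neg]) _ hδ)))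

/-- The sufficiency criterion with `h = logWeight ^ (-(p - 1 + ε))`: then `h^{1/(p-1)}` is the power
`-1 - ε/(p-1)` of a logarithm. -/
theorem isCarlesonForBesov_of_isLogCarleson (hn : 0 < n) {m : ℕ} (hm : 0 < m) {p α ε : ℝ}
    (hp : 1 < p) (hα : ∀ k : ℕ, (n : ℝ) + 1 + α ≠ -(k : ℝ)) (hε : 0 < ε) {μ : Measure (Cn n)}
    (hμ : IsLogCarleson n (1 - p - ε) μ) : IsCarlesonForBesov n m 0 p α μ := by
  obtain ⟨M, hM0, hM⟩ := exists_measure_unitBall_le_of_isLogCarleson hn hμ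
  rw [isLogCarleson_iff] at hμ
  obtain ⟨K, hK, hμ⟩ := hμ
  set β := p - 1 + ε with hβ
  have hβ0 : 0 < β := by linarith
  have hp1 : 0 < p - 1 := by linarith
  have hβ' : 1 - p - ε = -β := by rw [hβ]; ring
  rw [hβ'] at hμ
  have h240 : 0 ≤ Real.log 240 := Real.log_nonneg (by norm_num)
  refine isCarlesonForBesov_of_tent_bound hn hm hp hα (h := fun x => logWeight x ^ (-β))
    (D := (1 + Real.log 240) ^ β) (measurable_logWeight.pow_const _)
    (fun x hx => Real.rpow_pos_of_pos (by linarith [one_le_logWeight hx]) _)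
    (fun x y hx hxy => ?_) ?_ (K := K * 3 ^ β + M * 2 ^ β) (by positivity)
    (fun ξ hξ δ hδ => ?_)
  · have h1 := one_le_logWeight hx
    have h2 := one_le_logWeight (show 0 < y by linarith)
    have h3 := Real.rpow_le_rpow (by linarith) (logWeight_le_of_le hx hxy) hβ0.le
    rw [Real.mul_rpow (by linarith) (by linarith)] at h3
    have hx' : 0 < logWeight x ^ β := by positivity
    have hy' : 0 < logWeight y ^ β := by positivity
    rw [Real.rpow_neg (by linarith), Real.rpow_neg (by linarith), inv_eq_one_div,
      ← div_eq_mul_inv, div_le_div_iff₀ hx' hy']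
    linarith
  · set η := ε / (p - 1) with hη
    have hη0 : 0 < η := by positivity
    refine lt_of_le_of_lt ?_ ((integrableOn_one_sub_log_rpow_div hη0).mono_set
      Ioo_subset_Ioc_self).lintegral_lt_top
    refine setLIntegral_mono' measurableSet_Ioo fun x hx => ENNReal.ofReal_le_ofReal ?_
    have h1 := one_le_logWeight hx.1
    have h2 : 0 < 1 - Real.log x := by
      have h3 := Real.log_le_log hx.1 hx.2.le
      have h4 := Real.log_two_lt_d9
      linarith
    have e : -β * (1 / (p - 1)) = -η - 1 := by rw [hβ, hη]; field_simp; ring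
    rw [← Real.rpow_mul (by linarith), e]
    have hx0 := hx.1
    gcongr ?_ / x
    exact Real.rpow_le_rpow_of_nonpos h2 (one_sub_log_le_logWeight hx.1) (by linarith)
  · have hL := one_le_logWeight hδ
    have hh : 0 < logWeight δ ^ (-β) := by positivity
    rw [zero_mul, Real.rpow_zero, one_mul]
    rcases le_or_gt δ 1 with hδ1 | hδ1
    · refine (hμ ξ hξ δ ⟨hδ, by linarith⟩).trans (ENNReal.ofReal_le_ofReal ?_)
      have hl2 := Real.log_two_gt_d9
      have h1 : Real.log 2 ≤ Real.log (2 / δ) :=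
        Real.log_le_log two_pos (by rw [le_div_iff₀ hδ]; linarith)
      have h2 : Real.log (1 + 1 / δ) ≤ Real.log (2 / δ) := by
        refine Real.log_le_log (by positivity) ?_
        rw [le_div_iff₀ hδ, add_mul, one_div, inv_mul_cancel₀ hδ.ne']
        linarith
      have h3 : logWeight δ / 3 ≤ Real.log (2 / δ) := by
        rw [logWeight]; linarith
      have h4 : Real.log (2 / δ) ^ (-β) ≤ (logWeight δ / 3) ^ (-β) :=
        Real.rpow_le_rpow_of_nonpos (by linarith) h3 (by linarith)
      rw [Real.div_rpow (by linarith) (by norm_num), Real.rpow_neg (by norm_num : (0 : ℝ) ≤ 3),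
        div_inv_eq_mul] at h4
      calc K * Real.log (2 / δ) ^ (-β) ≤ K * (logWeight δ ^ (-β) * 3 ^ β) := by gcongr
        _ = K * 3 ^ β * logWeight δ ^ (-β) := by ring
        _ ≤ _ := by
          gcongr
          have : 0 ≤ M * 2 ^ β := by positivity
          linarith
    · refine (measure_mono (carlesonTent_subset δ ξ)).trans
        (hM.trans (ENNReal.ofReal_le_ofReal ?_))
      have h1 : logWeight δ ≤ 2 := by
        have h2 : 1 / δ ≤ 1 := by rw [div_le_one hδ]; exact hδ1.le
        have h3 := Real.log_le_sub_one_of_pos (show 0 < 1 + 1 / δ by positivity)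
        rw [logWeight]; linarith
      have h2 : (2 : ℝ) ^ (-β) ≤ logWeight δ ^ (-β) :=
        Real.rpow_le_rpow_of_nonpos (by linarith) h1 (by linarith)
      have h3 : (2 : ℝ) ^ β * 2 ^ (-β) = 1 := by
        rw [← Real.rpow_add two_pos]; simp
      calc M = M * (2 ^ β * 2 ^ (-β)) := by rw [h3, mul_one]
        _ ≤ M * (2 ^ β * logWeight δ ^ (-β)) := by gcongr
        _ = M * 2 ^ β * logWeight δ ^ (-β) := by ring
        _ ≤ _ := by
          gcongr
          have : 0 ≤ K * 3 ^ β := by positivity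
          linarith

end BesovSobolev

end

open BesovSobolev in
theorem theorem2p1 (n m : ℕ) (hn : 1 < n) (hm : 0 < m) (σ p α : ℝ)
    (hσ : 0 ≤ σ) (hp : 1 < p) (hmσ : (n : ℝ) / p < (m : ℝ) + σ)
    (hα : ∀ k : ℕ, 0 < k → (n : ℝ) + α ≠ -(k : ℝ))
    (hαm : ∀ k : ℕ, 0 < k → (n : ℝ) + α + m ≠ -(k : ℝ))
    (μ : MeasureTheory.Measure (Cn n)) :
    (0 < σ →
      (IsCarlesonForBesov n m σ p α μ → IsPowerCarleson n (σ * p / n) μ) ∧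
      (∀ ε : ℝ, 0 < ε → IsPowerCarleson n ((σ * p + ε) / n) μ →
        IsCarlesonForBesov n m σ p α μ)) ∧
    (σ = 0 →
      (IsCarlesonForBesov n m 0 p α μ → IsLogCarleson n (1 - p) μ) ∧
      (∀ ε : ℝ, 0 < ε → IsLogCarleson n (1 - p - ε) μ →
        IsCarlesonForBesov n m 0 p α μ)) := by
  have hn0 : 0 < n := by omega
  have hp0 : 0 < p := by linarith
  have hA : ∀ k : ℕ, (n : ℝ) + 1 + α ≠ -(k : ℝ) := fun k h =>
    hα (k + 1) k.succ_pos (by push_cast; linarith)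
  have hq : (n : ℝ) < m * p + σ * p := by
    rw [div_lt_iff₀ hp0] at hmσ
    linarith
  refine ⟨fun hσ0 => ⟨isPowerCarleson_of_isCarlesonForBesov hn0 hm hσ0 hp0 hq hA, fun ε hε =>
    isCarlesonForBesov_of_isPowerCarleson hn0 hm hp hA hε⟩, ?_⟩
  rintro rfl
  exact ⟨isLogCarleson_of_isCarlesonForBesov hn0 hm hp (by linarith) hA, fun ε hε =>
    isCarlesonForBesov_of_isLogCarleson hn0 hm hp hA hε⟩
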